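/- **Setting.** Let $M$ be a smooth manifold (finite-dimensional, Hausdorff, second countable), $\mathbb K=\mathbb R$ or $\mathbb C$, $R=C^\infty(M,\mathbb K)$, $T_{\mathbb K}M=TM\otimes_{\mathbb R}\mathbb K$, and let $F\subset T_{\mathbb K}M$ be an integrable distribution, i.e. a smooth $\mathbb K$-subbundle with $[\Gamma(F),\Gamma(F)]\subset\Gamma(F)$. Let $B=T_{\mathbb K}M/F$, with projection $\mathrm{pr}_B:T_{\mathbb K}M\to B$ and the Bott $F$-connection $\nabla_V\,\mathrm{pr}_B(X)=\mathrm{pr}_B([V,X])$. Let $j:B\to T_{\mathbb K}M$ be a splitting of $$0\to F\to T_{\mathbb K}M\xrightarrow{\mathrm{pr}_B}B\to 0,$$ and $\mathrm{pr}_F=\mathrm{id}-j\circ\mathrm{pr}_B:T_{\mathbb K}M\to F$. For an $F$-module $P$ let $\Omega_F^\bullet(P)=\Gamma(\wedge^\bullet F^\vee\otimes P)$, with its Chevalley–Eilenberg differential; $\Omega_F=\Omega_F^\bullet(\mathbb K)$ is the algebra of functions on the dg manifold $F[1]$ with homological vector field $d_F$, and $\pi^*:R=\Omega^0_F\hookrightarrow\Omega_F$.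 For $m,n\ge 0$ let $\mathbb T_m^n(B)=(B^\vee)^{\otimes m}\otimes B^{\otimes n}$ with the induced $F$-module structure, and let $d_B$ be the Chevalley–Eilenberg differential on $\Omega_F^\bullet(\mathbb T_m^n(B))$. Let $\mathfrak X(F[1])$ be the graded $\Omega_F$-module of graded $\mathbb K$-derivations of $\Omega_F$, with $L_{d_F}=[d_F,\cdot\,]$; let $\Omega^1(F[1])=\mathfrak X(F[1])^\vee$ be its graded $\Omega_F$-dual, with $\langle L_{d_F}\alpha,\mathcal X\rangle=d_F\langle\alpha,\mathcal X\rangle-(-1)^{|\alpha|}\langle\alpha,L_{d_F}\mathcal X\rangle$; and let $$\mathfrak T_m^n(T(F[1]))=\Omega^1(F[1])^{\otimes m}\otimes\mathfrak X(F[1])^{\otimes n}$$ (tensor products over $\Omega_F$) be the $(n,m)$-tensor fields, with $L_{d_F}$ extended by the graded Leibniz rule. A *contraction* from a complex $(E,d_E)$ onto $(Y,d_Y)$, both dg $\Omega_F$-modules, is a triple $(p,i,h)$ of graded $\Omega_F$-linear maps $p:E\to Y$, $i:Y\to E$ of degree $0$ commuting with the differentials and $h:E\to E$ of degree $-1$ such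 that $p\,i=\mathrm{id}$, $i\,p+d_Eh+hd_E=\mathrm{id}$, and $h\,i=0$, $p\,h=0$, $h^2=0$. **Statement.** 1. Let $\pi_*:\mathfrak X(F[1])\to\Omega_F^\bullet(T_{\mathbb K}M)$, $\pi_*(\mathcal X)(f)=\mathcal X(\pi^*f)$, and $\phi=\mathrm{pr}_B\circ\pi_*:\mathfrak X(F[1])\to\Omega^\bullet_F(B)$. There is an $\Omega_F$-linear map $\psi_j:\Omega_F^\bullet(B)\to\mathfrak X(F[1])$ such that, for $Z\in\Gamma(B)$, $f\in R$, $\xi\in\Omega_F^1$, $V\in\Gamma(F)$, the form $\psi_j(Z)(\xi)$ has degree $1$ and $$\psi_j(Z)(\pi^*f)=j(Z)(f),\qquad \psi_j(Z)(\xi)(V)=j(Z)\big(\xi(V)\big)-\xi\big(\mathrm{pr}_F[j(Z),V]\big),$$ and there is a map $h_j:\mathfrak X(F[1])\to\mathfrak X(F[1])$ with $h_j(\mathcal X)=(-1)^{|\mathcal X|}\iota_{\mathrm{pr}_F(\pi_*\mathcal X)}$, where $\iota_{\alpha\otimes V}\omega=\alpha\wedge\iota_V\omega$. The triple $(\phi,\psi_j,h_j)$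 is a contraction from $(\mathfrak X(F[1]),L_{d_F})$ onto $(\Omega_F^\bullet(B),d_B)$. 2. There are maps $\phi^\vee,\psi_j^\vee,h_j^\vee$ which are $\Omega_F$-dual to $\phi,\psi_j,h_j$, namely $\langle\phi^\vee\beta,\mathcal X\rangle=\langle\beta,\phi\mathcal X\rangle$, $\langle\psi_j^\vee\alpha,z\rangle=\langle\alpha,\psi_jz\rangle$, $\langle h_j^\vee\alpha,\mathcal X\rangle=(-1)^{|\alpha|}\langle\alpha,h_j\mathcal X\rangle$, and $(\psi_j^\vee,\phi^\vee,h_j^\vee)$ is a contraction from $(\Omega^1(F[1]),L_{d_F})$ onto $(\Omega_F^\bullet(B^\vee),d_B)$. 3. For all $m,n\ge 0$ the maps $$\Phi_m^n=(\psi_j^\vee)^{\otimes m}\otimes\phi^{\otimes n},\qquad \Psi_m^n=(\phi^\vee)^{\otimes m}\otimes\psi_j^{\otimes n},$$ $$H_m^n=\sum_{i=1}^m(\phi^\vee\psi_j^\vee)^{\otimes(i-1)}\otimes h_j^\vee\otimes\mathrm{id}^{\otimes(n+m-i)}+\sum_{l=1}^n(\phi^\vee\psi_j^\vee)^{\otimes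 m}\otimes(\psi_j\phi)^{\otimes(l-1)}\otimes h_j\otimes\mathrm{id}^{\otimes(n-l)}$$ (with the Koszul sign rule) are well defined, and $(\Phi_m^n,\Psi_m^n,H_m^n)$ is a contraction from $(\mathfrak T_m^n(T(F[1])),L_{d_F})$ onto $(\Omega_F^\bullet(\mathbb T_m^n(B)),d_B)$. That is, $\Phi_m^n,\Psi_m^n$ are cochain maps and $$\Phi_m^n\Psi_m^n=\mathrm{id},\qquad \Psi_m^n\Phi_m^n+[L_{d_F},H_m^n]=\mathrm{id},$$ $$H_m^n\Psi_m^n=0,\qquad \Phi_m^nH_m^n=0,\qquad H_m^nH_m^n=0.$$ -/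

import Mathlib

noncomputable section

namespace FoliationDG

universe u v w

/-! ### Alternating forms, interior product and wedge product -/

section Forms

variable {R : Type*} [CommRing R] {L : Type*} [AddCommGroup L] [Module R L]
variable {E E' E'' E''' E₁ E₂ : Type*} [AddCommGroup E] [Module R E] [AddCommGroup E'] [Module R E']
  [AddCommGroup E''] [Module R E''] [AddCommGroup E'''] [Module R E''']
  [AddCommGroup E₁] [Module R E₁] [AddCommGroup E₂] [Module R E₂]

variable (R L E) in
/-- `E`-valued alternating forms on the `R`-module `L`; the component `ω n` is the part of
degree `n`.  (If `L` is locally generated by `r` elements, the parts of degree `> r` vanish, so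
that this is the direct sum of the modules of `n`-forms.) -/
def Forms : Type _ := ∀ n : ℕ, L [⋀^Fin n]→ₗ[R] E

namespace Forms

instance : AddCommGroup (Forms R L E) :=
  inferInstanceAs (AddCommGroup (∀ n : ℕ, L [⋀^Fin n]→ₗ[R] E))

instance : Module R (Forms R L E) :=
  inferInstanceAs (Module R (∀ n : ℕ, L [⋀^Fin n]→ₗ[R] E))

theorem add_app (a b : Forms R L E) (n : ℕ) (v : Fin n → L) : (a + b) n v = a n v + b n v := rfl
theorem neg_app (a : Forms R L E) (n : ℕ) (v : Fin n → L) : (-a) n v = -a n v := rfl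
theorem sub_app (a b : Forms R L E) (n : ℕ) (v : Fin n → L) : (a - b) n v = a n v - b n v := rfl
theorem zero_app (n : ℕ) (v : Fin n → L) : (0 : Forms R L E) n v = 0 := rfl
theorem smul_app (f : R) (a : Forms R L E) (n : ℕ) (v : Fin n → L) :
    (f • a) n v = f • a n v := rfl

theorem ext_app {a b : Forms R L E} (h : ∀ n v, a n v = b n v) : a = b :=
  funext fun n => AlternatingMap.ext (h n)

/-- Elements of `E` as forms of degree `0`. -/
def const (e : E) : Forms R L E
  | 0 => AlternatingMap.constOfIsEmpty R L (Fin 0) e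
  | _ + 1 => 0

theorem const_zero_app (e : E) (v : Fin 0 → L) : (const e : Forms R L E) 0 v = e := rfl
theorem const_succ_app (e : E) (n : ℕ) (v : Fin (n + 1) → L) :
    (const e : Forms R L E) (n + 1) v = 0 := rfl

theorem const_add (e e' : E) : (const (e + e') : Forms R L E) = const e + const e' := by
  refine ext_app fun n v => ?_
  cases n <;> simp [add_app, const_zero_app, const_succ_app]

/-- The grading: `ω` is homogeneous of degree `k` if all other components vanish. -/
def deg (k : ℤ) : AddSubgroup (Forms R L E) where
  carrier := {ω | ∀ n : ℕ, (n : ℤ) ≠ k → ω n = 0}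
  zero_mem' := fun _ _ => rfl
  add_mem' := fun ha hb n hn => by
    have h1 := ha n hn
    have h2 := hb n hn
    refine AlternatingMap.ext fun v => ?_
    rw [add_app, h1, h2]; simp
  neg_mem' := fun ha n hn => by
    have h1 := ha n hn
    refine AlternatingMap.ext fun v => ?_
    rw [neg_app, h1]; simp

/-- The parity operator `ω ↦ (-1)^|ω| ω`. -/
def par : Forms R L E →+ Forms R L E where
  toFun ω := fun n => (-1 : ℤ) ^ n • ω n
  map_zero' := funext fun _ => smul_zero _
  map_add' _ _ := funext fun _ => smul_add _ _ _

theorem par_app (a : Forms R L E) (n : ℕ) (v : Fin n → L) :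
    par a n v = (-1 : ℤ) ^ n • a n v := rfl

theorem par_par (a : Forms R L E) : par (par a) = a := by
  refine ext_app fun n v => ?_
  rw [par_app, par_app, smul_smul, ← mul_pow]; simp

theorem par_smul (f : R) (a : Forms R L E) : par (f • a) = f • par a := by
  refine ext_app fun n v => ?_
  rw [par_app, smul_app, smul_app, par_app, smul_comm]

theorem par_const (e : E) : par (const e : Forms R L E) = const e := by
  refine ext_app fun n v => ?_
  rw [par_app]
  cases n <;> simp [const_zero_app, const_succ_app]

/-- The interior product: `(ι_x ω)(v₁,…,vₙ) = ω(x,v₁,…,vₙ)`. -/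
def ins (x : L) : Forms R L E →ₗ[R] Forms R L E where
  toFun ω := fun n => (ω (n + 1)).curryLeft x
  map_add' _ _ := rfl
  map_smul' _ _ := rfl

theorem ins_app (x : L) (ω : Forms R L E) (n : ℕ) (v : Fin n → L) :
    ins x ω n v = ω (n + 1) (Fin.cons x v) := rfl

theorem succ_app (ω : Forms R L E) (n : ℕ) (v : Fin (n + 1) → L) :
    ω (n + 1) v = ins (v 0) ω n (Fin.tail v) := by
  rw [ins_app, Fin.cons_self_tail]

theorem ins_add_left (x y : L) (ω : Forms R L E) : ins (x + y) ω = ins x ω + ins y ω :=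
  ext_app fun n v => by
    have := congrArg (fun T => T v) ((ω (n + 1)).curryLeft.map_add x y)
    exact this

theorem ins_smul_left (f : R) (x : L) (ω : Forms R L E) : ins (f • x) ω = f • ins x ω :=
  ext_app fun n v => by
    have := congrArg (fun T => T v) ((ω (n + 1)).curryLeft.map_smul f x)
    exact this

theorem ins_sub_left (x y : L) (ω : Forms R L E) : ins (x - y) ω = ins x ω - ins y ω :=
  ext_app fun n v => by
    have := congrArg (fun T => T v) ((ω (n + 1)).curryLeft.map_sub x y)
    exact this

theorem ins_self (x : L) (ω : Forms R L E) : ins x (ins x ω) = 0 :=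
  ext_app fun n v => by
    have := congrArg (fun T => T v) ((ω (n + 2)).curryLeft_same x)
    exact this

theorem ins_comm (x y : L) (ω : Forms R L E) : ins x (ins y ω) = -ins y (ins x ω) := by
  have h := ins_self (x + y) ω
  rw [ins_add_left, ins_add_left, map_add, map_add, ins_self, ins_self, zero_add, add_zero] at h
  exact eq_neg_of_add_eq_zero_left h

theorem ins_par (x : L) (ω : Forms R L E) : ins x (par ω) = -par (ins x ω) :=
  ext_app fun n v => by
    rw [ins_app, par_app, neg_app, par_app, ins_app, pow_succ]; simp

theorem ins_const (x : L) (e : E) : ins x (const e : Forms R L E) = 0 := rfl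

theorem eq_of_ins {a b : Forms R L E} (h0 : ∀ v, a 0 v = b 0 v) (h : ∀ x, ins x a = ins x b) :
    a = b := by
  refine ext_app fun n v => ?_
  cases n with
  | zero => exact h0 v
  | succ n => rw [succ_app, succ_app, h]

/-- A function of `n + 1` arguments is an alternating map if it is alternating in the last `n` of
them, linear in the first, and vanishes when the first two agree. -/
theorem exists_alternating {n : ℕ} (g : (Fin (n + 1) → L) → E) (T : L → L [⋀^Fin n]→ₗ[R] E)
    (hT : ∀ v, g v = T (v 0) (Fin.tail v)) (hadd : ∀ x y w, T (x + y) w = T x w + T y w)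
    (hsmul : ∀ (f : R) x w, T (f • x) w = f • T x w)
    (h0 : ∀ x w (i : Fin n), (i : ℕ) = 0 → w i = x → T x w = 0) :
    ∃ η : L [⋀^Fin (n + 1)]→ₗ[R] E, ∀ v, η v = g v := by
  have key : ∀ x w (i : Fin n), w i = x → T x w = 0 := by
    intro x w i hi
    by_cases h : (i : ℕ) = 0
    · exact h0 x w i h hi
    · have hn : 0 < n := lt_of_le_of_lt (Nat.zero_le _) i.2
      have hne : (⟨0, hn⟩ : Fin n) ≠ i := fun e => h (by rw [← e])
      have hs := (T x).map_swap w hne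
      have := h0 x (w ∘ Equiv.swap ⟨0, hn⟩ i) ⟨0, hn⟩ rfl (by simp [hi])
      rw [this] at hs
      exact (neg_eq_zero.mp hs.symm)
  let Tl : L →ₗ[R] MultilinearMap R (fun _ : Fin n => L) E :=
    { toFun := fun x => (T x).toMultilinearMap
      map_add' := fun x y => MultilinearMap.ext (hadd x y)
      map_smul' := fun f x => MultilinearMap.ext (hsmul f x) }
  let U : MultilinearMap R (fun _ : Fin (n + 1) => L) E := LinearMap.uncurryLeft Tl
  have hU : ∀ v, U v = T (v 0) (Fin.tail v) := fun v => rfl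
  have hU0 : ∀ (v : Fin (n + 1) → L) (i j : Fin (n + 1)), v i = v j → i ≠ j → U v = 0 := ?_
  · exact ⟨{ U with map_eq_zero_of_eq' := hU0 }, fun v => ((hT v).trans (hU v).symm).symm⟩
  intro v i j hv hij
  rw [hU]
  cases i using Fin.cases with
  | zero =>
    cases j using Fin.cases with
    | zero => exact absurd rfl hij
    | succ j => exact key _ _ j hv.symm
  | succ i =>
    cases j using Fin.cases with
    | zero => exact key _ _ i hv
    | succ j =>
      exact (T (v 0)).map_eq_zero_of_eq _ hv (fun e => hij (congrArg _ e))

/-- The alternating map with a given underlying function. -/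
def ofFun {n : ℕ} (g : (Fin n → L) → E) (h : ∃ η : L [⋀^Fin n]→ₗ[R] E, ∀ v, η v = g v) :
    L [⋀^Fin n]→ₗ[R] E where
  toFun := g
  map_update_add' := fun v i x y => by
    obtain ⟨η, h⟩ := h
    simp only [← h]; convert η.map_update_add v i x y
  map_update_smul' := fun v i x y => by
    obtain ⟨η, h⟩ := h
    simp only [← h]; convert η.map_update_smul v i x y
  map_eq_zero_of_eq' := fun v i j hv hij => by
    obtain ⟨η, h⟩ := h
    simp only [← h]; exact η.map_eq_zero_of_eq v hv hij

/-! The wedge product along a bilinear map `B`: the shuffle product, written through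
`(a ∧ b)₀ = B(a₀, b₀)` and `ι_x (a ∧ b) = ι_x a ∧ b + (-1)^|a| a ∧ ι_x b`. -/

/-- Values of the wedge product along `B` in degree `n`. -/
def wedgeAux (B : E →ₗ[R] E' →ₗ[R] E'') :
    ∀ n : ℕ, Forms R L E → Forms R L E' → (Fin n → L) → E''
  | 0, a, b, v => B (a 0 v) (b 0 v)
  | n + 1, a, b, v => wedgeAux B n (ins (v 0) a) b (Fin.tail v)
      + wedgeAux B n (par a) (ins (v 0) b) (Fin.tail v)

variable (B : E →ₗ[R] E' →ₗ[R] E'')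

theorem wedgeAux_add_left (n : ℕ) : ∀ (a a' : Forms R L E) (b : Forms R L E') (v),
    wedgeAux B n (a + a') b v = wedgeAux B n a b v + wedgeAux B n a' b v := by
  induction n with
  | zero => intro a a' b v; simp [wedgeAux, add_app]
  | succ n ih => intro a a' b v; simp only [wedgeAux, map_add, ih]; abel

theorem wedgeAux_add_right (n : ℕ) : ∀ (a : Forms R L E) (b b' : Forms R L E') (v),
    wedgeAux B n a (b + b') v = wedgeAux B n a b v + wedgeAux B n a b' v := by
  induction n with
  | zero => intro a b b' v; simp [wedgeAux, add_app]
  | succ n ih => intro a b b' v; simp only [wedgeAux, map_add, ih]; abel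

theorem wedgeAux_smul_left (n : ℕ) : ∀ (f : R) (a : Forms R L E) (b : Forms R L E') (v),
    wedgeAux B n (f • a) b v = f • wedgeAux B n a b v := by
  induction n with
  | zero => intro f a b v; simp [wedgeAux, smul_app]
  | succ n ih => intro f a b v; simp only [wedgeAux, map_smul, par_smul, ih, smul_add]

theorem wedgeAux_smul_right (n : ℕ) : ∀ (f : R) (a : Forms R L E) (b : Forms R L E') (v),
    wedgeAux B n a (f • b) v = f • wedgeAux B n a b v := by
  induction n with
  | zero => intro f a b v; simp [wedgeAux, smul_app]
  | succ n ih => intro f a b v; simp only [wedgeAux, map_smul, ih, smul_add]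

theorem wedgeAux_zero_left (n : ℕ) (b : Forms R L E') (v) :
    wedgeAux B n (0 : Forms R L E) b v = 0 := by
  simpa using wedgeAux_smul_left B n 0 0 b v

theorem wedgeAux_zero_right (n : ℕ) (a : Forms R L E) (v) :
    wedgeAux B n a (0 : Forms R L E') v = 0 := by
  simpa using wedgeAux_smul_right B n 0 a 0 v

theorem wedgeAux_neg_left (n : ℕ) (a : Forms R L E) (b : Forms R L E') (v) :
    wedgeAux B n (-a) b v = -wedgeAux B n a b v := by
  have := wedgeAux_smul_left B n (-1) a b v
  simpa using this

theorem wedgeAux_exists (n : ℕ) : ∀ (a : Forms R L E) (b : Forms R L E'),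
    ∃ η : L [⋀^Fin n]→ₗ[R] E'', ∀ v, η v = wedgeAux B n a b v := by
  induction n with
  | zero =>
    intro a b
    refine ⟨AlternatingMap.constOfIsEmpty R L (Fin 0) (B (a 0 0) (b 0 0)), fun v => ?_⟩
    rw [Subsingleton.elim v 0]; rfl
  | succ n ih =>
    intro a b
    choose W hW using ih
    refine exists_alternating _ (fun x => W (ins x a) b + W (par a) (ins x b)) ?_ ?_ ?_ ?_
    · intro v; simp [wedgeAux, hW]
    · intro x y w
      simp only [AlternatingMap.add_apply, hW, ins_add_left, wedgeAux_add_left,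
        wedgeAux_add_right]
      abel
    · intro f x w
      simp only [AlternatingMap.add_apply, hW, ins_smul_left, wedgeAux_smul_left,
        wedgeAux_smul_right, smul_add]
    · intro x w i hi hw
      simp only [AlternatingMap.add_apply, hW]
      cases n with
      | zero => exact i.elim0
      | succ n =>
        have : w 0 = x := by rw [← hw]; congr 1; exact Fin.ext hi.symm
        simp only [wedgeAux, this, ins_self, wedgeAux_zero_left, wedgeAux_zero_right, ins_par,
          wedgeAux_neg_left]
        abel

/-- The wedge product along a bilinear map `B`. -/
def wedge (a : Forms R L E) (b : Forms R L E') : Forms R L E'' :=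
  fun n => ofFun (wedgeAux B n a b) (wedgeAux_exists B n a b)

theorem wedge_zero_app (a : Forms R L E) (b : Forms R L E') (v) :
    wedge B a b 0 v = B (a 0 v) (b 0 v) := rfl

theorem wedge_app (a : Forms R L E) (b : Forms R L E') (n v) :
    wedge B a b n v = wedgeAux B n a b v := rfl

theorem ins_wedge (x : L) (a : Forms R L E) (b : Forms R L E') :
    ins x (wedge B a b) = wedge B (ins x a) b + wedge B (par a) (ins x b) := by
  refine ext_app fun n v => ?_
  rw [ins_app, add_app]; rfl

theorem wedge_add_left (a a' : Forms R L E) (b : Forms R L E') :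
    wedge B (a + a') b = wedge B a b + wedge B a' b :=
  ext_app fun n v => wedgeAux_add_left B n a a' b v

theorem wedge_add_right (a : Forms R L E) (b b' : Forms R L E') :
    wedge B a (b + b') = wedge B a b + wedge B a b' :=
  ext_app fun n v => wedgeAux_add_right B n a b b' v

theorem wedge_zero_left (b : Forms R L E') : wedge B (0 : Forms R L E) b = 0 :=
  ext_app fun n v => wedgeAux_zero_left B n b v

theorem wedge_zero_right (a : Forms R L E) : wedge B a (0 : Forms R L E') = 0 :=
  ext_app fun n v => wedgeAux_zero_right B n a v

theorem wedge_neg_left (a : Forms R L E) (b : Forms R L E') :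
    wedge B (-a) b = -wedge B a b :=
  ext_app fun n v => wedgeAux_neg_left B n a b v

theorem wedge_neg_right (a : Forms R L E) (b : Forms R L E') :
    wedge B a (-b) = -wedge B a b := by
  rw [eq_neg_iff_add_eq_zero, ← wedge_add_right, neg_add_cancel, wedge_zero_right]

theorem wedge_smul_left (f : R) (a : Forms R L E) (b : Forms R L E') :
    wedge B (f • a) b = f • wedge B a b :=
  ext_app fun n v => wedgeAux_smul_left B n f a b v

theorem wedge_smul_right (f : R) (a : Forms R L E) (b : Forms R L E') :
    wedge B a (f • b) = f • wedge B a b :=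
  ext_app fun n v => wedgeAux_smul_right B n f a b v

theorem par_wedge (a : Forms R L E) (b : Forms R L E') :
    par (wedge B a b) = wedge B (par a) (par b) := by
  refine ext_app fun n => ?_
  induction n generalizing a b with
  | zero => intro v; simp [par_app, wedge_zero_app]
  | succ n ih =>
    intro v
    rw [succ_app, succ_app, ins_par, ins_wedge, ins_wedge, map_add, neg_app, add_app, add_app,
      ih, ih, ins_par, ins_par, wedge_neg_left, wedge_neg_right, neg_app, neg_app]
    abel

theorem wedge_assoc (B₁ : E₁ →ₗ[R] E'' →ₗ[R] E''') (B₂ : E →ₗ[R] E' →ₗ[R] E₁)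
    (B₃ : E →ₗ[R] E₂ →ₗ[R] E''') (B₄ : E' →ₗ[R] E'' →ₗ[R] E₂)
    (hB : ∀ x y z, B₁ (B₂ x y) z = B₃ x (B₄ y z))
    (a : Forms R L E) (b : Forms R L E') (c : Forms R L E'') :
    wedge B₁ (wedge B₂ a b) c = wedge B₃ a (wedge B₄ b c) := by
  refine ext_app fun n => ?_
  induction n generalizing a b c with
  | zero => intro v; simp [wedge_zero_app, hB]
  | succ n ih =>
    intro v
    rw [succ_app, succ_app, ins_wedge, ins_wedge, ins_wedge, ins_wedge, wedge_add_left,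
      wedge_add_right, par_wedge]
    simp only [add_app, ih]
    abel

theorem const_wedge (e : E) (b : Forms R L E') (n : ℕ) (v : Fin n → L) :
    wedge B (const e) b n v = B e (b n v) := by
  induction n generalizing b with
  | zero => rfl
  | succ n ih =>
    rw [succ_app, ins_wedge, ins_const, wedge_zero_left, zero_add, par_const, ih, ← succ_app]

theorem wedge_const (a : Forms R L E) (e : E') (n : ℕ) (v : Fin n → L) :
    wedge B a (const e) n v = B (a n v) e := by
  induction n generalizing a with
  | zero => rfl
  | succ n ih =>
    rw [succ_app, ins_wedge, ins_const, wedge_zero_right, add_zero, ih, ← succ_app]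

/-- Graded commutativity. -/
theorem wedge_comm (B' : E' →ₗ[R] E →ₗ[R] E'') (hB : ∀ x y, B x y = B' y x) (n : ℕ) :
    ∀ (a : Forms R L E) (b : Forms R L E') (v : Fin n → L),
      (par a = a → wedge B a b n v = wedge B' b a n v) ∧
      (par a = -a → wedge B a b n v = wedge B' (par b) a n v) := by
  induction n with
  | zero =>
    intro a b v
    refine ⟨fun _ => by simp [wedge_zero_app, hB], fun _ => ?_⟩
    simp [wedge_zero_app, hB, par_app]
  | succ n ih =>
    intro a b v
    have hp : ∀ x, par (ins x a) = -ins x (par a) := fun x => by rw [ins_par, neg_neg]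
    rw [succ_app, succ_app, ins_wedge, ins_wedge, succ_app, ins_wedge]
    simp only [add_app]
    constructor
    · intro h
      rw [h, (ih a _ _).1 h, (ih (ins (v 0) a) b _).2 (by rw [hp, h])]
      abel
    · intro h
      rw [h, wedge_neg_left, neg_app, (ih a _ _).2 h,
        (ih (ins (v 0) a) b _).1 (by rw [hp, h, map_neg, neg_neg]), par_par, ins_par,
        wedge_neg_left, neg_app]
      abel

end Forms

end Forms

/-! ### Lie subalgebroids of the tangent Lie algebroid, connections, Chevalley-Eilenberg complex -/

/-- The module of sections of an integrable distribution: an `R`-submodule of the module of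
derivations of `R` (the vector fields) that is closed under the Lie bracket. -/
structure Distribution (K : Type v) (R : Type w) [Field K] [CommRing R] [Algebra K R] where
  /-- the sections -/
  sections : Submodule R (Derivation K R R)
  lie_mem : ∀ X ∈ sections, ∀ Y ∈ sections, ⁅X, Y⁆ ∈ sections

section Algebroid

variable {K : Type v} {R : Type w} [Field K] [CommRing R] [Algebra K R] (F : Distribution K R)

namespace Distribution

/-- The Lie bracket of two sections of the distribution. -/
def bracket (x y : F.sections) : F.sections :=
  ⟨⁅x.1, y.1⁆, F.lie_mem _ x.2 _ y.2⟩

theorem bracket_add_left (x y z : F.sections) :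
    F.bracket (x + y) z = F.bracket x z + F.bracket y z :=
  Subtype.ext (add_lie x.1 y.1 z.1)

theorem bracket_add_right (x y z : F.sections) :
    F.bracket x (y + z) = F.bracket x y + F.bracket x z :=
  Subtype.ext (lie_add x.1 y.1 z.1)

theorem bracket_self (x : F.sections) : F.bracket x x = 0 :=
  Subtype.ext (lie_self x.1)

theorem bracket_smul_right (f : R) (x y : F.sections) :
    F.bracket x (f • y) = x.1 f • y + f • F.bracket x y := by
  refine Subtype.ext (Derivation.ext fun g => ?_)
  simp [bracket, Derivation.commutator_apply]
  ring

theorem bracket_smul_left (f : R) (x y : F.sections) :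
    F.bracket (f • x) y = f • F.bracket x y - y.1 f • x := by
  refine Subtype.ext (Derivation.ext fun g => ?_)
  simp [bracket, Derivation.commutator_apply]
  ring

/-- The quotient `B = T/F` (on sections). -/
abbrev Quot : Type w := Derivation K R R ⧸ F.sections

end Distribution

/-- A vector bundle with a linear `F`-connection, through its module of sections. -/
structure Conn where
  /-- the sections -/
  carrier : Type w
  [addCommGroup : AddCommGroup carrier]
  [module : Module R carrier]
  /-- the covariant derivative -/
  nabla : F.sections → carrier →+ carrier
  nabla_add : ∀ x y e, nabla (x + y) e = nabla x e + nabla y e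
  nabla_smul : ∀ (f : R) x e, nabla (f • x) e = f • nabla x e
  leibniz : ∀ (f : R) x e, nabla x (f • e) = x.1 f • e + f • nabla x e

attribute [instance] Conn.addCommGroup Conn.module

namespace Conn

/-- The trivial line bundle: `∇_x f = x(f)`. -/
abbrev trivial : Conn F where
  carrier := R
  nabla x := x.1.toLinearMap.toAddMonoidHom
  nabla_add _ _ _ := rfl
  nabla_smul _ _ _ := rfl
  leibniz f x e := by
    show x.1 (f * e) = x.1 f * e + f * x.1 e
    rw [Derivation.leibniz]; simp only [smul_eq_mul]; ring

/-- The Bott connection on `B = T/F`: `∇_x (Z mod F) = [x, Z] mod F`. -/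
abbrev bott : Conn F where
  carrier := F.Quot
  nabla x := QuotientAddGroup.map F.sections.toAddSubgroup F.sections.toAddSubgroup
    { toFun := fun Z => ⁅x.1, Z⁆, map_zero' := lie_zero _, map_add' := lie_add _ }
    (fun Z hZ => F.lie_mem _ x.2 _ hZ)
  nabla_add x y e := by
    obtain ⟨Z, rfl⟩ := Submodule.Quotient.mk_surjective _ e
    exact congrArg (Submodule.Quotient.mk (p := F.sections)) (add_lie x.1 y.1 Z)
  nabla_smul f x e := by
    obtain ⟨Z, rfl⟩ := Submodule.Quotient.mk_surjective _ e
    refine (Submodule.Quotient.eq F.sections (x := ⁅(f • x).1, Z⁆) (y := f • ⁅x.1, Z⁆)).2 ?_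
    have : ⁅(f • x).1, Z⁆ - f • ⁅x.1, Z⁆ = -(Z f • x.1) := by
      refine Derivation.ext fun g => ?_
      simp [Derivation.commutator_apply]
      ring
    rw [this]
    exact F.sections.neg_mem (F.sections.smul_mem _ x.2)
  leibniz f x e := by
    obtain ⟨Z, rfl⟩ := Submodule.Quotient.mk_surjective _ e
    refine congrArg (Submodule.Quotient.mk (p := F.sections))
      (a₁ := ⁅x.1, f • Z⁆) (a₂ := x.1 f • Z + f • ⁅x.1, Z⁆) ?_
    refine Derivation.ext fun g => ?_
    simp [Derivation.commutator_apply]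
    ring

variable {F}

/-- The induced connection on `Hom(P, S) = P^∨ ⊗ S`: `(∇_x f)(z) = ∇_x (f z) - f (∇_x z)`. -/
abbrev hom (P S : Conn F) : Conn F where
  carrier := P.carrier →ₗ[R] S.carrier
  nabla x :=
    { toFun := fun f =>
        { toFun := fun z => S.nabla x (f z) - f (P.nabla x z)
          map_add' := fun z z' => by simp only [map_add]; abel
          map_smul' := fun c z => by
            simp only [map_smul, P.leibniz, S.leibniz, map_add, RingHom.id_apply, smul_sub]; abel }
      map_zero' := by ext z; simp
      map_add' := fun f g => by
        ext z
        simp only [LinearMap.add_apply, LinearMap.coe_mk, AddHom.coe_mk, map_add]; abel }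
  nabla_add x y f := by
    ext z
    simp only [AddMonoidHom.coe_mk, ZeroHom.coe_mk, LinearMap.add_apply, LinearMap.coe_mk,
      AddHom.coe_mk, S.nabla_add, P.nabla_add, map_add]
    abel
  nabla_smul c x f := by
    ext z
    simp only [AddMonoidHom.coe_mk, ZeroHom.coe_mk, LinearMap.smul_apply, LinearMap.coe_mk,
      AddHom.coe_mk, S.nabla_smul, P.nabla_smul, map_smul, smul_sub]
  leibniz c x f := by
    ext z
    simp only [AddMonoidHom.coe_mk, ZeroHom.coe_mk, LinearMap.smul_apply, LinearMap.add_apply,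
      LinearMap.coe_mk, AddHom.coe_mk, S.leibniz, smul_sub]
    abel

/-- The dual bundle with the dual connection. -/
abbrev dual (P : Conn F) : Conn F := hom P (trivial F)

/-- The bundle `P^{⊗ n}` with its induced connection, where `P ⊗ S = Hom(P^∨, S)`. -/
def vecTens (P : Conn F) : ℕ → Conn F
  | 0 => trivial F
  | n + 1 => hom (dual P) (vecTens P n)

/-- The bundle `(P^∨)^{⊗ m} ⊗ P^{⊗ n}` with its induced connection, where `P^∨ ⊗ S = Hom(P, S)`;
thus sections are identified with `R`-multilinear maps with values in `R`. -/
def tens (P : Conn F) : ℕ → ℕ → Conn F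
  | 0, n => vecTens P n
  | m + 1, n => hom P (tens P m n)

end Conn

namespace Forms

variable {F} (P : Conn F)

/-- Values of the Lie derivative: `(L_x ω)(v₁,…,vₙ) = ∇_x ω(v₁,…,vₙ) - ∑ᵢ ω(…,[x,vᵢ],…)`, written
through `(L_x ω)₀ = ∇_x ω₀` and `ι_y L_x = L_x ι_y - ι_[x,y]`. -/
def lieAux (x : F.sections) :
    ∀ n : ℕ, Forms R F.sections P.carrier → (Fin n → F.sections) → P.carrier
  | 0, ω, v => P.nabla x (ω 0 v)
  | n + 1, ω, v => lieAux x n (ins (v 0) ω) (Fin.tail v)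
      - ins (F.bracket x (v 0)) ω n (Fin.tail v)

variable {P}

theorem lieAux_add (x : F.sections) (n : ℕ) : ∀ (a b : Forms R F.sections P.carrier) (v),
    lieAux P x n (a + b) v = lieAux P x n a v + lieAux P x n b v := by
  induction n with
  | zero => intro a b v; simp [lieAux, add_app]
  | succ n ih => intro a b v; simp only [lieAux, map_add, ih, add_app]; abel

theorem lieAux_smul (x : F.sections) (n : ℕ) :
    ∀ (f : R) (a : Forms R F.sections P.carrier) (v),
      lieAux P x n (f • a) v = x.1 f • a n v + f • lieAux P x n a v := by
  induction n with
  | zero => intro f a v; simp [lieAux, smul_app, P.leibniz]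
  | succ n ih =>
    intro f a v
    simp only [lieAux, map_smul, ih, smul_app, smul_sub, succ_app a]; abel

theorem lieAux_zero (x : F.sections) (n : ℕ) (v) :
    lieAux P x n (0 : Forms R F.sections P.carrier) v = 0 := by
  have := lieAux_add x n (0 : Forms R F.sections P.carrier) 0 v
  simpa using this

theorem lieAux_exists (x : F.sections) (n : ℕ) : ∀ a : Forms R F.sections P.carrier,
    ∃ η : F.sections [⋀^Fin n]→ₗ[R] P.carrier, ∀ v, η v = lieAux P x n a v := by
  induction n with
  | zero =>
    intro a
    refine ⟨AlternatingMap.constOfIsEmpty R F.sections (Fin 0) (P.nabla x (a 0 0)), fun v => ?_⟩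
    rw [Subsingleton.elim v 0]; rfl
  | succ n ih =>
    intro a
    choose W hW using ih
    refine exists_alternating _ (fun y => W (ins y a) - ins (F.bracket x y) a n) ?_ ?_ ?_ ?_
    · intro v; simp [lieAux, hW]
    · intro y z w
      simp only [AlternatingMap.sub_apply, hW, ins_add_left, lieAux_add, F.bracket_add_right,
        add_app]
      abel
    · intro f y w
      simp only [AlternatingMap.sub_apply, hW, ins_smul_left, lieAux_smul, F.bracket_smul_right,
        ins_add_left, add_app, smul_app, smul_sub]
      abel
    · intro y w i hi hw
      simp only [AlternatingMap.sub_apply, hW]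
      cases n with
      | zero => exact i.elim0
      | succ n =>
        have : w 0 = y := by rw [← hw]; congr 1; exact Fin.ext hi.symm
        simp only [lieAux, this, ins_self, lieAux_zero, succ_app _ n w]
        rw [ins_comm y (F.bracket x y), neg_app]
        abel

/-- The Lie derivative `L_x` on `P`-valued forms. -/
def lie (x : F.sections) (a : Forms R F.sections P.carrier) : Forms R F.sections P.carrier :=
  fun n => ofFun (lieAux P x n a) (lieAux_exists x n a)

theorem ins_lie (x y : F.sections) (a : Forms R F.sections P.carrier) :
    ins y (lie x a) = lie x (ins y a) - ins (F.bracket x y) a :=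
  ext_app fun n v => by
    rw [ins_app, sub_app]; rfl

theorem lie_zero_app (x : F.sections) (a : Forms R F.sections P.carrier) (v) :
    lie x a 0 v = P.nabla x (a 0 v) := rfl

theorem lie_add (x : F.sections) (a b : Forms R F.sections P.carrier) :
    lie x (a + b) = lie x a + lie x b := ext_app fun n v => lieAux_add x n a b v

theorem lie_smul (x : F.sections) (f : R) (a : Forms R F.sections P.carrier) :
    lie x (f • a) = x.1 f • a + f • lie x a := ext_app fun n v => lieAux_smul x n f a v

theorem lie_zero (x : F.sections) : lie x (0 : Forms R F.sections P.carrier) = 0 :=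
  ext_app fun n v => lieAux_zero x n v

theorem lie_neg (x : F.sections) (a : Forms R F.sections P.carrier) :
    lie x (-a) = -lie x a := by
  rw [eq_neg_iff_add_eq_zero, ← lie_add, neg_add_cancel, lie_zero]

theorem lie_par (x : F.sections) (a : Forms R F.sections P.carrier) :
    lie x (par a) = par (lie x a) := by
  refine ext_app fun n => ?_
  induction n generalizing a with
  | zero => intro v; simp [par_app, lie_zero_app]
  | succ n ih =>
    intro v
    rw [succ_app, succ_app, ins_lie, ins_par, ins_par, ins_par, ins_lie, lie_neg, map_sub,
      sub_app, neg_app, neg_app, neg_app, ih, sub_app]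
    abel

theorem lie_add_left (x y : F.sections) (a : Forms R F.sections P.carrier) :
    lie (x + y) a = lie x a + lie y a := by
  refine ext_app fun n => ?_
  induction n generalizing a with
  | zero => intro v; simp [add_app, lie_zero_app, P.nabla_add]
  | succ n ih =>
    intro v
    simp only [succ_app, map_add, ins_lie, add_app, sub_app, ih, F.bracket_add_left, ins_add_left]
    abel

/-- The action `R × E → E` as a bilinear map. -/
abbrev act (E : Type*) [AddCommGroup E] [Module R E] : R →ₗ[R] E →ₗ[R] E := LinearMap.lsmul R E

/-- The differential of a function, as a `1`-form. -/
def dfun (f : R) : Forms R F.sections R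
  | 1 => ofFun (fun v => (v 0).1 f)
    (exists_alternating (n := 0) _
      (fun x => AlternatingMap.constOfIsEmpty R F.sections (Fin 0) (x.1 f))
      (fun _ => rfl) (fun _ _ _ => rfl) (fun _ _ _ => rfl) (fun _ _ i => i.elim0))
  | _ => 0

theorem ins_dfun (f : R) (x : F.sections) : ins x (dfun f) = const (x.1 f) := by
  refine ext_app fun n v => ?_
  cases n <;> rfl

theorem ins_dfun_wedge (f : R) (x : F.sections) (a : Forms R F.sections P.carrier) :
    ins x (wedge (act P.carrier) (dfun f) a)
      = x.1 f • a - wedge (act P.carrier) (dfun f) (ins x a) := by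
  have hp : par (dfun (F := F) f) = -dfun f := by
    refine eq_of_ins (fun v => by simp [par_app, neg_app, dfun]) fun y => ?_
    rw [ins_par, ins_dfun, par_const, map_neg, ins_dfun]
  rw [ins_wedge, ins_dfun, hp, wedge_neg_left, sub_eq_add_neg]
  congr 1
  exact ext_app fun n v => const_wedge _ _ _ _ _

theorem lie_smul_left (f : R) (x : F.sections) (a : Forms R F.sections P.carrier) :
    lie (f • x) a = f • lie x a + wedge (act P.carrier) (dfun f) (ins x a) := by
  refine ext_app fun n => ?_
  induction n generalizing a with
  | zero =>
    intro v
    simp [add_app, smul_app, lie_zero_app, P.nabla_smul, wedge_zero_app, dfun]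
  | succ n ih =>
    intro v
    rw [succ_app, succ_app, ins_lie, sub_app, ih, map_add, map_smul, ins_lie, ins_dfun_wedge,
      F.bracket_smul_left, ins_sub_left, ins_smul_left, ins_smul_left, ins_comm x]
    simp only [add_app, smul_app, sub_app, smul_sub, wedge_neg_right, neg_app]
    abel

variable (P) in
/-- Values of the Chevalley-Eilenberg differential
`(dω)(v₀,…,vₙ) = ∑ᵢ (-1)ⁱ ∇_{vᵢ} ω(…,v̂ᵢ,…) + ∑_{i<j} (-1)^{i+j} ω([vᵢ,vⱼ],…,v̂ᵢ,…,v̂ⱼ,…)`,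
written through Cartan's formula `ι_x d = L_x - d ι_x`. -/
def extAux : ∀ n : ℕ, Forms R F.sections P.carrier → (Fin n → F.sections) → P.carrier
  | 0, _, _ => 0
  | n + 1, ω, v => lie (v 0) ω n (Fin.tail v) - extAux n (ins (v 0) ω) (Fin.tail v)

theorem extAux_add (n : ℕ) : ∀ (a b : Forms R F.sections P.carrier) (v),
    extAux P n (a + b) v = extAux P n a v + extAux P n b v := by
  induction n with
  | zero => intro a b v; simp [extAux]
  | succ n ih => intro a b v; simp only [extAux, map_add, ih, lie_add, add_app]; abel

theorem extAux_zero (n : ℕ) (v) : extAux P n (0 : Forms R F.sections P.carrier) v = 0 := by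
  have := extAux_add n (0 : Forms R F.sections P.carrier) 0 v
  simpa using this

theorem extAux_smul (n : ℕ) : ∀ (f : R) (a : Forms R F.sections P.carrier) (v),
    extAux P n (f • a) v = wedge (act P.carrier) (dfun f) a n v + f • extAux P n a v := by
  induction n with
  | zero => intro f a v; simp [extAux, wedge_zero_app, dfun]
  | succ n ih =>
    intro f a v
    simp only [extAux, map_smul, ih, lie_smul, add_app, smul_sub, succ_app _ n v, ins_dfun_wedge,
      sub_app, smul_app]
    abel

theorem extAux_exists (n : ℕ) : ∀ a : Forms R F.sections P.carrier,
    ∃ η : F.sections [⋀^Fin n]→ₗ[R] P.carrier, ∀ v, η v = extAux P n a v := by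
  induction n with
  | zero => intro a; exact ⟨0, fun v => rfl⟩
  | succ n ih =>
    intro a
    choose W hW using ih
    refine exists_alternating _ (fun x => lie x a n - W (ins x a)) ?_ ?_ ?_ ?_
    · intro v; simp [extAux, hW]
    · intro y z w
      simp only [AlternatingMap.sub_apply, hW, ins_add_left, extAux_add, lie_add_left, add_app]
      abel
    · intro f y w
      simp only [AlternatingMap.sub_apply, hW, ins_smul_left, extAux_smul, lie_smul_left,
        add_app, smul_app, smul_sub]
      abel
    · intro y w i hi hw
      simp only [AlternatingMap.sub_apply, hW]
      cases n with
      | zero => exact i.elim0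
      | succ n =>
        have : w 0 = y := by rw [← hw]; congr 1; exact Fin.ext hi.symm
        simp only [extAux, this, ins_self, extAux_zero, succ_app _ n w, ins_lie, F.bracket_self]
        have h0 : ins (0 : F.sections) a = 0 := by
          simpa using ins_smul_left (0 : R) (0 : F.sections) a
        rw [h0]
        simp

/-- The Chevalley-Eilenberg differential on `P`-valued forms. -/
def ext : Forms R F.sections P.carrier →+ Forms R F.sections P.carrier where
  toFun a := fun n => ofFun (extAux P n a) (extAux_exists n a)
  map_zero' := ext_app fun n v => extAux_zero n v
  map_add' a b := ext_app fun n v => extAux_add n a b v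

theorem ins_ext (x : F.sections) (a : Forms R F.sections P.carrier) :
    ins x (ext a) = lie x a - ext (ins x a) :=
  ext_app fun n v => by
    rw [ins_app, sub_app]; rfl

theorem ext_zero_app (a : Forms R F.sections P.carrier) (v) : ext a 0 v = 0 := rfl

theorem par_ext (a : Forms R F.sections P.carrier) : par (ext a) = -ext (par a) := by
  refine ext_app fun n => ?_
  induction n generalizing a with
  | zero => intro v; simp [par_app, neg_app, ext_zero_app]
  | succ n ih =>
    intro v
    rw [succ_app, succ_app, ins_par, map_neg, ins_ext, ins_ext, ins_par, lie_par, map_sub,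
      map_neg, neg_app, neg_app, sub_app, sub_app, ih]

theorem lie_wedge {Q S : Conn F} (B : P.carrier →ₗ[R] Q.carrier →ₗ[R] S.carrier)
    (hB : ∀ x e e', S.nabla x (B e e') = B (P.nabla x e) e' + B e (Q.nabla x e')) (x : F.sections) (a : Forms R F.sections P.carrier)
    (b : Forms R F.sections Q.carrier) :
    lie x (wedge B a b) = wedge B (lie x a) b + wedge B a (lie x b) := by
  refine ext_app fun n => ?_
  induction n generalizing a b with
  | zero => intro v; simp [add_app, lie_zero_app, wedge_zero_app, hB]
  | succ n ih =>
    intro v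
    rw [succ_app, succ_app, ins_lie, ins_wedge, lie_add, map_add, ins_wedge, ins_wedge, ins_wedge,
      ins_lie, ins_lie]
    simp only [add_app, ih, lie_par, sub_eq_add_neg, wedge_add_left, wedge_add_right,
      wedge_neg_left, wedge_neg_right, neg_app]
    abel

theorem ext_wedge {Q S : Conn F} (B : P.carrier →ₗ[R] Q.carrier →ₗ[R] S.carrier)
    (hB : ∀ x e e', S.nabla x (B e e') = B (P.nabla x e) e' + B e (Q.nabla x e')) (a : Forms R F.sections P.carrier) (b : Forms R F.sections Q.carrier) :
    ext (wedge B a b) = wedge B (ext a) b + wedge B (par a) (ext b) := by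
  refine ext_app fun n => ?_
  induction n generalizing a b with
  | zero => intro v; simp [add_app, ext_zero_app, wedge_zero_app]
  | succ n ih =>
    intro v
    rw [succ_app, succ_app, ins_ext, lie_wedge B hB, ins_wedge, map_add, map_add, ins_wedge,
      ins_wedge, ins_ext, ins_ext, par_par, par_ext, ins_par]
    simp only [add_app, ih, par_par, sub_eq_add_neg, wedge_add_left, wedge_add_right,
      wedge_neg_left, wedge_neg_right, neg_app]
    abel

end Forms

end Algebroid

/-! ### Differential graded algebras and modules, vector fields, tensor fields -/

/-- A graded commutative differential graded `K`-algebra (for instance the functions on a DG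
manifold).  `par` is the parity operator `a ↦ (-1)^|a| a`; all Koszul signs are expressed by it. -/
structure DGAlg (K : Type v) [Field K] where
  /-- the elements -/
  carrier : Type w
  [ring : Ring carrier]
  [algebra : Algebra K carrier]
  /-- homogeneous elements of degree `k` -/
  deg : ℤ → AddSubgroup carrier
  /-- `a ↦ (-1)^|a| a` -/
  par : carrier →ₗ[K] carrier
  /-- the differential -/
  d : carrier →ₗ[K] carrier
  par_of_even : ∀ k a, a ∈ deg k → Even k → par a = a
  par_of_odd : ∀ k a, a ∈ deg k → Odd k → par a = -a
  mul_deg : ∀ k l a b, a ∈ deg k → b ∈ deg l → a * b ∈ deg (k + l)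
  d_deg : ∀ k a, a ∈ deg k → d a ∈ deg (k + 1)
  par_par : ∀ a, par (par a) = a
  par_one : par 1 = 1
  par_mul : ∀ a b, par (a * b) = par a * par b
  comm_even : ∀ a b, par a = a → a * b = b * a
  comm_odd : ∀ a b, par a = -a → a * b = par b * a
  par_d : ∀ a, par (d a) = -d (par a)
  d_mul : ∀ a b, d (a * b) = d a * b + par a * d b

attribute [instance] DGAlg.ring DGAlg.algebra

section DG

variable {K : Type v} [Field K]

/-- A differential graded (left) module. -/
structure DGMod (A : DGAlg.{v, w} K) where
  /-- the elements -/
  carrier : Type w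
  [addCommGroup : AddCommGroup carrier]
  [module : Module A.carrier carrier]
  /-- homogeneous elements of degree `k` -/
  deg : ℤ → AddSubgroup carrier
  /-- `x ↦ (-1)^|x| x` -/
  par : carrier →+ carrier
  /-- the differential -/
  d : carrier →+ carrier
  par_of_even : ∀ k x, x ∈ deg k → Even k → par x = x
  par_of_odd : ∀ k x, x ∈ deg k → Odd k → par x = -x
  smul_deg : ∀ k l a x, a ∈ A.deg k → x ∈ deg l → a • x ∈ deg (k + l)
  d_deg : ∀ k x, x ∈ deg k → d x ∈ deg (k + 1)
  par_par : ∀ x, par (par x) = x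
  par_smul : ∀ a x, par (a • x) = A.par a • par x
  par_d : ∀ x, par (d x) = -d (par x)
  d_smul : ∀ a x, d (a • x) = A.d a • x + A.par a • d x

attribute [instance] DGMod.addCommGroup DGMod.module

theorem DGAlg.par_mem (A : DGAlg.{v, w} K) {k : ℤ} {a : A.carrier} (h : a ∈ A.deg k) :
    A.par a ∈ A.deg k := by
  rcases Int.even_or_odd k with hk | hk
  · rwa [A.par_of_even k a h hk]
  · rw [A.par_of_odd k a h hk]; exact neg_mem h

theorem DGMod.par_mem {A : DGAlg.{v, w} K} (E : DGMod A) {k : ℤ} {a : E.carrier}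
    (h : a ∈ E.deg k) : E.par a ∈ E.deg k := by
  rcases Int.even_or_odd k with hk | hk
  · rwa [E.par_of_even k a h hk]
  · rw [E.par_of_odd k a h hk]; exact neg_mem h

namespace DGAlg

variable (A : DGAlg.{v, w} K)

/-- The algebra as a module over itself. -/
def self : DGMod A where
  carrier := A.carrier
  deg := A.deg
  par := A.par.toAddMonoidHom
  d := A.d.toAddMonoidHom
  par_of_even := A.par_of_even
  par_of_odd := A.par_of_odd
  smul_deg := A.mul_deg
  d_deg := A.d_deg
  par_par := A.par_par
  par_smul := A.par_mul
  par_d := A.par_d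
  d_smul := A.d_mul

/-- The graded `K`-linear derivations of `A`: for `a` homogeneous,
`D(ab) = D(a)b + (-1)^{|D||a|} a D(b)`.  For odd `a` the sign `(-1)^|D|` is produced by
`D ↦ par ∘ D ∘ par`. -/
def derivations : Submodule A.carrier (A.carrier →ₗ[K] A.carrier) where
  carrier := {D | (∀ a b, A.par a = a → D (a * b) = D a * b + a * D b) ∧
    (∀ a b, A.par a = -a → D (a * b) = D a * b + a * A.par (D (A.par b)))}
  zero_mem' := by constructor <;> intros <;> simp
  add_mem' := by
    rintro D D' ⟨h1, h2⟩ ⟨h1', h2'⟩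
    constructor
    · intro a b ha
      simp only [LinearMap.add_apply, h1 a b ha, h1' a b ha, mul_add, add_mul]; abel
    · intro a b ha
      simp only [LinearMap.add_apply, h2 a b ha, h2' a b ha, mul_add, add_mul, map_add]; abel
  smul_mem' := by
    rintro c D ⟨h1, h2⟩
    constructor
    · intro a b ha
      simp only [LinearMap.smul_apply, smul_eq_mul, h1 a b ha, mul_add, ← mul_assoc,
        A.comm_even a c ha]
    · intro a b ha
      simp only [LinearMap.smul_apply, smul_eq_mul, h2 a b ha, mul_add, A.par_mul, ← mul_assoc]
      rw [A.comm_odd a _ ha, A.par_par]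

/-- `D ↦ par ∘ D ∘ par = (-1)^|D| D`. -/
def twist (D : A.carrier →ₗ[K] A.carrier) : A.carrier →ₗ[K] A.carrier := A.par ∘ₗ D ∘ₗ A.par

theorem twist_add (D D' : A.carrier →ₗ[K] A.carrier) :
    A.twist (D + D') = A.twist D + A.twist D' := LinearMap.ext fun a => by simp [twist]

theorem twist_neg (D : A.carrier →ₗ[K] A.carrier) :
    A.twist (-D) = -A.twist D := LinearMap.ext fun a => by simp [twist]

theorem twist_mem {D : A.carrier →ₗ[K] A.carrier} (h : D ∈ A.derivations) :
    A.twist D ∈ A.derivations := by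
  obtain ⟨h1, h2⟩ := h
  constructor
  · intro a b ha
    simp [twist, A.par_mul, ha, h1 a _ ha, A.par_par]
  · intro a b ha
    have := h2 a (A.par b) ha
    simp [twist, A.par_mul, ha, this, A.par_par]; abel

theorem bracket_mem {D : A.carrier →ₗ[K] A.carrier} (h : D ∈ A.derivations) :
    A.d ∘ₗ D - A.twist D ∘ₗ A.d ∈ A.derivations := by
  have h' := A.twist_mem h
  obtain ⟨h1, h2⟩ := h
  obtain ⟨h1', h2'⟩ := h'
  have hpd : ∀ a, A.d (A.par a) = -A.par (A.d a) := fun a => by rw [A.par_d, neg_neg]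
  have htt : ∀ a, A.par (A.twist D (A.par a)) = D a := fun a => by simp [twist, A.par_par]
  have htp : ∀ a, A.twist D (A.par a) = A.par (D a) := fun a => by simp [twist, A.par_par]
  constructor
  · intro a b ha
    have hda : A.par (A.d a) = -A.d a := by rw [A.par_d, ha]
    have hpD : A.par (D a) = A.twist D a := by rw [← htp, ha]
    simp only [LinearMap.sub_apply, LinearMap.comp_apply, h1 a b ha, A.d_mul, map_add, ha,
      h1' a _ ha, h2' _ b hda, htt, hpD, mul_sub, sub_mul]
    abel
  · intro a b ha
    have hda : A.par (A.d a) = A.d a := by rw [A.par_d, ha, map_neg, neg_neg]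
    have hpD : A.par (D a) = -A.twist D a := by rw [← htp, ha, map_neg]
    have e1 : A.par (D (A.par b)) = A.twist D b := rfl
    have e2 : A.par (A.d (D (A.par b))) = -A.d (A.twist D b) := A.par_d _
    simp only [LinearMap.sub_apply, LinearMap.comp_apply, h2 a b ha, A.d_mul, map_add, ha, map_sub,
      h1' _ b hda, h2' a _ ha, htp, hpD, hpd, e1, e2, mul_sub, map_neg, neg_mul, sub_mul,
      A.par_par, mul_neg]
    abel

/-- The vector fields: derivations of the functions, with the Lie derivative
`L_Q X = [Q, X] = Q ∘ X - (-1)^|X| X ∘ Q` along the homological vector field `Q = d`. -/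
def vectorFields : DGMod A where
  carrier := A.derivations
  deg k :=
    { carrier := {D | (∀ l, ∀ a ∈ A.deg l, D.1 a ∈ A.deg (l + k)) ∧
        (Even k → A.twist D.1 = D.1) ∧ (Odd k → A.twist D.1 = -D.1)}
      zero_mem' := ⟨fun _ _ _ => zero_mem _, by simp [twist], by simp [twist]⟩
      add_mem' := fun {D D'} h h' => ⟨fun l a ha => add_mem (h.1 l a ha) (h'.1 l a ha),
        fun hk => (A.twist_add D.1 D'.1).trans (congrArg₂ (· + ·) (h.2.1 hk) (h'.2.1 hk)),
        fun hk => ((A.twist_add D.1 D'.1).trans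
          (congrArg₂ (· + ·) (h.2.2 hk) (h'.2.2 hk))).trans (neg_add _ _).symm⟩
      neg_mem' := fun {D} h => ⟨fun l a ha => neg_mem (h.1 l a ha),
        fun hk => (A.twist_neg D.1).trans (congrArg (- ·) (h.2.1 hk)),
        fun hk => (A.twist_neg D.1).trans (congrArg (- ·) (h.2.2 hk))⟩ }
  par :=
    { toFun := fun D => ⟨A.twist D.1, A.twist_mem D.2⟩
      map_zero' := Subtype.ext (LinearMap.ext fun a => by simp [twist])
      map_add' := fun D D' => Subtype.ext (LinearMap.ext fun a => by simp [twist]) }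
  d :=
    { toFun := fun D => ⟨A.d ∘ₗ D.1 - A.twist D.1 ∘ₗ A.d, A.bracket_mem D.2⟩
      map_zero' := Subtype.ext (LinearMap.ext fun a => by simp [twist])
      map_add' := fun D D' => Subtype.ext (LinearMap.ext fun a => by simp [twist]; abel) }
  par_of_even _ _ h hk := Subtype.ext (h.2.1 hk)
  par_of_odd _ _ h hk := Subtype.ext (h.2.2 hk)
  smul_deg k l c D hc hD := by
    refine ⟨fun r a ha => ?_, fun hk => ?_, fun hk => ?_⟩
    · have := A.mul_deg _ _ _ _ hc (hD.1 r a ha)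
      rwa [show k + (r + l) = r + (k + l) by ring] at this
    all_goals
      have hs : A.twist ((c • D).1) = A.par c • A.twist D.1 :=
        LinearMap.ext fun a => by simp [twist, A.par_mul]
      rw [hs]
      rcases Int.even_or_odd k with h1 | h1 <;> rcases Int.even_or_odd l with h2 | h2
    · rw [A.par_of_even _ _ hc h1, hD.2.1 h2]; rfl
    · exact absurd hk (Int.not_even_iff_odd.2 (h1.add_odd h2))
    · exact absurd hk (Int.not_even_iff_odd.2 (h1.add_even h2))
    · rw [A.par_of_odd _ _ hc h1, hD.2.2 h2, neg_smul_neg]; rfl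
    · exact absurd hk (Int.not_odd_iff_even.2 (h1.add h2))
    · rw [A.par_of_even _ _ hc h1, hD.2.2 h2, smul_neg]; rfl
    · rw [A.par_of_odd _ _ hc h1, hD.2.1 h2]; exact neg_smul c D.1
    · exact absurd hk (Int.not_odd_iff_even.2 (h1.add_odd h2))
  d_deg k D hD := by
    have key : A.twist (A.d ∘ₗ D.1 - A.twist D.1 ∘ₗ A.d)
        = -(A.d ∘ₗ A.twist D.1 - D.1 ∘ₗ A.d) := LinearMap.ext fun a => by
      simp [twist, A.par_par, A.par_d]; abel
    refine ⟨fun r a ha => ?_, fun hk => ?_, fun hk => ?_⟩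
    · have h1 := A.d_deg _ _ (hD.1 r a ha)
      have h2 := A.par_mem (hD.1 _ _ (A.par_mem (A.d_deg _ _ ha)))
      rw [show r + k + 1 = r + (k + 1) by ring] at h1
      rw [show r + 1 + k = r + (k + 1) by ring] at h2
      exact sub_mem h1 h2
    · have hk' : Odd k := by
        rcases Int.even_or_odd k with h | h
        · exact absurd hk (Int.not_even_iff_odd.2 (h.add_one))
        · exact h
      refine key.trans ?_
      show _ = A.d ∘ₗ D.1 - A.twist D.1 ∘ₗ A.d
      rw [hD.2.2 hk']
      exact LinearMap.ext fun a => by simp; abel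
    · have hk' : Even k := by
        rcases Int.even_or_odd k with h | h
        · exact h
        · exact absurd hk (Int.not_odd_iff_even.2 (h.add_one))
      refine key.trans ?_
      show _ = -(A.d ∘ₗ D.1 - A.twist D.1 ∘ₗ A.d)
      rw [hD.2.1 hk']
  par_par D := Subtype.ext (LinearMap.ext fun a => by simp [twist, A.par_par])
  par_smul c D := Subtype.ext (LinearMap.ext fun a => by simp [twist, A.par_mul])
  par_d D := Subtype.ext (LinearMap.ext fun a => by
    have hpd : ∀ a, A.d (A.par a) = -A.par (A.d a) := fun a => by rw [A.par_d, neg_neg]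
    simp [twist, A.par_par, hpd]; abel)
  d_smul c D := Subtype.ext (LinearMap.ext fun a => by
    simp [twist, A.par_mul, A.d_mul, mul_sub]; abel)

end DGAlg

namespace DGMod

variable {A : DGAlg.{v, w} K}

/-- The graded `A`-linear maps: `f(a x) = (-1)^{|f||a|} a f(x)`. -/
def gradedLinear (E T : DGMod A) : Submodule A.carrier (E.carrier →+ T.carrier) where
  carrier := {f | (∀ a x, A.par a = a → f (a • x) = a • f x) ∧
    (∀ a x, A.par a = -a → f (a • x) = a • T.par (f (E.par x)))}
  zero_mem' := by constructor <;> intros <;> simp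
  add_mem' := by
    rintro f g ⟨h1, h2⟩ ⟨h1', h2'⟩
    constructor
    · intro a x ha
      simp only [AddMonoidHom.add_apply, h1 a x ha, h1' a x ha, smul_add]
    · intro a x ha
      simp only [AddMonoidHom.add_apply, h2 a x ha, h2' a x ha, smul_add, map_add]
  smul_mem' := by
    rintro c f ⟨h1, h2⟩
    constructor
    · intro a x ha
      simp only [AddMonoidHom.smul_apply, h1 a x ha, smul_smul, A.comm_even a c ha]
    · intro a x ha
      simp only [AddMonoidHom.smul_apply, h2 a x ha, T.par_smul, smul_smul]
      rw [A.comm_odd a _ ha, A.par_par]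

/-- `f ↦ par ∘ f ∘ par = (-1)^|f| f`. -/
def twist (E T : DGMod A) (f : E.carrier →+ T.carrier) : E.carrier →+ T.carrier :=
  T.par.comp (f.comp E.par)

theorem twist_add {E T : DGMod A} (f g : E.carrier →+ T.carrier) :
    twist E T (f + g) = twist E T f + twist E T g := AddMonoidHom.ext fun a => by simp [twist]

theorem twist_neg {E T : DGMod A} (f : E.carrier →+ T.carrier) :
    twist E T (-f) = -twist E T f := AddMonoidHom.ext fun a => by simp [twist]

theorem twist_mem {E T : DGMod A} {f : E.carrier →+ T.carrier} (h : f ∈ gradedLinear E T) :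
    twist E T f ∈ gradedLinear E T := by
  obtain ⟨h1, h2⟩ := h
  constructor
  · intro a x ha
    simp [twist, E.par_smul, T.par_smul, ha, h1 a _ ha]
  · intro a x ha
    have := h2 a (E.par x) ha
    simp [twist, E.par_smul, T.par_smul, ha, this, E.par_par]

theorem d_mem {E T : DGMod A} {f : E.carrier →+ T.carrier} (h : f ∈ gradedLinear E T) :
    T.d.comp f - (twist E T f).comp E.d ∈ gradedLinear E T := by
  have h' := twist_mem h
  obtain ⟨h1, h2⟩ := h
  obtain ⟨h1', h2'⟩ := h'
  have hpd : ∀ x, E.d (E.par x) = -E.par (E.d x) := fun a => by rw [E.par_d, neg_neg]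
  have htt : ∀ x, T.par (twist E T f (E.par x)) = f x := fun a => by
    simp [twist, E.par_par, T.par_par]
  have htp : ∀ x, twist E T f (E.par x) = T.par (f x) := fun a => by simp [twist, E.par_par]
  constructor
  · intro a x ha
    have hda : A.par (A.d a) = -A.d a := by rw [A.par_d, ha]
    simp only [AddMonoidHom.sub_apply, AddMonoidHom.comp_apply, h1 a x ha, T.d_smul, E.d_smul,
      map_add, ha, h1' a _ ha, h2' _ x hda, htt, smul_sub]
    abel
  · intro a x ha
    have hda : A.par (A.d a) = A.d a := by rw [A.par_d, ha, map_neg, neg_neg]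
    have e1 : T.par (f (E.par x)) = twist E T f x := rfl
    simp only [AddMonoidHom.sub_apply, AddMonoidHom.comp_apply, h2 a x ha, T.d_smul, E.d_smul,
      map_add, ha, h1' _ x hda, h2' a _ ha, htp, e1, map_neg, map_sub, neg_smul,
      smul_sub, T.par_d, T.par_par, hpd, smul_neg]
    abel

/-- The graded module `Hom_A(E, T)`, with `(d f)(x) = d(f(x)) - (-1)^|f| f(d x)`. -/
def hom (E T : DGMod A) : DGMod A where
  carrier := gradedLinear E T
  deg k :=
    { carrier := {f | (∀ l, ∀ x ∈ E.deg l, f.1 x ∈ T.deg (l + k)) ∧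
        (Even k → twist E T f.1 = f.1) ∧ (Odd k → twist E T f.1 = -f.1)}
      zero_mem' := ⟨fun _ _ _ => zero_mem _, by simp [twist], by simp [twist]⟩
      add_mem' := fun {f g} h h' => ⟨fun l a ha => add_mem (h.1 l a ha) (h'.1 l a ha),
        fun hk => (twist_add f.1 g.1).trans (congrArg₂ (· + ·) (h.2.1 hk) (h'.2.1 hk)),
        fun hk => ((twist_add f.1 g.1).trans
          (congrArg₂ (· + ·) (h.2.2 hk) (h'.2.2 hk))).trans (neg_add _ _).symm⟩
      neg_mem' := fun {f} h => ⟨fun l a ha => neg_mem (h.1 l a ha),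
        fun hk => (twist_neg f.1).trans (congrArg (- ·) (h.2.1 hk)),
        fun hk => (twist_neg f.1).trans (congrArg (- ·) (h.2.2 hk))⟩ }
  par :=
    { toFun := fun f => ⟨twist E T f.1, twist_mem f.2⟩
      map_zero' := Subtype.ext (AddMonoidHom.ext fun a => by simp [twist])
      map_add' := fun D D' => Subtype.ext (AddMonoidHom.ext fun a => by simp [twist]) }
  d :=
    { toFun := fun f => ⟨T.d.comp f.1 - (twist E T f.1).comp E.d, d_mem f.2⟩
      map_zero' := Subtype.ext (AddMonoidHom.ext fun a => by simp [twist])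
      map_add' := fun D D' => Subtype.ext (AddMonoidHom.ext fun a => by simp [twist]; abel) }
  par_of_even _ _ h hk := Subtype.ext (h.2.1 hk)
  par_of_odd _ _ h hk := Subtype.ext (h.2.2 hk)
  smul_deg k l c f hc hf := by
    refine ⟨fun r a ha => ?_, fun hk => ?_, fun hk => ?_⟩
    · have := T.smul_deg _ _ _ _ hc (hf.1 r a ha)
      rwa [show k + (r + l) = r + (k + l) by ring] at this
    all_goals
      have hs : twist E T ((c • f).1) = A.par c • twist E T f.1 :=
        AddMonoidHom.ext fun a => by simp [twist, T.par_smul]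
      rw [hs]
      rcases Int.even_or_odd k with h1 | h1 <;> rcases Int.even_or_odd l with h2 | h2
    · rw [A.par_of_even _ _ hc h1, hf.2.1 h2]; rfl
    · exact absurd hk (Int.not_even_iff_odd.2 (h1.add_odd h2))
    · exact absurd hk (Int.not_even_iff_odd.2 (h1.add_even h2))
    · rw [A.par_of_odd _ _ hc h1, hf.2.2 h2, neg_smul_neg]; rfl
    · exact absurd hk (Int.not_odd_iff_even.2 (h1.add h2))
    · rw [A.par_of_even _ _ hc h1, hf.2.2 h2, smul_neg]; rfl
    · rw [A.par_of_odd _ _ hc h1, hf.2.1 h2]; exact neg_smul c f.1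
    · exact absurd hk (Int.not_odd_iff_even.2 (h1.add_odd h2))
  d_deg k f hf := by
    have key : twist E T (T.d.comp f.1 - (twist E T f.1).comp E.d)
        = -(T.d.comp (twist E T f.1) - f.1.comp E.d) := AddMonoidHom.ext fun a => by
      simp [twist, E.par_par, T.par_par, E.par_d, T.par_d]; abel
    refine ⟨fun r a ha => ?_, fun hk => ?_, fun hk => ?_⟩
    · have h1 := T.d_deg _ _ (hf.1 r a ha)
      have h2 := T.par_mem (hf.1 _ _ (E.par_mem (E.d_deg _ _ ha)))
      rw [show r + k + 1 = r + (k + 1) by ring] at h1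
      rw [show r + 1 + k = r + (k + 1) by ring] at h2
      exact sub_mem h1 h2
    · have hk' : Odd k := by
        rcases Int.even_or_odd k with h | h
        · exact absurd hk (Int.not_even_iff_odd.2 (h.add_one))
        · exact h
      refine key.trans ?_
      show _ = T.d.comp f.1 - (twist E T f.1).comp E.d
      rw [hf.2.2 hk']
      exact AddMonoidHom.ext fun a => by simp; abel
    · have hk' : Even k := by
        rcases Int.even_or_odd k with h | h
        · exact h
        · exact absurd hk (Int.not_odd_iff_even.2 (h.add_one))
      refine key.trans ?_
      show _ = -(T.d.comp f.1 - (twist E T f.1).comp E.d)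
      rw [hf.2.1 hk']
  par_par f := Subtype.ext (AddMonoidHom.ext fun a => by simp [twist, E.par_par, T.par_par])
  par_smul c f := Subtype.ext (AddMonoidHom.ext fun a => by simp [twist, T.par_smul])
  par_d f := Subtype.ext (AddMonoidHom.ext fun a => by
    have hpd : ∀ x, E.d (E.par x) = -E.par (E.d x) := fun a => by rw [E.par_d, neg_neg]
    simp [twist, E.par_par, T.par_par, hpd, T.par_d]; abel)
  d_smul c f := Subtype.ext (AddMonoidHom.ext fun a => by
    simp [twist, T.par_smul, T.d_smul, smul_sub]; abel)

/-- The `A`-dual `E^∨ = Hom_A(E, A)`. -/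
abbrev dual (E : DGMod A) : DGMod A := hom E A.self

/-- The module `E^{⊗ n}` over `A`, where `E ⊗ T = Hom_A(E^∨, T)`. -/
def vecTens (E : DGMod A) : ℕ → DGMod A
  | 0 => A.self
  | n + 1 => hom (dual E) (vecTens E n)

/-- The module `(E^∨)^{⊗ m} ⊗ E^{⊗ n}` over `A`, where `E^∨ ⊗ T = Hom_A(E, T)`; thus its elements
are identified with graded `A`-multilinear maps with values in `A`. -/
def tens (E : DGMod A) : ℕ → ℕ → DGMod A
  | 0, n => vecTens E n
  | m + 1, n => hom E (tens E m n)

/-- The even part `(x + par x) / 2`. -/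
def even (E : DGMod A) (x : E.carrier) : E.carrier :=
  algebraMap K A.carrier 2⁻¹ • (x + E.par x)

/-- The odd part `(x - par x) / 2`. -/
def odd (E : DGMod A) (x : E.carrier) : E.carrier :=
  algebraMap K A.carrier 2⁻¹ • (x - E.par x)

theorem smul_algebraMap (E : DGMod A) (c : K) (a : A.carrier) (x : E.carrier) :
    algebraMap K A.carrier c • a • x = a • algebraMap K A.carrier c • x := by
  rw [smul_smul, smul_smul, Algebra.commutes]

theorem par_algebraMap_smul (E : DGMod A) (c : K) (x : E.carrier) :
    E.par (algebraMap K A.carrier c • x) = algebraMap K A.carrier c • E.par x := by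
  rw [E.par_smul, Algebra.algebraMap_eq_smul_one, map_smul, A.par_one]

theorem even_add (E : DGMod A) (x y : E.carrier) : E.even (x + y) = E.even x + E.even y := by
  simp only [even, map_add, smul_add]; abel

theorem odd_add (E : DGMod A) (x y : E.carrier) : E.odd (x + y) = E.odd x + E.odd y := by
  simp only [odd, map_add, smul_add, smul_sub]; abel

theorem par_even (E : DGMod A) (x : E.carrier) : E.par (E.even x) = E.even x := by
  rw [even, par_algebraMap_smul, map_add, E.par_par, add_comm]

theorem par_odd (E : DGMod A) (x : E.carrier) : E.par (E.odd x) = -E.odd x := by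
  rw [odd, par_algebraMap_smul, map_sub, E.par_par, ← smul_neg, neg_sub]

theorem even_par (E : DGMod A) (x : E.carrier) : E.even (E.par x) = E.even x := by
  rw [even, even, E.par_par, add_comm]

theorem odd_par (E : DGMod A) (x : E.carrier) : E.odd (E.par x) = -E.odd x := by
  rw [odd, odd, E.par_par, ← smul_neg, neg_sub]

theorem even_smul (E : DGMod A) {a : A.carrier} (x : E.carrier) :
    (A.par a = a → E.even (a • x) = a • E.even x) ∧
    (A.par a = -a → E.even (a • x) = a • E.odd x) := by
  constructor <;> intro ha
  · rw [even, E.par_smul, ha, ← smul_add, smul_algebraMap, even]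
  · rw [even, E.par_smul, ha, neg_smul, ← sub_eq_add_neg, ← smul_sub, smul_algebraMap, odd]

theorem odd_smul (E : DGMod A) {a : A.carrier} (x : E.carrier) :
    (A.par a = a → E.odd (a • x) = a • E.odd x) ∧
    (A.par a = -a → E.odd (a • x) = a • E.even x) := by
  constructor <;> intro ha
  · rw [odd, E.par_smul, ha, ← smul_sub, smul_algebraMap, odd]
  · rw [odd, E.par_smul, ha, neg_smul, sub_neg_eq_add, ← smul_add, smul_algebraMap, even]

variable {E T : DGMod A}

/-- The value `α(x)` of a linear form. -/
def pair {E : DGMod A} (α : (dual E).carrier) (x : E.carrier) : A.carrier := α.1 x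

theorem pair_add (α : (dual E).carrier) (x y : E.carrier) :
    pair α (x + y) = pair α x + pair α y := α.1.map_add x y

theorem pair_neg (α : (dual E).carrier) (x : E.carrier) : pair α (-x) = -pair α x :=
  α.1.map_neg x

theorem pair_smul_even (α : (dual E).carrier) {a : A.carrier} (x : E.carrier)
    (ha : A.par a = a) : pair α (a • x) = a * pair α x := α.2.1 a x ha

theorem pair_smul_odd (α : (dual E).carrier) {a : A.carrier} (x : E.carrier)
    (ha : A.par a = -a) : pair α (a • x) = a * A.par (pair α (E.par x)) := α.2.2 a x ha

/-- The decomposable tensor `α ⊗ t ∈ E^∨ ⊗ T = Hom_A(E, T)`: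
`(α ⊗ t)(x) = (-1)^{|t||x|} α(x) t`. -/
def dualTmul (α : (dual E).carrier) (t : T.carrier) : (hom E T).carrier :=
  ⟨{ toFun := fun x => pair α (E.even x) • t + pair α (E.odd x) • T.par t
     map_zero' := by
      have h : pair α 0 = 0 := α.1.map_zero
      simp [even, odd, h]
     map_add' := fun x y => by
      rw [even_add, odd_add, pair_add, pair_add, add_smul, add_smul]; abel },
   by
    intro a x ha
    simp only [AddMonoidHom.coe_mk, ZeroHom.coe_mk]
    rw [(E.even_smul x).1 ha, (E.odd_smul x).1 ha, pair_smul_even _ _ ha, pair_smul_even _ _ ha,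
      smul_add, smul_smul, smul_smul],
   by
    intro a x ha
    simp only [AddMonoidHom.coe_mk, ZeroHom.coe_mk]
    rw [(E.even_smul x).2 ha, (E.odd_smul x).2 ha, pair_smul_odd _ _ ha, pair_smul_odd _ _ ha,
      E.par_even, E.par_odd, E.even_par, E.odd_par, pair_neg, map_add, T.par_smul, T.par_smul,
      T.par_par, smul_add, smul_smul, smul_smul]
    abel⟩

/-- The canonical map `E → E^∨∨`, `x ↦ (α ↦ (-1)^{|x||α|} α(x))`. -/
def bidual (x : E.carrier) : (dual (dual E)).carrier :=
  ⟨{ toFun := fun α => pair α (E.even x) + pair ((dual E).par α) (E.odd x)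
     map_zero' := by
      rw [map_zero]
      exact add_zero (0 : A.carrier)
     map_add' := fun α β => by
      rw [map_add]
      exact add_add_add_comm (pair α (E.even x)) (pair β (E.even x))
        (pair ((dual E).par α) (E.odd x)) (pair ((dual E).par β) (E.odd x)) },
   by
    intro a α ha
    show pair (a • α) (E.even x) + pair ((dual E).par (a • α)) (E.odd x)
      = a * (pair α (E.even x) + pair ((dual E).par α) (E.odd x))
    rw [(dual E).par_smul, ha]
    exact (mul_add a (pair α (E.even x)) (pair ((dual E).par α) (E.odd x))).symm,
   by
    intro a α ha
    show pair (a • α) (E.even x) + pair ((dual E).par (a • α)) (E.odd x)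
      = a * A.par (pair ((dual E).par α) (E.even x)
        + pair ((dual E).par ((dual E).par α)) (E.odd x))
    rw [(dual E).par_smul, ha, (dual E).par_par]
    have h1 : pair ((dual E).par α) (E.even x) = A.par (pair α (E.even x)) :=
      congrArg (fun y => A.par (pair α y)) (E.par_even x)
    have h2 : pair ((dual E).par α) (E.odd x) = -A.par (pair α (E.odd x)) :=
      (congrArg (fun y => A.par (pair α y)) (E.par_odd x)).trans (by rw [pair_neg, map_neg])
    show a * pair α (E.even x) + -a * pair ((dual E).par α) (E.odd x)
      = a * A.par (pair ((dual E).par α) (E.even x) + pair α (E.odd x))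
    rw [h1, h2, map_add, A.par_par]
    noncomm_ring⟩

/-- The decomposable tensor `x ⊗ t ∈ E ⊗ T = Hom_A(E^∨, T)`. -/
def tmul (x : E.carrier) (t : T.carrier) : (hom (dual E) T).carrier :=
  dualTmul (bidual x) t

/-- Contraction data between two DG modules (projection `p`, inclusion `i`, homotopy `h`), with
all side conditions. -/
structure IsContraction (E Y : DGMod A) (p : E.carrier →+ Y.carrier) (i : Y.carrier →+ E.carrier)
    (h : E.carrier →+ E.carrier) : Prop where
  /-- both sides are complexes -/
  d_d_left : ∀ x, E.d (E.d x) = 0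
  d_d_right : ∀ y, Y.d (Y.d y) = 0
  /-- `p`, `i` have degree `0` and `h` has degree `-1` -/
  p_deg : ∀ k, ∀ x ∈ E.deg k, p x ∈ Y.deg k
  i_deg : ∀ k, ∀ y ∈ Y.deg k, i y ∈ E.deg k
  h_deg : ∀ k, ∀ x ∈ E.deg k, h x ∈ E.deg (k - 1)
  /-- graded linearity over the algebra -/
  p_smul : ∀ (a : A.carrier) x, p (a • x) = a • p x
  i_smul : ∀ (a : A.carrier) y, i (a • y) = a • i y
  h_smul : ∀ (a : A.carrier) x, h (a • x) = A.par a • h x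
  /-- `p`, `i` are cochain maps -/
  p_d : ∀ x, p (E.d x) = Y.d (p x)
  i_d : ∀ y, i (Y.d y) = E.d (i y)
  p_i : ∀ y, p (i y) = y
  homotopy : ∀ x, i (p x) + (E.d (h x) + h (E.d x)) = x
  h_i : ∀ y, h (i y) = 0
  p_h : ∀ x, p (h x) = 0
  h_h : ∀ x, h (h x) = 0

end DGMod

end DG

/-! ### The DG manifold `(F[1], d_F)` and the Chevalley-Eilenberg complexes -/

namespace Forms

section Ring

variable {R : Type*} [CommRing R] {L : Type*} [AddCommGroup L] [Module R L]
  {E E' E'' : Type*} [AddCommGroup E] [Module R E] [AddCommGroup E'] [Module R E']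
  [AddCommGroup E''] [Module R E'']

/-- The wedge product of scalar forms. -/
instance : Ring (Forms R L R) :=
  { (inferInstance : AddCommGroup (Forms R L R)) with
    mul := wedge (act R)
    one := const 1
    left_distrib := fun a b c => wedge_add_right (act R) a b c
    right_distrib := fun a b c => wedge_add_left (E := R) (E' := R) (E'' := R) (act R) a b c
    zero_mul := fun a => wedge_zero_left (E := R) (E' := R) (E'' := R) (act R) a
    mul_zero := fun a => wedge_zero_right (act R) a
    mul_assoc := wedge_assoc (act R) (act R) (act R) (act R) (fun x y z => mul_assoc x y z)
    one_mul := fun a => ext_app fun n v => (const_wedge (act R) 1 a n v).trans (one_mul _)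
    mul_one := fun a => ext_app fun n v => (wedge_const (act R) a 1 n v).trans (mul_one _) }

/-- The wedge product of a scalar form and a form with values in `E`. -/
instance : Module (Forms R L R) (Forms R L E) where
  smul := wedge (act E)
  smul_add := fun a b c => wedge_add_right (act E) a b c
  add_smul := fun a b c => wedge_add_left (E := R) (act E) a b c
  zero_smul := fun a => wedge_zero_left (E := R) (act E) a
  smul_zero := fun a => wedge_zero_right (act E) a
  one_smul := fun a => ext_app fun n v => (const_wedge (act E) 1 a n v).trans (one_smul R _)
  mul_smul := wedge_assoc (act E) (act R) (act E) (act E) (fun x y z => mul_smul x y z)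

theorem const_mul (f : R) (a : Forms R L R) : const f * a = f • a :=
  ext_app fun n v => const_wedge (act R) f a n v

theorem mul_const (a : Forms R L R) (f : R) : a * const f = f • a :=
  ext_app fun n v => (wedge_const (act R) a f n v).trans (mul_comm _ _)

instance {K : Type*} [Field K] [Algebra K R] : Algebra K (Forms R L R) :=
  RingHom.toAlgebra'
    { toFun := fun c => const (algebraMap K R c)
      map_one' := by rw [map_one]; rfl
      map_mul' := fun c c' => by
        rw [const_mul, map_mul]
        refine ext_app fun n v => ?_
        cases n <;> simp [smul_app, const_zero_app, const_succ_app]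
      map_zero' := by
        rw [map_zero]
        refine ext_app fun n v => ?_
        cases n <;> rfl
      map_add' := fun c c' => by rw [map_add, const_add] }
    (fun c a => (const_mul _ a).trans (mul_const a _).symm)

theorem const_smul (f : R) (e : E) : (const (f • e) : Forms R L E) = f • const e := by
  refine ext_app fun n v => ?_
  cases n <;> simp [smul_app, const_zero_app, const_succ_app]

theorem algebra_smul {K : Type*} [Field K] [Algebra K R] (c : K) (a : Forms R L R) :
    c • a = algebraMap K R c • a := by
  rw [Algebra.smul_def]; exact const_mul _ a

theorem par_of_even (k : ℤ) (a : Forms R L E) (ha : a ∈ deg k) (hk : Even k) : par a = a := by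
  refine ext_app fun n v => ?_
  by_cases h : (n : ℤ) = k
  · have : Even n := by rw [← h] at hk; exact_mod_cast hk
    rw [par_app, this.neg_one_pow, one_smul]
  · rw [par_app, ha n h]; simp

theorem par_of_odd (k : ℤ) (a : Forms R L E) (ha : a ∈ deg k) (hk : Odd k) : par a = -a := by
  refine ext_app fun n v => ?_
  by_cases h : (n : ℤ) = k
  · have : Odd n := by rw [← h] at hk; exact_mod_cast hk
    rw [par_app, this.neg_one_pow, neg_app]; simp
  · rw [par_app, neg_app, ha n h]; simp

theorem mem_deg {k : ℤ} {a : Forms R L E} :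
    a ∈ deg k ↔ ∀ (n : ℕ) (v), (n : ℤ) ≠ k → a n v = 0 :=
  ⟨fun h n v hn => by rw [h n hn]; rfl, fun h n hn => AlternatingMap.ext fun v => h n v hn⟩

theorem ins_deg {k : ℤ} {a : Forms R L E} (x : L) (ha : a ∈ deg k) : ins x a ∈ deg (k - 1) :=
  mem_deg.2 fun n v hn => mem_deg.1 ha (n + 1) _ (by push_cast; omega)

theorem par_deg {k : ℤ} {a : Forms R L E} (ha : a ∈ deg k) : par a ∈ deg k :=
  mem_deg.2 fun n v hn => by rw [par_app, mem_deg.1 ha n v hn, smul_zero]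

theorem wedge_deg (B : E →ₗ[R] E' →ₗ[R] E'') {k l : ℤ} {a : Forms R L E} {b : Forms R L E'}
    (ha : a ∈ deg k) (hb : b ∈ deg l) : wedge B a b ∈ deg (k + l) := by
  refine mem_deg.2 fun n => ?_
  induction n generalizing k l a b with
  | zero =>
    intro v hn
    rw [wedge_zero_app]
    by_cases h : (0 : ℤ) = k
    · rw [mem_deg.1 hb 0 v (by push_cast at *; omega), map_zero]
    · rw [mem_deg.1 ha 0 v (by push_cast; omega), map_zero, LinearMap.zero_apply]
  | succ n ih =>
    intro v hn
    push_cast at hn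
    rw [succ_app, ins_wedge, add_app, ih (ins_deg _ ha) hb _ (by omega),
      ih (par_deg ha) (ins_deg _ hb) _ (by omega), add_zero]

end Ring

section Algebroid

variable {K : Type v} {R : Type w} [Field K] [CommRing R] [Algebra K R] {F : Distribution K R}
  {P : Conn F}

theorem lie_deg {k : ℤ} {a : Forms R F.sections P.carrier} (x : F.sections) (ha : a ∈ deg k) :
    lie x a ∈ deg k := by
  refine mem_deg.2 fun n => ?_
  induction n generalizing k a with
  | zero => intro v hn; rw [lie_zero_app, mem_deg.1 ha 0 v hn, map_zero]
  | succ n ih =>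
    intro v hn
    push_cast at hn
    rw [succ_app, ins_lie, sub_app, ih (ins_deg _ ha) _ (by omega),
      mem_deg.1 (ins_deg _ ha) n _ (by omega), sub_zero]

theorem ext_deg (k : ℤ) (a : Forms R F.sections P.carrier) (ha : a ∈ deg k) :
    ext a ∈ deg (k + 1) := by
  refine mem_deg.2 fun n => ?_
  induction n generalizing k a with
  | zero => intro v hn; rfl
  | succ n ih =>
    intro v hn
    push_cast at hn
    rw [succ_app, ins_ext, sub_app, mem_deg.1 (lie_deg _ ha) n _ (by omega),
      ih _ _ (ins_deg _ ha) _ (by omega), sub_zero]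

theorem ext_smul_const (c : K) (a : Forms R F.sections P.carrier) :
    ext (algebraMap K R c • a) = algebraMap K R c • ext a := by
  refine ext_app fun n v => ?_
  have h : (dfun (F := F) (algebraMap K R c)) = 0 := by
    refine eq_of_ins (fun v => rfl) fun x => ?_
    rw [ins_dfun, Derivation.map_algebraMap, map_zero]
    refine ext_app fun n v => ?_
    cases n <;> rfl
  refine (extAux_smul n (algebraMap K R c) a v).trans ?_
  rw [h, wedge_zero_left, zero_app, zero_add]
  rfl

end Algebroid

end Forms

section Functions

variable {K : Type v} {R : Type w} [Field K] [CommRing R] [Algebra K R] (F : Distribution K R)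

/-- The functions `Ω_F = Γ(∧ F^∨)` on the DG manifold `F[1]`, with the homological vector field
`d_F`, the Chevalley-Eilenberg differential of `F`. -/
def functions : DGAlg.{v, w} K where
  carrier := Forms R F.sections R
  deg := Forms.deg
  par :=
    { Forms.par with
      map_smul' := fun c a => by
        show Forms.par (c • a) = c • Forms.par a
        rw [Forms.algebra_smul, Forms.algebra_smul, Forms.par_smul] }
  d :=
    { Forms.ext (P := Conn.trivial F) with
      map_smul' := fun c a => by
        show Forms.ext (P := Conn.trivial F) (c • a) = c • Forms.ext (P := Conn.trivial F) a
        rw [Forms.algebra_smul, Forms.algebra_smul]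
        exact Forms.ext_smul_const (P := Conn.trivial F) c a }
  par_of_even := Forms.par_of_even
  par_of_odd := Forms.par_of_odd
  mul_deg _ _ _ _ ha hb := Forms.wedge_deg _ ha hb
  d_deg := Forms.ext_deg (P := Conn.trivial F)
  par_par := Forms.par_par
  par_one := Forms.par_const 1
  par_mul := Forms.par_wedge _
  comm_even a b h := Forms.ext_app fun n v =>
    (Forms.wedge_comm _ _ (fun x y => mul_comm x y) n a b v).1 h
  comm_odd a b h := Forms.ext_app fun n v =>
    (Forms.wedge_comm _ _ (fun x y => mul_comm x y) n a b v).2 h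
  par_d := Forms.par_ext (P := Conn.trivial F)
  d_mul := Forms.ext_wedge (P := Conn.trivial F) (Q := Conn.trivial F) (S := Conn.trivial F)
    (Forms.act R) (fun x e e' => by
      show x.1 (e * e') = x.1 e * e' + e * x.1 e'
      rw [Derivation.leibniz]; simp only [smul_eq_mul]; ring)

variable {F}

/-- The Chevalley-Eilenberg complex `Ω_F(P)` of `F` with coefficients in `P`. -/
def complex (P : Conn F) : DGMod (functions F) where
  carrier := Forms R F.sections P.carrier
  module := (inferInstance : Module (Forms R F.sections R) (Forms R F.sections P.carrier))
  deg := Forms.deg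
  par := Forms.par
  d := Forms.ext
  par_of_even := Forms.par_of_even
  par_of_odd := Forms.par_of_odd
  smul_deg _ _ _ _ ha hb := Forms.wedge_deg (Forms.act P.carrier) ha hb
  d_deg := Forms.ext_deg
  par_par := Forms.par_par
  par_smul a x := Forms.par_wedge (E := R) (Forms.act P.carrier) a x
  par_d := Forms.par_ext
  d_smul a x := Forms.ext_wedge (P := Conn.trivial F) (Forms.act P.carrier)
    (fun x f e => P.leibniz f x e) a x

variable (F) in
/-- The DG module `𝔛(F[1])` of vector fields on `F[1]`, with `L_{d_F}`. -/
abbrev vect : DGMod (functions F) := (functions F).vectorFields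

/-- The decomposable tensor `β ⊗ s ∈ Ω_F(P^∨ ⊗ S)` for `β ∈ Ω_F(P^∨)`, `s ∈ Ω_F(S)`. -/
def formDualTmul {P S : Conn F} (β : (complex (Conn.dual P)).carrier) (s : (complex S).carrier) :
    (complex (Conn.hom P S)).carrier :=
  Forms.wedge (E := P.carrier →ₗ[R] R) (E' := S.carrier) (E'' := P.carrier →ₗ[R] S.carrier)
    LinearMap.smulRightₗ β s

/-- The decomposable tensor `z ⊗ s ∈ Ω_F(P ⊗ S)` for `z ∈ Ω_F(P)`, `s ∈ Ω_F(S)`, where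
`P ⊗ S = Hom(P^∨, S)`. -/
def formTmul {P S : Conn F} (z : (complex P).carrier) (s : (complex S).carrier) :
    (complex (Conn.hom (Conn.dual P) S)).carrier :=
  Forms.wedge (E := P.carrier) (E' := S.carrier) (E'' := (P.carrier →ₗ[R] R) →ₗ[R] S.carrier)
    (LinearMap.smulRightₗ ∘ₗ Module.Dual.eval R P.carrier) z s

/-- The pairing `Ω_F(P^∨) × Ω_F(P) → Ω_F`. -/
def formPair {P : Conn F} (β : (complex (Conn.dual P)).carrier) (z : (complex P).carrier) :
    (functions F).carrier :=
  Forms.wedge (E := P.carrier →ₗ[R] R) (E' := P.carrier) (E'' := R) LinearMap.id β z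

/-! ### The contraction for vector fields -/

/-- The tangent map `π_* : 𝔛(F[1]) → Ω_F(T)` of the projection `π : F[1] → M`, determined by
`π_*(X)(f) = X(π^* f)`. -/
def pushforward (X : (vect F).carrier) : Forms R F.sections (Derivation K R R) := fun n =>
  { toFun := fun v => Derivation.mk'
      { toFun := fun f => (X.1 (Forms.const f) : Forms R F.sections R) n v
        map_add' := fun f g => by
          rw [Forms.const_add]
          exact congrArg (fun ω : Forms R F.sections R => ω n v) (X.1.map_add _ _)
        map_smul' := fun c f => by
          have h : (Forms.const (c • f) : Forms R F.sections R) = c • Forms.const f := by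
            rw [Forms.algebra_smul, ← Forms.const_smul, algebraMap_smul]
          rw [h]
          refine (congrArg (fun ω : Forms R F.sections R => ω n v) (X.1.map_smul _ _)).trans ?_
          exact (congrArg (fun ω : Forms R F.sections R => ω n v)
            (Forms.algebra_smul c _)).trans (algebraMap_smul R c _) }
      (fun f g => by
        have h : (Forms.const (f * g) : Forms R F.sections R) = Forms.const f * Forms.const g :=
          (Forms.const_smul f g).trans (Forms.const_mul _ _).symm
        show (X.1 (Forms.const (f * g)) : Forms R F.sections R) n v
          = f * (X.1 (Forms.const g) : Forms R F.sections R) n v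
            + g * (X.1 (Forms.const f) : Forms R F.sections R) n v
        rw [h]
        refine (congrArg (fun ω : Forms R F.sections R => ω n v)
          (X.2.1 (Forms.const f) (Forms.const g) (Forms.par_const f))).trans ?_
        refine (congrArg (fun ω : Forms R F.sections R => ω n v)
          (congrArg₂ (· + ·) (Forms.mul_const (X.1 (Forms.const f)) g)
            (Forms.const_mul f (X.1 (Forms.const g))))).trans ?_
        exact add_comm _ _)
    map_update_add' := fun v i x y => Derivation.ext fun f =>
      ((X.1 (Forms.const f) : Forms R F.sections R) n).map_update_add v i x y
    map_update_smul' := fun v i c x => Derivation.ext fun f =>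
      ((X.1 (Forms.const f) : Forms R F.sections R) n).map_update_smul v i c x
    map_eq_zero_of_eq' := fun v i j hv hij => Derivation.ext fun f =>
      ((X.1 (Forms.const f) : Forms R F.sections R) n).map_eq_zero_of_eq v hv hij }

/-- `φ = pr_B ∘ π_* : 𝔛(F[1]) → Ω_F(B)`. -/
def phi : (vect F).carrier →+ (complex (Conn.bott F)).carrier where
  toFun X := fun n => F.sections.mkQ.compAlternatingMap (pushforward X n)
  map_zero' := rfl
  map_add' _ _ := rfl

/-- A splitting `j : B → T` of `0 → F → T → B → 0` (on sections). -/
structure Splitting (F : Distribution K R) where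
  /-- the map `j` -/
  map : F.Quot →ₗ[R] Derivation K R R
  mkQ_map : ∀ z, F.sections.mkQ (map z) = z

/-- The projection `pr_F = id - j ∘ pr_B : T → F` defined by a splitting `j`. -/
def prF (j : Splitting F) : Derivation K R R →ₗ[R] F.sections :=
  (LinearMap.id - j.map ∘ₗ F.sections.mkQ).codRestrict F.sections fun X => by
    refine (Submodule.Quotient.eq F.sections (x := X) (y := j.map (F.sections.mkQ X))).1 ?_
    exact (j.mkQ_map (F.sections.mkQ X)).symm

/-- A form `ω` as the form `V ↦ ι_V ω` with values in the dual of `F`. -/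
def flat (ω : Forms R F.sections R) : Forms R F.sections (Module.Dual R F.sections) := fun n =>
  { toFun := fun v =>
      { toFun := fun V => Forms.ins V ω n v
        map_add' := fun V W => by rw [Forms.ins_add_left]; rfl
        map_smul' := fun f V => by rw [Forms.ins_smul_left]; rfl }
    map_update_add' := fun v i x y => LinearMap.ext fun V =>
      (Forms.ins V ω n).map_update_add v i x y
    map_update_smul' := fun v i c x => LinearMap.ext fun V =>
      (Forms.ins V ω n).map_update_smul v i c x
    map_eq_zero_of_eq' := fun v i j hv hij => LinearMap.ext fun V =>
      (Forms.ins V ω n).map_eq_zero_of_eq v hv hij }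

/-- The contraction operator `ι_η` for `η ∈ Ω_F(F)`: `ι_{α ⊗ V} ω = α ∧ ι_V ω`. -/
def contract (η : Forms R F.sections F.sections) (ω : Forms R F.sections R) :
    Forms R F.sections R :=
  Forms.wedge (Module.Dual.eval R F.sections) η (flat ω)

/-- `ψ = ψ_j : Ω_F(B) → 𝔛(F[1])` is the `Ω_F`-linear map with `ψ_j(Z)(π^* f) = j(Z)(f)` and
`ψ_j(Z)(ξ)(V) = j(Z)(ξ(V)) - ξ(pr_F [j(Z), V])` for sections `Z` of `B`, functions `f`,
`1`-forms `ξ` and sections `V` of `F`. -/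
structure IsPsi (j : Splitting F)
    (ψ : (complex (Conn.bott F)).carrier →+ (vect F).carrier) : Prop where
  smul : ∀ (a : (functions F).carrier) y, ψ (a • y) = a • ψ y
  apply_fun : ∀ (z : F.Quot) (f : R),
    (ψ (Forms.const z)).1 (Forms.const f) = (Forms.const (j.map z f) : Forms R F.sections R)
  apply_form : ∀ (z : F.Quot) (ξ : Forms R F.sections R), ξ ∈ Forms.deg 1 →
    (ψ (Forms.const z)).1 ξ ∈ (functions F).deg 1 ∧ ∀ V : F.sections,
      ((ψ (Forms.const z)).1 ξ : Forms R F.sections R) 1 (fun _ => V)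
        = j.map z (ξ 1 fun _ => V) - ξ 1 (fun _ => prF j ⁅j.map z, V.1⁆)

/-- `h = h_j : 𝔛(F[1]) → 𝔛(F[1])` is `h_j(X) = (-1)^|X| ι_{pr_F(π_* X)}`. -/
def IsHomotopy (j : Splitting F)
    (h : (vect F).carrier →+ (vect F).carrier) : Prop :=
  ∀ (X : (vect F).carrier) (ω : Forms R F.sections R),
    (h X).1 ω = contract
      (fun n => (prF j).compAlternatingMap (pushforward ((vect F).par X) n)) ω

/-- The `Ω_F`-duals of `φ`, `ψ`, `h`:
`⟨φ^∨ β, X⟩ = ⟨β, φ X⟩`, `⟨ψ^∨ α, z⟩ = ⟨α, ψ z⟩`, `⟨h^∨ α, X⟩ = (-1)^|α| ⟨α, h X⟩`. -/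
structure IsDual (φ : (vect F).carrier →+ (complex (Conn.bott F)).carrier)
    (ψ : (complex (Conn.bott F)).carrier →+ (vect F).carrier)
    (h : (vect F).carrier →+ (vect F).carrier)
    (φd : (complex (Conn.dual (Conn.bott F))).carrier →+ (DGMod.dual (vect F)).carrier)
    (ψd : (DGMod.dual (vect F)).carrier →+ (complex (Conn.dual (Conn.bott F))).carrier)
    (hd : (DGMod.dual (vect F)).carrier →+ (DGMod.dual (vect F)).carrier) : Prop where
  phi_dual : ∀ β X, DGMod.pair (φd β) X = formPair β (φ X)
  psi_dual : ∀ α z, formPair (ψd α) z = DGMod.pair α (ψ z)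
  h_dual : ∀ α X, DGMod.pair (hd α) X = DGMod.pair ((DGMod.dual (vect F)).par α) (h X)

/-- The tensor trick: `Φ_m^n = (ψ^∨)^{⊗ m} ⊗ φ^{⊗ n}`, `Ψ_m^n = (φ^∨)^{⊗ m} ⊗ ψ^{⊗ n}` and
`H_m^n = ∑_{i=1}^m (φ^∨ ψ^∨)^{⊗ (i-1)} ⊗ h^∨ ⊗ id^{⊗ (n+m-i)}
  + ∑_{l=1}^n (φ^∨ ψ^∨)^{⊗ m} ⊗ (ψ φ)^{⊗ (l-1)} ⊗ h ⊗ id^{⊗ (n-l)}`,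
expressed on decomposable tensors by recursion on the number of factors, with the Koszul sign
`(f ⊗ g)(x ⊗ t) = (-1)^{|g||x|} f(x) ⊗ g(t)`. -/
structure IsTensorTrick (φ : (vect F).carrier →+ (complex (Conn.bott F)).carrier)
    (ψ : (complex (Conn.bott F)).carrier →+ (vect F).carrier)
    (h : (vect F).carrier →+ (vect F).carrier)
    (φd : (complex (Conn.dual (Conn.bott F))).carrier →+ (DGMod.dual (vect F)).carrier)
    (ψd : (DGMod.dual (vect F)).carrier →+ (complex (Conn.dual (Conn.bott F))).carrier)
    (hd : (DGMod.dual (vect F)).carrier →+ (DGMod.dual (vect F)).carrier)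
    (Φ : ∀ m n, ((vect F).tens m n).carrier →+ (complex ((Conn.bott F).tens m n)).carrier)
    (Ψ : ∀ m n, (complex ((Conn.bott F).tens m n)).carrier →+ ((vect F).tens m n).carrier)
    (H : ∀ m n, ((vect F).tens m n).carrier →+ ((vect F).tens m n).carrier) : Prop where
  Φ_zero : ∀ a : (functions F).carrier, Φ 0 0 a = a
  Ψ_zero : ∀ a : (functions F).carrier, Ψ 0 0 a = a
  H_zero : ∀ a : (functions F).carrier, H 0 0 a = 0
  Φ_tmul : ∀ n X (t : ((vect F).tens 0 n).carrier),
    Φ 0 (n + 1) (DGMod.tmul (T := (vect F).tens 0 n) X t)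
      = formTmul (S := (Conn.bott F).tens 0 n) (φ X) (Φ 0 n t)
  Ψ_tmul : ∀ n z (s : (complex ((Conn.bott F).tens 0 n)).carrier),
    Ψ 0 (n + 1) (formTmul (S := (Conn.bott F).tens 0 n) z s)
      = DGMod.tmul (T := (vect F).tens 0 n) (ψ z) (Ψ 0 n s)
  H_tmul : ∀ n X (t : ((vect F).tens 0 n).carrier),
    H 0 (n + 1) (DGMod.tmul (T := (vect F).tens 0 n) X t)
      = DGMod.tmul (T := (vect F).tens 0 n) (h X) t
        + DGMod.tmul (T := (vect F).tens 0 n) (ψ (φ ((vect F).par X))) (H 0 n t)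
  Φ_dualTmul : ∀ m n α t, Φ (m + 1) n (DGMod.dualTmul α t) = formDualTmul (ψd α) (Φ m n t)
  Ψ_dualTmul : ∀ m n β s, Ψ (m + 1) n (formDualTmul β s) = DGMod.dualTmul (φd β) (Ψ m n s)
  H_dualTmul : ∀ m n α t, H (m + 1) n (DGMod.dualTmul α t)
    = DGMod.dualTmul (hd α) t
      + DGMod.dualTmul (φd (ψd ((DGMod.dual (vect F)).par α))) (H m n t)

end Functions

/-! ### Distributions on a manifold -/

section Manifold

open scoped Manifold ContDiff TensorProduct

variable (𝕂 : Type*) [RCLike 𝕂] (E : Type*) [NormedAddCommGroup E] [NormedSpace ℝ E]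
  (M : Type*) [TopologicalSpace M] [ChartedSpace E M]

/-- The algebra `C^∞(M, 𝕂)`. -/
def smoothFunctions : Subalgebra 𝕂 (M → 𝕂) where
  carrier := {f | ContMDiff 𝓘(ℝ, E) 𝓘(ℝ, 𝕂) ∞ f}
  mul_mem' := fun hf hg => 
    (contDiff_mul (𝕜 := ℝ) (𝔸 := 𝕂) (n := ∞)).contMDiff.comp (hf.prodMk_space hg)
  add_mem' := fun hf hg => ContMDiff.add hf hg
  algebraMap_mem' := fun _ => contMDiff_const

variable {M}

/-- The complexified (if `𝕂 = ℂ`) tangent space `T_𝕂 M = TM ⊗_ℝ 𝕂` at a point. -/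
abbrev TangentK (x : M) : Type _ := 𝕂 ⊗[ℝ] TangentSpace 𝓘(ℝ, E) x

variable {𝕂 E}

/-- The differential of a `𝕂`-valued function, extended `𝕂`-linearly to `T_𝕂 M`:
`c ⊗ v ↦ c · df(v)`. -/
def differential (f : M → 𝕂) (x : M) : TangentK 𝕂 E x →ₗ[𝕂] 𝕂 :=
  LinearMap.liftBaseChange (R := ℝ) (M := TangentSpace 𝓘(ℝ, E) x) (N := 𝕂) 𝕂
    (mfderiv 𝓘(ℝ, E) 𝓘(ℝ, 𝕂) f x).toLinearMap

variable (𝕂 E M) in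
/-- The module of smooth sections of `T_𝕂 M`: the `𝕂`-linear derivations of `C^∞(M, 𝕂)`. -/
abbrev SectionsK : Type _ :=
  Derivation 𝕂 (smoothFunctions 𝕂 E M) (smoothFunctions 𝕂 E M)

/-- The section `X` of `T_𝕂 M` has the value `v` at `x`. -/
def HasValue (X : SectionsK 𝕂 E M) (x : M) (v : TangentK 𝕂 E x) : Prop :=
  ∀ f : smoothFunctions 𝕂 E M, (X f).1 x = differential f.1 x v

/-- A family of subspaces of the fibres of `T_𝕂 M` is a smooth subbundle if, locally, it has a
smooth frame. -/
def IsSubbundle (F : ∀ x : M, Submodule 𝕂 (TangentK 𝕂 E x)) : Prop :=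
  ∀ x₀ : M, ∃ (r : ℕ) (X : Fin r → SectionsK 𝕂 E M), ∀ᶠ x in nhds x₀,
    ∃ v : Fin r → TangentK 𝕂 E x, (∀ i, HasValue (X i) x (v i)) ∧
      LinearIndependent 𝕂 v ∧ Submodule.span 𝕂 (Set.range v) = F x

/-- The module `Γ(F)` of smooth sections of `F`. -/
def sectionsOf (F : ∀ x : M, Submodule 𝕂 (TangentK 𝕂 E x)) :
    Submodule (smoothFunctions 𝕂 E M) (SectionsK 𝕂 E M) where
  carrier := {X | ∀ x, ∃ v ∈ F x, HasValue X x v}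
  zero_mem' := fun x => ⟨0, zero_mem _, fun f => by rw [map_zero]; rfl⟩
  add_mem' := fun {X Y} hX hY x => by
    obtain ⟨v, hv, h⟩ := hX x
    obtain ⟨w, hw, h'⟩ := hY x
    exact ⟨v + w, add_mem hv hw, fun f => by rw [map_add, ← h, ← h']; rfl⟩
  smul_mem' := fun g X hX x => by
    obtain ⟨v, hv, h⟩ := hX x
    exact ⟨g.1 x • v, Submodule.smul_mem _ _ hv, fun f => by rw [map_smul, ← h]; rfl⟩

/-- Integrability (involutivity): the sections are closed under the Lie bracket. -/
def IsInvolutive (F : ∀ x : M, Submodule 𝕂 (TangentK 𝕂 E x)) : Prop :=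
  ∀ X ∈ sectionsOf F, ∀ Y ∈ sectionsOf F, ⁅X, Y⁆ ∈ sectionsOf F

/-- The sections of an integrable distribution. -/
def distributionOf (F : ∀ x : M, Submodule 𝕂 (TangentK 𝕂 E x)) (hF : IsInvolutive F) :
    Distribution 𝕂 (smoothFunctions 𝕂 E M) where
  sections := sectionsOf F
  lie_mem := hF

end Manifold

end FoliationDG

end

open FoliationDG
open scoped Manifold ContDiff

noncomputable section
namespace FoliationDG
universe u v w

/-! Everything rests on one principle: a vector field X on F[1] is determined by its values on
functions f and on their differentials df, since these generate Ω_F locally. Because (L X)(f) =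
d_F(X f) - (-1)^|X| X(df) for L = L_{d_F}, the field X vanishes as soon as π_* X and π_*(L X) vanish
(`vect_eq_zero_of_pushforward`). An identity between vector fields thus becomes two identities
between forms with values in T_𝕂 M.

For ψ = ψ_j one finds π_* ψ = j and π_* L ψ = j d_B (`pushforward_psi`, `pushforward_d_psi`); for h
= h_j, π_* h = 0 and π_* L h = pr_F π_* (`pushforward_homotopyMap`, `pushforward_d_homotopyMap`).
The first pair and the flatness of the Bott connection make ψ a cochain map. The second shows that X
- ψφX - L h X is vertical, i.e. killed by π_*. A vertical field Y satisfies φ L Y = 0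
(`phi_d_of_vertical`): it acts linearly over functions, so it kills the restriction to F of a 1-form
annihilating F, that restriction being zero. Hence φ is a cochain map, and the homotopy identity
follows from the principle and from X = j pr_B X + pr_F X. The side conditions hold because h
depends on its argument only through pr_F π_*.

Duals and tensors are handled together, since all tensor modules are iterated modules of linear
maps. Contractions (p, i, h) of E and (p', i', h') of T induce one of Hom(E, T), namely f ↦ p' f i,
g ↦ i' g p, f ↦ (-1)^|f| f h + h' f i p (`IsParContraction.hom`). If P has local frames, the graded
linear maps Ω_F(P) → Ω_F(S) are the forms with values in Hom(P, S) (`symbolEquiv`), so the small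
complex is again a Chevalley-Eilenberg complex. Recursion on the number of factors gives all m, n,
and the formulas on decomposable tensors are computations of Koszul signs.

The algebra takes place over a commutative algebra R. The manifold enters through `Separated` and
`HasFrames`, both expressed by functions χ for which χ X = χ ∑ X(xᵢ) eᵢ for every derivation X. On
C^∞(M, 𝕂), bump functions and Hadamard's lemma provide such a χ with χ(p) = 1 at any point p. -/

theorem derivation_sum_apply {K R : Type*} [CommRing K] [CommRing R] [Algebra K R] {ι : Type*}
    (s : Finset ι) (e : ι → Derivation K R R) (f : R) :
    (∑ i ∈ s, e i) f = ∑ i ∈ s, e i f := by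
  have := congrFun (map_sum (Derivation.coeFnAddMonoidHom (R := K) (A := R) (M := R)) e s) f
  rwa [Finset.sum_apply] at this

/-! ### Local frames -/

section Torsion

variable {R : Type*} [CommRing R]

/-- The elements killed by a power of `χ`. -/
def tors (χ : R) (E : Type*) [AddCommGroup E] [Module R E] : Submodule R E where
  carrier := {e | ∃ k : ℕ, χ ^ k • e = 0}
  zero_mem' := ⟨0, smul_zero _⟩
  add_mem' := by
    rintro a b ⟨k, hk⟩ ⟨l, hl⟩
    refine ⟨k + l, ?_⟩
    rw [smul_add, pow_add, mul_smul _ _ b, hl, smul_zero, add_zero, mul_comm, mul_smul, hk,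
      smul_zero]
  smul_mem' := by
    rintro c a ⟨k, hk⟩
    exact ⟨k, by rw [smul_comm, hk, smul_zero]⟩

variable {E E' : Type*} [AddCommGroup E] [Module R E] [AddCommGroup E'] [Module R E'] {χ : R}

theorem map_mem_tors (T : E →ₗ[R] E') {e : E} (h : e ∈ tors χ E) : T e ∈ tors χ E' := by
  obtain ⟨k, hk⟩ := h
  exact ⟨k, by rw [← map_smul, hk, map_zero]⟩

theorem mem_tors_of_pow_smul {e : E} (k : ℕ) (h : χ ^ k • e ∈ tors χ E) : e ∈ tors χ E := by
  obtain ⟨l, hl⟩ := h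
  exact ⟨l + k, by rw [pow_add, mul_smul, hl]⟩

variable (K : Type*) [CommRing K] [Algebra K R]

/-- `χ` is supported in a coordinate domain: up to multiplication by `χ`, every derivation `X`
is `∑ X(xᵢ) eᵢ`. -/
def IsChartFn (χ : R) : Prop :=
  ∃ (n : ℕ) (x : Fin n → R) (e : Fin n → Derivation K R R),
    ∀ X : Derivation K R R, χ • X = χ • ∑ i, X (x i) • e i

variable (R) in
/-- Elements of `E` that vanish locally, in coordinate domains, vanish. -/
def Separated (E : Type*) [AddCommGroup E] [Module R E] : Prop :=
  ∀ e : E, (∀ χ : R, IsChartFn K χ → e ∈ tors χ E) → e = 0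

variable (R) in
/-- `P` has local frames, with their dual frames. -/
def HasFrames (P : Type*) [AddCommGroup P] [Module R P] : Prop :=
  ∀ χ : R, IsChartFn K χ → ∃ (n : ℕ) (l : Fin n → Module.Dual R P) (e : Fin n → P),
    ∀ m, χ • m = χ • ∑ i, l i m • e i

variable {K}

/-- Linear maps preserve being killed by a power of χ, so separatedness is pulled back along a
family of maps with trivial common kernel. Evaluations form such a family, both on linear maps and
on forms; hence everything reduces to the separatedness of R. -/
theorem Separated.of_linearMaps {ι : Type*} (h : Separated R K E') (T : ι → E →ₗ[R] E')
    (hT : ∀ e, (∀ i, T i e = 0) → e = 0) : Separated R K E := fun e he =>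
  hT e fun i => h _ fun χ hχ => map_mem_tors (T i) (he χ hχ)

theorem Separated.linearMap {P : Type*} [AddCommGroup P] [Module R P] (h : Separated R K E) :
    Separated R K (P →ₗ[R] E) :=
  h.of_linearMaps (ι := P) LinearMap.applyₗ fun _ he => LinearMap.ext he

/-- The value of a form, as a linear function of the form. -/
def Forms.eval {L : Type*} [AddCommGroup L] [Module R L] (n : ℕ) (v : Fin n → L) :
    Forms R L E →ₗ[R] E where
  toFun a := a n v
  map_add' _ _ := rfl
  map_smul' _ _ := rfl

theorem Separated.forms {L : Type*} [AddCommGroup L] [Module R L] (h : Separated R K E) :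
    Separated R K (Forms R L E) :=
  h.of_linearMaps (ι := (n : ℕ) × (Fin n → L)) (fun p => Forms.eval p.1 p.2)
    fun _ he => Forms.ext_app fun n v => he ⟨n, v⟩

theorem hasFrames_derivation : HasFrames R K (Derivation K R R) := by
  rintro χ ⟨n, x, e, h⟩
  exact ⟨n, fun i =>
    { toFun := fun X => X (x i), map_add' := fun _ _ => rfl, map_smul' := fun _ _ => rfl }, e, h⟩

/-- The frame of P is projected by `p` and its coefficient functions are composed with `i`. Applied
to j and pr_B, this turns coordinate vector fields into frames of B. -/
theorem HasFrames.of_retract {P Q : Type*} [AddCommGroup P] [Module R P] [AddCommGroup Q]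
    [Module R Q] (h : HasFrames R K P) (i : Q →ₗ[R] P) (p : P →ₗ[R] Q) (hp : ∀ q, p (i q) = q) :
    HasFrames R K Q := by
  intro χ hχ
  obtain ⟨n, l, e, h⟩ := h χ hχ
  refine ⟨n, fun k => l k ∘ₗ i, fun k => p (e k), fun m => ?_⟩
  have := congrArg p (h (i m))
  simpa [hp] using this

/-- The frame and its dual frame exchange their roles: m is locally ∑ m(eᵢ) lᵢ. -/
theorem HasFrames.dual {P : Type*} [AddCommGroup P] [Module R P] (h : HasFrames R K P) :
    HasFrames R K (Module.Dual R P) := by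
  intro χ hχ
  obtain ⟨n, l, e, h⟩ := h χ hχ
  refine ⟨n, fun k => Module.Dual.eval R P (e k), l, fun m => LinearMap.ext fun z => ?_⟩
  have := congrArg m (h z)
  simp only [map_smul, map_sum, smul_eq_mul] at this
  simp only [LinearMap.smul_apply, LinearMap.sum_apply, smul_eq_mul, Module.Dual.eval_apply, this]
  congr 1
  exact Finset.sum_congr rfl fun i _ => mul_comm _ _

end Torsion

/-! ### Forms: naturality of the wedge product, commutativity -/

namespace Forms

section

variable {R : Type*} [CommRing R] {L : Type*} [AddCommGroup L] [Module R L]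
variable {E E' E'' E₁ E₂ E₃ : Type*} [AddCommGroup E] [Module R E] [AddCommGroup E'] [Module R E']
  [AddCommGroup E''] [Module R E'']
  [AddCommGroup E₁] [Module R E₁] [AddCommGroup E₂] [Module R E₂] [AddCommGroup E₃] [Module R E₃]

/-- Change of coefficients. -/
def map (T : E →ₗ[R] E') : Forms R L E →ₗ[R] Forms R L E' where
  toFun μ := fun n => T.compAlternatingMap (μ n)
  map_add' _ _ := ext_app fun _ _ => T.map_add _ _
  map_smul' _ _ := ext_app fun _ _ => T.map_smul _ _

theorem map_app (T : E →ₗ[R] E') (μ : Forms R L E) (n : ℕ) (v : Fin n → L) :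
    map T μ n v = T (μ n v) := rfl

theorem ins_map (T : E →ₗ[R] E') (x : L) (μ : Forms R L E) : ins x (map T μ) = map T (ins x μ) :=
  rfl

theorem par_map (T : E →ₗ[R] E') (μ : Forms R L E) : par (map T μ) = map T (par μ) :=
  ext_app fun n v => by rw [par_app, map_app, map_app, par_app, map_zsmul]

theorem map_const (T : E →ₗ[R] E') (e : E) : map T (const e : Forms R L E) = const (T e) := by
  refine ext_app fun n v => ?_
  cases n with
  | zero => rfl
  | succ n => exact T.map_zero

theorem map_deg (T : E →ₗ[R] E') {k : ℤ} {μ : Forms R L E} (h : μ ∈ deg k) : map T μ ∈ deg k :=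
  mem_deg.2 fun n v hn => by rw [map_app, mem_deg.1 h n v hn, map_zero]

theorem const_deg (e : E) : (const e : Forms R L E) ∈ deg 0 :=
  mem_deg.2 fun n v hn => by
    cases n with
    | zero => exact absurd rfl hn
    | succ n => rfl

/-- Mostly used with `T` an evaluation at a fixed vector, to reduce identities between bundle-valued
forms to identities between simpler forms. -/
theorem map_wedge (B : E →ₗ[R] E' →ₗ[R] E'') (B' : E₁ →ₗ[R] E₂ →ₗ[R] E₃) (T : E'' →ₗ[R] E₃)
    (T₁ : E →ₗ[R] E₁) (T₂ : E' →ₗ[R] E₂) (h : ∀ x y, T (B x y) = B' (T₁ x) (T₂ y))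
    (a : Forms R L E) (b : Forms R L E') :
    map T (wedge B a b) = wedge B' (map T₁ a) (map T₂ b) := by
  refine ext_app fun n => ?_
  induction n generalizing a b with
  | zero => intro v; simp [map_app, wedge_zero_app, h]
  | succ n ih =>
    intro v
    rw [succ_app, succ_app, ins_map, ins_wedge, ins_wedge, map_add, add_app, add_app, ih, ih, par_map]
    rfl

theorem wedge_comm_even (B : E →ₗ[R] E' →ₗ[R] E'') (B' : E' →ₗ[R] E →ₗ[R] E'')
    (hB : ∀ x y, B x y = B' y x) {a : Forms R L E} (b : Forms R L E') (ha : par a = a) :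
    wedge B a b = wedge B' b a := ext_app fun n v => (wedge_comm B B' hB n a b v).1 ha

theorem wedge_comm_odd (B : E →ₗ[R] E' →ₗ[R] E'') (B' : E' →ₗ[R] E →ₗ[R] E'')
    (hB : ∀ x y, B x y = B' y x) {a : Forms R L E} (b : Forms R L E') (ha : par a = -a) :
    wedge B a b = wedge B' (par b) a := ext_app fun n v => (wedge_comm B B' hB n a b v).2 ha

theorem const_wedge_eq (B : E →ₗ[R] E' →ₗ[R] E'') (e : E) (b : Forms R L E') :
    wedge B (const e) b = map (B e) b := ext_app fun n v => const_wedge B e b n v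

theorem wedge_const_eq (B : E →ₗ[R] E' →ₗ[R] E'') (a : Forms R L E) (e : E') :
    wedge B a (const e) = map (B.flip e) a := ext_app fun n v => wedge_const B a e n v

theorem form_smul_def (a : Forms R L R) (b : Forms R L E) : a • b = wedge (act E) a b := rfl

theorem const_form_smul (f : R) (b : Forms R L E) : (const f : Forms R L R) • b = f • b :=
  const_wedge_eq (act E) f b

theorem smul_wedge (B : E →ₗ[R] E' →ₗ[R] E'') (a : Forms R L R) (b : Forms R L E)
    (c : Forms R L E') : wedge B (a • b) c = a • wedge B b c :=
  wedge_assoc B (act E) (act E'') B (fun x y z => by simp) a b c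

/-- The scalar form is carried to the other side of `b` by graded commutativity and the product is
then reassociated. In the odd case the exchange replaces `b` by `par b`. -/
theorem wedge_smul_even (B : E →ₗ[R] E' →ₗ[R] E'') {a : Forms R L R} (ha : par a = a)
    (b : Forms R L E) (c : Forms R L E') : wedge B b (a • c) = a • wedge B b c := by
  rw [← smul_wedge, form_smul_def a b, wedge_comm_even (act E) (act E).flip (fun _ _ => rfl) b ha]
  exact (wedge_assoc B (act E).flip B (act E') (fun x y z => by simp) b a c).symm

theorem wedge_smul_odd (B : E →ₗ[R] E' →ₗ[R] E'') {a : Forms R L R} (ha : par a = -a)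
    (b : Forms R L E) (c : Forms R L E') : wedge B b (a • c) = a • wedge B (par b) c := by
  rw [← smul_wedge, form_smul_def a (par b), wedge_comm_odd (act E) (act E).flip (fun _ _ => rfl) _ ha,
    par_par]
  exact (wedge_assoc B (act E).flip B (act E') (fun x y z => by simp) b a c).symm

theorem map_form_smul (T : E →ₗ[R] E') (a : Forms R L R) (b : Forms R L E) :
    map T (a • b) = a • map T b :=
  map_wedge (act E) (act E') T LinearMap.id T (fun x y => by simp) a b

end

end Forms

/-! ### Flat connections -/

section Flat

variable {K : Type v} {R : Type w} [Field K] [CommRing R] [Algebra K R] {F : Distribution K R}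

/-- Flatness of a connection. -/
def Conn.IsFlat (P : Conn F) : Prop := ∀ (x y : F.sections) (e : P.carrier),
  P.nabla (F.bracket x y) e = P.nabla x (P.nabla y e) - P.nabla y (P.nabla x e)

theorem Conn.isFlat_trivial : (Conn.trivial F).IsFlat := fun _ _ e =>
  Derivation.commutator_apply e

theorem Conn.isFlat_bott : (Conn.bott F).IsFlat := fun x y e => by
  obtain ⟨Z, rfl⟩ := Submodule.Quotient.mk_surjective _ e
  exact congrArg (Submodule.Quotient.mk (p := F.sections)) (lie_lie x.1 y.1 Z)

namespace Forms

variable {P : Conn F}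

theorem lie_sub (x : F.sections) (a b : Forms R F.sections P.carrier) :
    lie x (a - b) = lie x a - lie x b := by
  rw [sub_eq_add_neg, lie_add, lie_neg, sub_eq_add_neg]

theorem bracket_bracket (x y z : F.sections) :
    F.bracket (F.bracket x y) z = F.bracket x (F.bracket y z) - F.bracket y (F.bracket x z) :=
  Subtype.ext (lie_lie x.1 y.1 z.1)

/-- Induction on the degree, by taking interior products: degree 0 is flatness, and the correction
terms produced by `ins_lie` match by the Jacobi identity. Then L_x commutes with d, and d² = 0
follows from ι_x d d = L_x d - d L_x + d d ι_x, all by the same induction. -/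
theorem lie_bracket (hP : P.IsFlat) (x y : F.sections) (a : Forms R F.sections P.carrier) :
    lie (F.bracket x y) a = lie x (lie y a) - lie y (lie x a) := by
  refine ext_app fun n => ?_
  induction n generalizing a with
  | zero => intro v; simp only [lie_zero_app, sub_app]; exact hP x y _
  | succ n ih =>
    intro v
    rw [succ_app, succ_app, map_sub]
    simp only [ins_lie, lie_sub, sub_app, ih, bracket_bracket, ins_sub_left]
    abel

theorem lie_ext (hP : P.IsFlat) (x : F.sections) (a : Forms R F.sections P.carrier) :
    lie x (ext a) = ext (lie x a) := by
  refine ext_app fun n => ?_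
  induction n generalizing a with
  | zero => intro v; rw [lie_zero_app, ext_zero_app, map_zero, ext_zero_app]
  | succ n ih =>
    intro v
    rw [succ_app, succ_app]
    simp only [ins_lie, ins_ext, lie_sub, map_sub, sub_app, ih, lie_bracket hP]
    abel

theorem ext_ext (hP : P.IsFlat) (a : Forms R F.sections P.carrier) : ext (ext a) = 0 := by
  refine ext_app fun n => ?_
  induction n generalizing a with
  | zero => intro v; rfl
  | succ n ih =>
    intro v
    rw [succ_app, ins_ext, ins_ext, map_sub, lie_ext hP, sub_app, sub_app, ih]
    simp [zero_app]

theorem par_dfun (f : R) : par (dfun (F := F) f) = -dfun f := by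
  refine eq_of_ins (fun v => by simp [par_app, neg_app, dfun]) fun y => ?_
  rw [ins_par, ins_dfun, par_const, map_neg, ins_dfun]

theorem ext_const (f : R) : ext (P := Conn.trivial F) (const f) = dfun f := by
  refine eq_of_ins (fun v => rfl) fun x => ?_
  rw [ins_ext, ins_const, ins_dfun, map_zero, sub_zero]
  refine ext_app fun n v => ?_
  cases n with
  | zero => rfl
  | succ n =>
    rw [succ_app, ins_lie, ins_const, ins_const, lie_zero, sub_zero]; rfl

end Forms

end Flat

end FoliationDG
end

noncomputable section
namespace FoliationDG
universe u v w

/-! ### Forms in a local frame -/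

namespace Forms

section Frame

variable {R : Type*} [CommRing R] {L : Type*} [AddCommGroup L] [Module R L]
variable {E : Type*} [AddCommGroup E] [Module R E]

/-- Forms of degree larger than the number of local generators vanish locally. -/
theorem pow_smul_app_eq_zero {χ : R} {n : ℕ} {l : Fin n → L → R} {e : Fin n → L}
    (h : ∀ m, χ • m = χ • ∑ i, l i m • e i) (d : ℕ) (a : Forms R L E) (v : Fin (n + 1 + d) → L) :
    χ ^ (n + 1) • a (n + 1 + d) v = 0 := by
  induction d generalizing a with
  | zero =>
    -- Each of the n + 1 arguments absorbs one factor χ, which allows it to be replaced by its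
    -- expansion in the n local generators.
    have h1 : χ ^ (n + 1) • a (n + 1) v = a (n + 1) (fun i => χ • v i) := by
      have := (a (n + 1)).toMultilinearMap.map_smul_univ (fun _ => χ) v
      simpa using this.symm
    have h2 : (fun i => χ • v i) = fun i => χ • ∑ k, l k (v i) • e k := funext fun i => h (v i)
    have h3 := (a (n + 1)).toMultilinearMap.map_smul_univ (fun _ => χ)
      (fun i => ∑ k, l k (v i) • e k)
    have h4 := (a (n + 1)).toMultilinearMap.map_sum (fun i k => l k (v i) • e k)
    -- Pigeonhole: among n + 1 arguments taken from n generators two coincide.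
    have h5 : ∀ r : Fin (n + 1) → Fin n,
        (a (n + 1)).toMultilinearMap (fun i => l (r i) (v i) • e (r i)) = 0 := fun r => by
      obtain ⟨x, y, hxy, hr⟩ := Fintype.exists_ne_map_eq_of_card_lt r (by simp)
      have h6 : (a (n + 1)).toMultilinearMap (fun i => e (r i)) = 0 :=
        (a (n + 1)).map_eq_zero_of_eq _ (by simp only [hr]) hxy
      rw [(a (n + 1)).toMultilinearMap.map_smul_univ (fun i => l (r i) (v i)), h6, smul_zero]
    refine h1.trans ((congrArg (a (n + 1)) h2).trans (h3.trans ?_))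
    rw [h4, Finset.sum_eq_zero fun r _ => h5 r, smul_zero]
  | succ d ih =>
    have := ih (ins (v 0) a) (Fin.tail v)
    rwa [← succ_app a (n + 1 + d) v] at this

/-- The component of degree `m`. -/
def component (m : ℕ) (a : Forms R L E) : Forms R L E := fun n => if n = m then a n else 0

theorem component_deg (m : ℕ) (a : Forms R L E) : component m a ∈ deg (m : ℤ) := fun n hn =>
  if_neg fun h => hn (by rw [h])

/-- A form here is a family of components in all degrees. This makes it, locally, a finite sum of
homogeneous forms, to which additive maps can be applied term by term. -/
theorem exists_pow_smul_eq_sum_component {χ : R} {n : ℕ} {l : Fin n → L → R} {e : Fin n → L}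
    (h : ∀ m, χ • m = χ • ∑ i, l i m • e i) (a : Forms R L E) :
    χ ^ (n + 1) • a = χ ^ (n + 1) • ∑ m ∈ Finset.range (n + 1), component m a := by
  refine ext_app fun k v => ?_
  rw [smul_app, smul_app]
  have hs : (∑ m ∈ Finset.range (n + 1), component m a) k v
      = ∑ m ∈ Finset.range (n + 1), component m a k v :=
    map_sum (eval (R := R) (E := E) k v) (fun m => component m a) _
  rw [hs]
  have hc : ∀ m, component m a k v = if k = m then a k v else 0 := fun m => by
    unfold component
    split_ifs <;> rfl
  simp only [hc, Finset.sum_ite_eq, Finset.mem_range]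
  split_ifs with hk
  · rfl
  · obtain ⟨d, rfl⟩ := Nat.exists_eq_add_of_le (not_lt.1 hk)
    rw [smul_zero, pow_smul_app_eq_zero h]

theorem eq_const_of_deg_zero {a : Forms R L E} (h : a ∈ deg 0) : a = const (a 0 0) := by
  refine ext_app fun n v => ?_
  cases n with
  | zero => rw [const_zero_app, Subsingleton.elim v 0]
  | succ n => rw [const_succ_app, mem_deg.1 h (n + 1) v (by push_cast; omega)]

end Frame

end Forms

/-! ### Vector fields on F[1] are determined by functions and their differentials -/

section Functions

variable {K : Type v} {R : Type w} [Field K] [CommRing R] [Algebra K R] {F : Distribution K R}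

open Forms

theorem prF_coe (j : Splitting F) (X : Derivation K R R) :
    ((prF j X : F.sections) : Derivation K R R) = X - j.map (F.sections.mkQ X) := rfl

theorem prF_of_mem (j : Splitting F) (V : F.sections) : prF j V.1 = V := by
  refine Subtype.ext ?_
  rw [prF_coe, show F.sections.mkQ V.1 = 0 from (Submodule.Quotient.mk_eq_zero _).2 V.2, map_zero,
    sub_zero]

theorem prF_map (j : Splitting F) (z : F.Quot) : prF j (j.map z) = 0 := by
  refine Subtype.ext ?_
  rw [prF_coe, j.mkQ_map, sub_self]; rfl

/-- The action of a vector field on functions. -/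
def applyVect (X : (vect F).carrier) (a : Forms R F.sections R) : Forms R F.sections R := X.1 a

theorem vect_ext {X Y : (vect F).carrier} (h : ∀ a, applyVect X a = applyVect Y a) : X = Y :=
  Subtype.ext (LinearMap.ext h)

theorem applyVect_add_right (X : (vect F).carrier) (a b : Forms R F.sections R) :
    applyVect X (a + b) = applyVect X a + applyVect X b := X.1.map_add a b

theorem applyVect_zero_right (X : (vect F).carrier) : applyVect X 0 = 0 := X.1.map_zero

theorem applyVect_neg_right (X : (vect F).carrier) (a : Forms R F.sections R) :
    applyVect X (-a) = -applyVect X a := X.1.map_neg a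

theorem applyVect_zero (a : Forms R F.sections R) :
    applyVect (0 : (vect F).carrier) a = 0 := rfl

theorem applyVect_par (X : (vect F).carrier) (a : Forms R F.sections R) :
    applyVect ((vect F).par X) a = par (applyVect X (par a)) := rfl

theorem applyVect_d (X : (vect F).carrier) (a : Forms R F.sections R) :
    applyVect ((vect F).d X) a = ext (P := Conn.trivial F) (applyVect X a)
      - applyVect ((vect F).par X) (ext (P := Conn.trivial F) a) := rfl

/-- The defect of R-linearity of X at f is X(f). A field that kills functions therefore acts
R-linearly on forms and can be studied after multiplication by χ. -/
theorem applyVect_fun_smul (X : (vect F).carrier) (f : R) (a : Forms R F.sections R) :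
    applyVect X (f • a) = applyVect X (const f) * a + f • applyVect X a := by
  have h := X.2.1 (const f) a (par_const f)
  rw [← const_mul, ← const_mul]
  exact h

theorem applyVect_odd_mul (X : (vect F).carrier) {a : Forms R F.sections R} (ha : par a = -a)
    (b : Forms R F.sections R) :
    applyVect X (a * b) = applyVect X a * b + a * par (applyVect X (par b)) :=
  X.2.2 a b ha

/-- `∑ dxᵢ ∧ ι_{eᵢ}` is multiplication by the degree. -/
theorem euler_app {χ : R} {n : ℕ} {x : Fin n → R} {e : Fin n → F.sections}
    (h : ∀ V : F.sections, χ • V = χ • ∑ i, V.1 (x i) • e i) (m : ℕ) :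
    ∀ (a : Forms R F.sections R) (v : Fin m → F.sections),
      χ * ∑ i, (dfun (F := F) (x i) * ins (e i) a) m v = χ * (m * a m v) := by
  induction m with
  | zero =>
    intro a v
    have : ∀ i, (dfun (F := F) (x i) * ins (e i) a) 0 v = 0 := fun i => by
      refine (wedge_zero_app (E := R) (E' := R) (act R) _ _ _).trans ?_
      simp [dfun]
    simp [this]
  | succ m ih =>
    intro a v
    have h1 : ∀ i, (dfun (F := F) (x i) * ins (e i) a) (m + 1) v
        = (v 0).1 (x i) * ins (e i) a m (Fin.tail v)
          + (dfun (F := F) (x i) * ins (e i) (ins (v 0) a)) m (Fin.tail v) := fun i => by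
      rw [succ_app]
      have := ins_dfun_wedge (P := Conn.trivial F) (x i) (v 0) (ins (e i) a)
      refine (congrArg (fun b : Forms R F.sections R => b m (Fin.tail v)) this).trans ?_
      rw [ins_comm (v 0) (e i), wedge_neg_right, sub_neg_eq_add]
      rfl
    -- The frame expansion of `v 0` is inserted into the linear map V ↦ (ι_V a)(v₁, …).
    have h2 : χ * ∑ i, (v 0).1 (x i) * ins (e i) a m (Fin.tail v)
        = χ * ins (v 0) a m (Fin.tail v) := by
      let T : F.sections →ₗ[R] R :=
        { toFun := fun V => ins V a m (Fin.tail v)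
          map_add' := fun V W => by rw [ins_add_left]; rfl
          map_smul' := fun f V => by rw [ins_smul_left]; rfl }
      have := congrArg T (h (v 0))
      simp only [map_smul, map_sum, smul_eq_mul] at this
      exact this.symm
    simp only [h1, Finset.sum_add_distrib, mul_add, h2, ih, succ_app a m v]
    push_cast
    ring

/-- In positive degree the Euler identity can be divided by the degree, which is where
characteristic zero enters. So a form of degree m + 1 is locally a combination of dxᵢ ∧ bᵢ with bᵢ
of degree m. -/
theorem euler [CharZero K] {χ : R} {n : ℕ} {x : Fin n → R} {e : Fin n → F.sections}
    (h : ∀ V : F.sections, χ • V = χ • ∑ i, V.1 (x i) • e i) {m : ℕ}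
    {a : Forms R F.sections R} (ha : a ∈ deg ((m + 1 : ℕ) : ℤ)) :
    χ • a = (algebraMap K R (m + 1 : K)⁻¹ * χ) • ∑ i, dfun (F := F) (x i) * ins (e i) a := by
  refine ext_app fun k v => ?_
  have hs : (∑ i, dfun (F := F) (x i) * ins (e i) a) k v = ∑ i, (dfun (F := F) (x i) * ins (e i) a) k v :=
    map_sum (eval (R := R) (E := R) k v) (fun i => dfun (F := F) (x i) * ins (e i) a) _
  rw [smul_app, smul_app, hs, mul_smul, smul_eq_mul, smul_eq_mul, smul_eq_mul, euler_app h]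
  by_cases hk : k = m + 1
  · subst hk
    have : algebraMap K R (m + 1 : K)⁻¹ * ((m + 1 : ℕ) : R) = 1 := by
      rw [← map_natCast (algebraMap K R), ← map_mul,
        Nat.cast_succ, inv_mul_cancel₀ (Nat.cast_add_one_ne_zero m), map_one]
    linear_combination (-χ * a (m + 1) v) * this
  · rw [mem_deg.1 ha k v (by exact_mod_cast hk)]
    simp

/-- Applying pr_F to the frame vectors does not affect the coefficients V(xᵢ). That they are
derivatives of functions is what lets the Euler identity involve only the differentials dxᵢ. -/
theorem exists_frame_sections (j : Splitting F) {χ : R} (hχ : IsChartFn K χ) :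
    ∃ (n : ℕ) (x : Fin n → R) (e : Fin n → F.sections), ∀ V : F.sections,
      χ • V = χ • ∑ i, V.1 (x i) • e i := by
  obtain ⟨n, x, e, h⟩ := hχ
  refine ⟨n, x, fun i => prF j (e i), fun V => ?_⟩
  have := congrArg (prF j) (h V.1)
  simpa only [map_smul, map_sum, prF_of_mem] using this

/-- A vector field on `F[1]` that annihilates functions and their differentials vanishes. -/
theorem vect_eq_zero [CharZero K] (hsep : Separated R K R) (j : Splitting F)
    (X : (vect F).carrier) (h0 : ∀ f : R, applyVect X (const f) = 0)
    (h1 : ∀ f : R, applyVect X (dfun f) = 0) : X = 0 := by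
  refine vect_ext fun a => ?_
  -- Since X kills functions it is R-linear, so it suffices to show that its values vanish locally.
  let T : Forms R F.sections R →ₗ[R] Forms R F.sections R :=
    { toFun := applyVect X
      map_add' := applyVect_add_right X
      map_smul' := fun f b => by rw [applyVect_fun_smul, h0, zero_mul, zero_add]; rfl }
  show T a = 0
  refine hsep.forms _ fun χ hχ => ?_
  obtain ⟨n, x, e, h⟩ := exists_frame_sections j hχ
  have hdeg : ∀ (m : ℕ) (b : Forms R F.sections R), b ∈ deg (m : ℤ) →
      T b ∈ tors χ (Forms R F.sections R) := by
    intro m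
    induction m with
    | zero =>
      intro b hb
      rw [eq_const_of_deg_zero hb, show T (const (b 0 0)) = 0 from h0 _]
      exact zero_mem _
    | succ m ih =>
      intro b hb
      -- One factor χ pays for the Euler identity. The Leibniz rule and X(dxᵢ) = 0 then leave X
      -- applied to a form of lower degree.
      refine mem_tors_of_pow_smul 1 ?_
      rw [pow_one, ← map_smul, euler h hb, map_smul, map_sum]
      refine Submodule.smul_mem _ _ (Submodule.sum_mem _ fun i _ => ?_)
      have hmul : T (dfun (F := F) (x i) * ins (e i) b)
          = dfun (F := F) (x i) * par (T (par (ins (e i) b))) := by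
        refine (applyVect_odd_mul X (par_dfun (x i)) (ins (e i) b)).trans ?_
        rw [h1, zero_mul, zero_add]
        rfl
      rw [hmul]
      obtain ⟨k, hk⟩ := ih (par (ins (e i) b)) (par_deg (by
        have := ins_deg (e i) hb
        push_cast at this
        rwa [add_sub_cancel_right] at this))
      refine ⟨k, ?_⟩
      have : χ ^ k • (dfun (F := F) (x i) * par (T (par (ins (e i) b))))
          = dfun (F := F) (x i) * (χ ^ k • par (T (par (ins (e i) b)))) :=
        (wedge_smul_right (E := R) (E' := R) (act R) _ _ _).symm
      rw [this, ← par_smul, hk, map_zero, mul_zero]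
  -- The factor χ^(n+1) removes the components of degree larger than the number n of generators.
  refine mem_tors_of_pow_smul (n + 1) ?_
  rw [← map_smul, exists_pow_smul_eq_sum_component h, map_smul, map_sum]
  exact Submodule.smul_mem _ _ (Submodule.sum_mem _ fun m _ => hdeg m _ (component_deg m a))

end Functions

end FoliationDG
end

noncomputable section
namespace FoliationDG
universe u v w

section Functions

variable {K : Type v} {R : Type w} [Field K] [CommRing R] [Algebra K R] {F : Distribution K R}
variable {Q : Type w} [AddCommGroup Q] [Module R Q]

open Forms

theorem mem_vect_deg {X : (vect F).carrier} {k : ℤ}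
    (h : ∀ l a, a ∈ deg l → applyVect X a ∈ deg (l + k))
    (h0 : Even k → (vect F).par X = X) (h1 : Odd k → (vect F).par X = -X) : X ∈ (vect F).deg k :=
  ⟨h, fun hk => congrArg Subtype.val (h0 hk), fun hk => congrArg Subtype.val (h1 hk)⟩

/-! ### Vector fields from derivations with values in a dual bundle -/

theorem ext_dual {L : Type*} [AddCommGroup L] [Module R L] {P S : Type*} [AddCommGroup P]
    [Module R P] [AddCommGroup S] [Module R S] {a b : Forms R L (P →ₗ[R] S)}
    (h : ∀ z : P, map (LinearMap.applyₗ z) a = map (LinearMap.applyₗ z) b) : a = b :=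
  ext_app fun n v => LinearMap.ext fun z =>
    congrArg (fun c : Forms R L S => c n v) (h z)

/-- A derivation of parity `s = ±1` of the algebra of forms with values in `Ω_F(Q^∨)`. -/
structure IsFormDerivation (s : ℤ)
    (G : Forms R F.sections R →+ Forms R F.sections (Module.Dual R Q)) : Prop where
  even_mul : ∀ a b, par a = a →
    G (a * b) = wedge (act (Module.Dual R Q)).flip (G a) b + a • G b
  odd_mul : ∀ a b, par a = -a →
    G (a * b) = wedge (act (Module.Dual R Q)).flip (G a) b + s • a • G b
  par_apply : ∀ a, par (G a) = s • G (par a)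
  map_algebraMap_smul : ∀ (c : K) a, G (algebraMap K R c • a) = algebraMap K R c • G a

theorem wedge_zsmul_right {L : Type*} [AddCommGroup L] [Module R L] {E E' E'' : Type*}
    [AddCommGroup E] [Module R E] [AddCommGroup E'] [Module R E'] [AddCommGroup E''] [Module R E'']
    (B : E →ₗ[R] E' →ₗ[R] E'') (s : ℤ) (a : Forms R L E) (b : Forms R L E') :
    wedge B a (s • b) = s • wedge B a b :=
  map_zsmul (AddMonoidHom.mk' (wedge B a) (wedge_add_right B a)) s b

theorem wedge_zsmul_left {L : Type*} [AddCommGroup L] [Module R L] {E E' E'' : Type*}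
    [AddCommGroup E] [Module R E] [AddCommGroup E'] [Module R E'] [AddCommGroup E''] [Module R E'']
    (B : E →ₗ[R] E' →ₗ[R] E'') (s : ℤ) (a : Forms R L E) (b : Forms R L E') :
    wedge B (s • a) b = s • wedge B a b :=
  map_zsmul (AddMonoidHom.mk' (fun a => wedge B a b) (fun a a' => wedge_add_left B a a' b)) s a

/-- The vector field `a ↦ z ∧ G(a)`. -/
def vectOf {s : ℤ} {G : Forms R F.sections R →+ Forms R F.sections (Module.Dual R Q)}
    (hG : IsFormDerivation s G) :
    Forms R F.sections Q →+ (vect F).carrier where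
  toFun z := ⟨{ toFun := fun a => wedge (Module.Dual.eval R Q) z (G a)
                map_add' := fun a b => by
                  refine (congrArg _ (G.map_add a b)).trans (wedge_add_right _ _ _ _)
                map_smul' := fun c a => by
                  refine (congrArg (fun b => wedge _ z (G b)) (algebra_smul c _)).trans ?_
                  refine (congrArg _ (hG.map_algebraMap_smul c a)).trans ?_
                  refine (wedge_smul_right _ _ _ _).trans ?_
                  exact (algebra_smul c _).symm },
    by
      intro (a : Forms R F.sections R) (b : Forms R F.sections R) ha
      refine (congrArg (wedge (Module.Dual.eval R Q) z) (hG.even_mul a b ha)).trans ?_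
      refine (wedge_add_right _ _ _ _).trans ?_
      refine congrArg₂ (· + ·) ?_ ?_
      · exact (wedge_assoc (act R) (Module.Dual.eval R Q) (Module.Dual.eval R Q) (act _).flip
          (fun x y z => by simp [mul_comm]) z (G a) b).symm
      · exact wedge_smul_even _ ha _ _,
    by
      intro (a : Forms R F.sections R) (b : Forms R F.sections R) ha
      refine (congrArg (wedge (Module.Dual.eval R Q) z) (hG.odd_mul a b ha)).trans ?_
      refine (wedge_add_right _ _ _ _).trans ?_
      refine congrArg₂ (· + ·) ?_ ?_
      · exact (wedge_assoc (act R) (Module.Dual.eval R Q) (Module.Dual.eval R Q) (act _).flip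
          (fun x y z => by simp [mul_comm]) z (G a) b).symm
      · refine (wedge_zsmul_right _ _ _ _).trans ?_
        refine (congrArg (s • ·) (wedge_smul_odd _ ha _ _)).trans ?_
        -- Conjugation by the parity turns the field of z into s times the field of `par z`; moving
        -- the odd form `a` past z produces the same `par z`, and s comes from G.
        have h : par (wedge (Module.Dual.eval R Q) z (G (par b)))
            = s • wedge (Module.Dual.eval R Q) (par z) (G b) := by
          rw [par_wedge, hG.par_apply, par_par, wedge_zsmul_right]
        refine Eq.trans ?_ (congrArg (fun c : Forms R F.sections R => wedge (act R) a c) h.symm)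
        exact (wedge_zsmul_right (E := R) (E' := R) (act R) _ _ _).symm⟩
  map_zero' := vect_ext fun a => wedge_zero_left _ _
  map_add' z z' := vect_ext fun a => wedge_add_left _ _ _ _

section VectOf

variable {s : ℤ} {G : Forms R F.sections R →+ Forms R F.sections (Module.Dual R Q)}
    (hG : IsFormDerivation s G)

theorem applyVect_vectOf (z : Forms R F.sections Q) (a : Forms R F.sections R) :
    applyVect (vectOf hG z) a = wedge (Module.Dual.eval R Q) z (G a) := rfl

theorem vectOf_smul (c : Forms R F.sections R) (z : Forms R F.sections Q) :
    vectOf hG (c • z) = (show (functions F).carrier from c) • vectOf hG z :=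
  vect_ext fun a => smul_wedge _ c z (G a)

theorem par_vectOf (z : Forms R F.sections Q) :
    (vect F).par (vectOf hG z) = s • vectOf hG (par z) :=
  vect_ext fun a => by
    rw [applyVect_par, applyVect_vectOf, par_wedge, hG.par_apply, par_par, wedge_zsmul_right,
      ← map_zsmul, applyVect_vectOf, wedge_zsmul_left]

/-- The hypothesis `hs` says s = (-1)^δ. The parity requirement in the grading of vector fields then
amounts to (-1)^δ (-1)^k = (-1)^(k+δ). -/
theorem vectOf_deg {δ : ℤ} (hs : (Even δ → s = 1) ∧ (Odd δ → s = -1))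
    (hδ : ∀ l a, a ∈ deg l → G a ∈ deg (l + δ)) {k : ℤ} {z : Forms R F.sections Q}
    (hz : z ∈ deg k) : vectOf hG z ∈ (vect F).deg (k + δ) := by
  have hpar := par_vectOf hG z
  have heven : Even δ → (vect F).par (vectOf hG z) = vectOf hG (par z) := fun h => by
    rw [hpar]; exact (congrArg (· • _) (hs.1 h)).trans (one_smul _ _)
  have hodd : Odd δ → (vect F).par (vectOf hG z) = -vectOf hG (par z) := fun h => by
    rw [hpar]; exact (congrArg (· • _) (hs.2 h)).trans ((neg_smul _ _).trans (by rw [one_smul]))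
  refine mem_vect_deg (fun l a ha => ?_) (fun hk => ?_) (fun hk => ?_)
  · have := wedge_deg (Module.Dual.eval R Q) hz (hδ l a ha)
    rwa [show k + (l + δ) = l + (k + δ) by ring] at this
  · rcases Int.even_or_odd k with h1 | h1 <;> rcases Int.even_or_odd δ with h2 | h2
    · rw [heven h2, par_of_even k z hz h1]
    · exact absurd hk (Int.not_even_iff_odd.2 (h1.add_odd h2))
    · exact absurd hk (Int.not_even_iff_odd.2 (h1.add_even h2))
    · rw [hodd h2, par_of_odd k z hz h1, map_neg, neg_neg]
  · rcases Int.even_or_odd k with h1 | h1 <;> rcases Int.even_or_odd δ with h2 | h2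
    · exact absurd hk (Int.not_odd_iff_even.2 (h1.add h2))
    · rw [hodd h2, par_of_even k z hz h1]
    · rw [heven h2, par_of_odd k z hz h1, map_neg]
    · exact absurd hk (Int.not_odd_iff_even.2 (h1.add_odd h2))

end VectOf

/-! ### Interior products -/

/-- `a ↦ (V ↦ ι_V a)`. -/
def flatHom : Forms R F.sections R →+ Forms R F.sections (Module.Dual R F.sections) where
  toFun := flat
  map_zero' := rfl
  map_add' _ _ := rfl

theorem map_flat (V : F.sections) (a : Forms R F.sections R) :
    map (LinearMap.applyₗ V) (flatHom a) = ins V a := rfl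

theorem map_apply_wedge_flip {P : Type*} [AddCommGroup P] [Module R P] (z : P)
    (a : Forms R F.sections (Module.Dual R P)) (b : Forms R F.sections R) :
    map (LinearMap.applyₗ z) (wedge (act (Module.Dual R P)).flip a b)
      = map (LinearMap.applyₗ z) a * b :=
  map_wedge (act (Module.Dual R P)).flip (act R) (LinearMap.applyₗ z) (LinearMap.applyₗ z)
    LinearMap.id (fun x y => by simp [mul_comm]) a b

theorem map_apply_smul {P : Type*} [AddCommGroup P] [Module R P] (z : P)
    (a : Forms R F.sections R) (b : Forms R F.sections (Module.Dual R P)) :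
    map (LinearMap.applyₗ z) (a • b) = a * map (LinearMap.applyₗ z) b :=
  map_form_smul (LinearMap.applyₗ z : (P →ₗ[R] R) →ₗ[R] R) a b

theorem ins_mul (x : F.sections) (a b : Forms R F.sections R) :
    ins x (a * b) = ins x a * b + par a * ins x b :=
  ins_wedge (E := R) (E' := R) (act R) x a b

/-- After evaluation at V these are the rules for ι_V, which is odd; whence the sign -1. For
`splitLie` the evaluation at z is an even derivation, with sign 1. -/
theorem isFormDerivation_flat : IsFormDerivation (-1) (flatHom (F := F)) where
  even_mul a b ha := ext_dual fun V => by
    rw [map_add, map_apply_wedge_flip, map_apply_smul, map_flat, map_flat, map_flat, ins_mul, ha]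
  odd_mul a b ha := ext_dual fun V => by
    rw [map_add, map_zsmul, map_apply_wedge_flip, map_apply_smul, map_flat, map_flat, map_flat,
      ins_mul, ha, neg_smul, one_smul, neg_mul]
  par_apply a := ext_dual fun V => by
    rw [← par_map, map_zsmul, map_flat, map_flat, ins_par, smul_neg, neg_smul, neg_neg, one_smul]
  map_algebraMap_smul c a := rfl

/-! ### Lie derivatives along a vector field that acts on the distribution -/

/-- A derivation `X` of `R` together with a compatible derivation of the module of sections. -/
structure SectionDerivation (F : Distribution K R) where
  /-- the action on functions -/
  base : Derivation K R R
  /-- the action on sections -/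
  act : F.sections →+ F.sections
  act_smul : ∀ (f : R) V, act (f • V) = base f • V + f • act V

namespace SectionDerivation

variable (X : SectionDerivation F)

/-- Values of the Lie derivative along `X`. -/
def lieAux : ∀ n : ℕ, Forms R F.sections R → (Fin n → F.sections) → R
  | 0, a, v => X.base (a 0 v)
  | n + 1, a, v => lieAux n (ins (v 0) a) (Fin.tail v) - ins (X.act (v 0)) a n (Fin.tail v)

theorem lieAux_add (n : ℕ) : ∀ (a b : Forms R F.sections R) (v),
    X.lieAux n (a + b) v = X.lieAux n a v + X.lieAux n b v := by
  induction n with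
  | zero => intro a b v; simp [lieAux, add_app]
  | succ n ih => intro a b v; simp only [lieAux, map_add, ih, add_app]; abel

theorem lieAux_smul (n : ℕ) : ∀ (f : R) (a : Forms R F.sections R) (v),
    X.lieAux n (f • a) v = X.base f • a n v + f • X.lieAux n a v := by
  induction n with
  | zero => intro f a v; simp [lieAux, smul_app]; ring
  | succ n ih =>
    intro f a v
    simp only [lieAux, map_smul, ih, smul_app, smul_sub, succ_app a]; abel

theorem lieAux_zero (n : ℕ) (v) : X.lieAux n 0 v = 0 := by
  have := X.lieAux_add n 0 0 v
  simpa using this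

theorem lieAux_exists (n : ℕ) : ∀ a : Forms R F.sections R,
    ∃ b : F.sections [⋀^Fin n]→ₗ[R] R, ∀ v, b v = X.lieAux n a v := by
  induction n with
  | zero =>
    intro a
    refine ⟨AlternatingMap.constOfIsEmpty R F.sections (Fin 0) (X.base (a 0 0)), fun v => ?_⟩
    rw [Subsingleton.elim v 0]; rfl
  | succ n ih =>
    intro a
    choose W hW using ih
    refine exists_alternating _ (fun y => W (ins y a) - ins (X.act y) a n) ?_ ?_ ?_ ?_
    · intro v; simp [lieAux, hW]
    · intro y z w
      simp only [AlternatingMap.sub_apply, hW, ins_add_left, lieAux_add, map_add, add_app]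
      abel
    · intro f y w
      simp only [AlternatingMap.sub_apply, hW, ins_smul_left, lieAux_smul, X.act_smul,
        ins_add_left, add_app, smul_app, smul_sub]
      abel
    · intro y w i hi hw
      simp only [AlternatingMap.sub_apply, hW]
      cases n with
      | zero => exact i.elim0
      | succ n =>
        have : w 0 = y := by rw [← hw]; congr 1; exact Fin.ext hi.symm
        simp only [lieAux, this, ins_self, lieAux_zero, succ_app _ n w]
        rw [ins_comm y (X.act y), neg_app]
        abel

/-- The Lie derivative along `X`. -/
def lie : Forms R F.sections R →+ Forms R F.sections R where
  toFun a := fun n => ofFun (X.lieAux n a) (X.lieAux_exists n a)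
  map_zero' := ext_app fun n v => X.lieAux_zero n v
  map_add' a b := ext_app fun n v => X.lieAux_add n a b v

theorem ins_lie (y : F.sections) (a : Forms R F.sections R) :
    ins y (X.lie a) = X.lie (ins y a) - ins (X.act y) a :=
  ext_app fun n v => by
    rw [ins_app, sub_app]; rfl

theorem lie_zero_app (a : Forms R F.sections R) (v) : X.lie a 0 v = X.base (a 0 v) := rfl

theorem lie_smul (f : R) (a : Forms R F.sections R) :
    X.lie (f • a) = X.base f • a + f • X.lie a := ext_app fun n v => X.lieAux_smul n f a v

theorem lie_const (f : R) : X.lie (const f) = const (X.base f) := by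
  refine eq_of_ins (fun v => rfl) fun x => ?_
  rw [ins_lie, ins_const, ins_const, ins_const, map_zero, sub_zero]

theorem lie_par (a : Forms R F.sections R) : X.lie (par a) = par (X.lie a) := by
  refine ext_app fun n => ?_
  induction n generalizing a with
  | zero => intro v; simp [par_app, lie_zero_app]
  | succ n ih =>
    intro v
    rw [succ_app, succ_app, ins_lie, ins_par, ins_par, ins_par, ins_lie, map_neg, map_sub,
      sub_app, neg_app, neg_app, neg_app, ih, sub_app]
    abel

theorem lie_mul (a b : Forms R F.sections R) : X.lie (a * b) = X.lie a * b + a * X.lie b := by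
  refine ext_app fun n => ?_
  induction n generalizing a b with
  | zero =>
    intro v
    have h : ∀ c d : Forms R F.sections R, (c * d) 0 v = c 0 v * d 0 v := fun c d =>
      wedge_zero_app (E := R) (E' := R) (Forms.act R) c d v
    rw [lie_zero_app, h, add_app, h, h, X.base.leibniz]
    simp only [smul_eq_mul, lie_zero_app]
    ring
  | succ n ih =>
    intro v
    rw [succ_app, succ_app, ins_lie, ins_mul, map_add, map_add, ins_mul, ins_mul, ins_mul,
      ins_lie, ins_lie]
    simp only [add_app, sub_app, ih, lie_par, sub_mul, mul_sub]
    abel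

theorem lie_deg {k : ℤ} {a : Forms R F.sections R} (ha : a ∈ deg k) : X.lie a ∈ deg k := by
  refine mem_deg.2 fun n => ?_
  induction n generalizing k a with
  | zero => intro v hn; rw [lie_zero_app, mem_deg.1 ha 0 v hn, map_zero]
  | succ n ih =>
    intro v hn
    push_cast at hn
    rw [succ_app, ins_lie, sub_app, ih (ins_deg _ ha) _ (by omega),
      mem_deg.1 (ins_deg _ ha) n _ (by omega), sub_zero]

/-- The Lie derivative depends additively on the vector field. -/
theorem lie_eq_add {X Y Z : SectionDerivation F} (h : ∀ f, Z.base f = X.base f + Y.base f)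
    (h' : ∀ V, Z.act V = X.act V + Y.act V) (a : Forms R F.sections R) :
    Z.lie a = X.lie a + Y.lie a := by
  refine ext_app fun n => ?_
  induction n generalizing a with
  | zero => intro v; exact h _
  | succ n ih =>
    intro v
    simp only [succ_app, map_add, ins_lie, add_app, sub_app, ih, h', ins_add_left]
    abel

theorem lie_eq_smul {X Z : SectionDerivation F} (c : R) (h : ∀ f, Z.base f = c * X.base f)
    (h' : ∀ V, Z.act V = c • X.act V) (a : Forms R F.sections R) :
    Z.lie a = c • X.lie a := by
  refine ext_app fun n => ?_
  induction n generalizing a with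
  | zero => intro v; exact h _
  | succ n ih =>
    intro v
    simp only [succ_app, map_smul, ins_lie, smul_app, sub_app, ih, h', ins_smul_left, smul_sub]

end SectionDerivation

/-! ### The derivations `j(Z)` and the map `ψ` -/

/-- `j(z)` with its action `V ↦ pr_F [j(z), V]` on sections of `F`. -/
def splitDerivation (j : Splitting F) (z : F.Quot) : SectionDerivation F where
  base := j.map z
  act :=
    { toFun := fun V => prF j ⁅j.map z, V.1⁆
      map_zero' := by
        rw [ZeroMemClass.coe_zero, _root_.lie_zero, map_zero]
      map_add' := fun V W => by
        rw [Submodule.coe_add, _root_.lie_add, map_add] }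
  act_smul f V := by
    have : ⁅j.map z, (f • V).1⁆ = j.map z f • V.1 + f • ⁅j.map z, V.1⁆ := by
      refine Derivation.ext fun g => ?_
      simp [Derivation.commutator_apply]
      ring
    show prF j ⁅j.map z, (f • V).1⁆ = _
    rw [this, map_add, map_smul, map_smul, prF_of_mem]
    rfl

theorem splitDerivation_base (j : Splitting F) (z : F.Quot) :
    (splitDerivation j z).base = j.map z := rfl

theorem splitDerivation_act (j : Splitting F) (z : F.Quot) (V : F.sections) :
    (splitDerivation j z).act V = prF j ⁅j.map z, V.1⁆ := rfl

theorem lie_split_add (j : Splitting F) (z z' : F.Quot) (a : Forms R F.sections R) :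
    (splitDerivation j (z + z')).lie a
      = (splitDerivation j z).lie a + (splitDerivation j z').lie a :=
  SectionDerivation.lie_eq_add
    (fun f => by simp only [splitDerivation_base, map_add]; rfl)
    (fun V => by simp only [splitDerivation_act, map_add, add_lie]) a

/-- This explains the projection in the formula for ψ_j: [c j(z), V] differs from c [j(z), V] by a
multiple of j(z), and pr_F annihilates that multiple. Hence z ↦ L_{j(z)} is tensorial and extends to
forms with values in B. -/
theorem lie_split_smul (j : Splitting F) (c : R) (z : F.Quot) (a : Forms R F.sections R) :
    (splitDerivation j (c • z)).lie a = c • (splitDerivation j z).lie a :=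
  SectionDerivation.lie_eq_smul c
    (fun f => by simp only [splitDerivation_base, map_smul]; rfl)
    (fun V => by
      have : ⁅c • j.map z, V.1⁆ = c • ⁅j.map z, V.1⁆ - V.1 c • j.map z := by
        refine Derivation.ext fun g => ?_
        simp [Derivation.commutator_apply]
        ring
      rw [splitDerivation_act, splitDerivation_act, map_smul, this, map_sub, map_smul, map_smul,
        prF_map, smul_zero, sub_zero]) a

/-- `a ↦ (z ↦ L_{j(z)} a)`. -/
def splitLie (j : Splitting F) :
    Forms R F.sections R →+ Forms R F.sections (Module.Dual R F.Quot) where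
  toFun a := fun n =>
    { toFun := fun v =>
        { toFun := fun z => (splitDerivation j z).lie a n v
          map_add' := fun z z' => by rw [lie_split_add]; rfl
          map_smul' := fun c z => by rw [lie_split_smul]; rfl }
      map_update_add' := fun v i x y => LinearMap.ext fun z =>
        ((splitDerivation j z).lie a n).map_update_add v i x y
      map_update_smul' := fun v i c x => LinearMap.ext fun z =>
        ((splitDerivation j z).lie a n).map_update_smul v i c x
      map_eq_zero_of_eq' := fun v i j' hv hij => LinearMap.ext fun z =>
        ((splitDerivation j z).lie a n).map_eq_zero_of_eq v hv hij }
  map_zero' := ext_dual fun z => (splitDerivation j z).lie.map_zero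
  map_add' a b := ext_dual fun z => (splitDerivation j z).lie.map_add a b

theorem map_splitLie (j : Splitting F) (z : F.Quot) (a : Forms R F.sections R) :
    map (LinearMap.applyₗ z) (splitLie j a) = (splitDerivation j z).lie a := rfl

theorem isFormDerivation_splitLie (j : Splitting F) : IsFormDerivation 1 (splitLie j) where
  even_mul a b _ := ext_dual fun z => by
    rw [map_add, map_apply_wedge_flip, map_apply_smul, map_splitLie, map_splitLie, map_splitLie,
      SectionDerivation.lie_mul]
  odd_mul a b _ := ext_dual fun z => by
    rw [one_smul, map_add, map_apply_wedge_flip, map_apply_smul, map_splitLie, map_splitLie,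
      map_splitLie, SectionDerivation.lie_mul]
  par_apply a := ext_dual fun z => by
    rw [← par_map, one_smul, map_splitLie, map_splitLie, SectionDerivation.lie_par]
  map_algebraMap_smul c a := ext_dual fun z => by
    rw [map_splitLie, SectionDerivation.lie_smul, Derivation.map_algebraMap, zero_smul, zero_add]
    rfl

/-- The map `ψ_j`. -/
def psi (j : Splitting F) : (complex (Conn.bott F)).carrier →+ (vect F).carrier :=
  vectOf (isFormDerivation_splitLie j)

theorem applyVect_psi (j : Splitting F) (z : Forms R F.sections F.Quot)
    (a : Forms R F.sections R) :
    applyVect (psi j z) a = wedge (Module.Dual.eval R F.Quot) z (splitLie j a) := rfl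

/-- The value of a derivation at a function. -/
def evalAt (K : Type*) {R : Type*} [CommRing K] [CommRing R] [Algebra K R] (f : R) :
    Derivation K R R →ₗ[R] R where
  toFun X := X f
  map_add' _ _ := rfl
  map_smul' _ _ := rfl

theorem ext_derivation {L : Type*} [AddCommGroup L] [Module R L]
    {a b : Forms R L (Derivation K R R)}
    (h : ∀ f : R, map (evalAt K f) a = map (evalAt K f) b) : a = b :=
  ext_app fun n v => Derivation.ext fun f => congrArg (fun c : Forms R L R => c n v) (h f)

theorem map_pushforward (f : R) (X : (vect F).carrier) :
    map (evalAt K f) (pushforward X) = applyVect X (const f) := rfl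

theorem pushforward_add (X Y : (vect F).carrier) :
    pushforward (X + Y) = pushforward X + pushforward Y := ext_derivation fun _ => rfl

theorem pushforward_zero : pushforward (0 : (vect F).carrier) = 0 := ext_derivation fun _ => rfl

theorem pushforward_smul (c : Forms R F.sections R) (X : (vect F).carrier) :
    pushforward ((show (functions F).carrier from c) • X) = c • pushforward X :=
  ext_derivation fun f => (map_form_smul (evalAt K f) c (pushforward X)).symm

theorem pushforward_par (X : (vect F).carrier) :
    pushforward ((vect F).par X) = par (pushforward X) :=
  ext_derivation fun f => by
    rw [map_pushforward, applyVect_par, par_const, ← par_map, map_pushforward]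

/-- The map `h_j`. -/
def homotopyMap (j : Splitting F) : (vect F).carrier →+ (vect F).carrier where
  toFun X := vectOf isFormDerivation_flat (map (prF j) (pushforward ((vect F).par X)))
  map_zero' := by
    rw [map_zero, pushforward_zero, map_zero, map_zero]
  map_add' X Y := by
    rw [map_add, pushforward_add, map_add, map_add]

theorem applyVect_homotopyMap (j : Splitting F) (X : (vect F).carrier)
    (a : Forms R F.sections R) :
    applyVect (homotopyMap j X) a = wedge (Module.Dual.eval R F.sections)
      (map (prF j) (pushforward ((vect F).par X))) (flatHom a) := rfl

theorem isHomotopy_homotopyMap (j : Splitting F) : IsHomotopy j (homotopyMap j) :=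
  fun _ _ => rfl

theorem applyVect_psi_const (j : Splitting F) (z : F.Quot) (a : Forms R F.sections R) :
    applyVect (psi j (const z : Forms R F.sections F.Quot)) a = (splitDerivation j z).lie a := by
  rw [applyVect_psi, const_wedge_eq]
  rfl

theorem isPsi_psi (j : Splitting F) : IsPsi j (psi j) where
  smul a y := vectOf_smul _ a y
  apply_fun z f := (applyVect_psi_const j z (const f)).trans
    (SectionDerivation.lie_const _ f)
  apply_form z a ha := by
    have h := applyVect_psi_const j z a
    refine ⟨?_, fun V => ?_⟩
    · refine (congrArg (· ∈ deg 1) h).mpr ?_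
      exact SectionDerivation.lie_deg _ ha
    · refine (congrArg (fun b : Forms R F.sections R => b 1 fun _ => V) h).trans ?_
      rw [succ_app, SectionDerivation.ins_lie, sub_app, SectionDerivation.lie_zero_app,
        splitDerivation_act, splitDerivation_base, ← succ_app a 0 (fun _ => V)]
      congr 1
      exact congrArg (a 1) (funext fun i => Fin.cases rfl (fun k => k.elim0) i)

end Functions
end FoliationDG
end

noncomputable section
namespace FoliationDG
universe u v w

section Functions

variable {K : Type v} {R : Type w} [Field K] [CommRing R] [Algebra K R] {F : Distribution K R}

open Forms

/-! ### The contraction for vector fields -/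

theorem vect_d_d (X : (vect F).carrier) : (vect F).d ((vect F).d X) = 0 := vect_ext fun a => by
  have h : applyVect (-(vect F).d ((vect F).par X)) (ext (P := Conn.trivial F) a)
      = -applyVect ((vect F).d ((vect F).par X)) (ext (P := Conn.trivial F) a) := rfl
  rw [applyVect_d, (vect F).par_d, h, applyVect_d, applyVect_d, (vect F).par_par, map_sub,
    ext_ext Conn.isFlat_trivial, ext_ext Conn.isFlat_trivial, applyVect_zero_right,
    applyVect_zero]
  abel

/-- The push-forward of the Lie derivative records the values of X on exact 1-forms, which π_* X
alone does not see. -/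
theorem pushforward_d (f : R) (X : (vect F).carrier) :
    map (evalAt K f) (pushforward ((vect F).d X))
      = ext (P := Conn.trivial F) (applyVect X (const f)) - applyVect ((vect F).par X) (dfun f) := by
  rw [map_pushforward, applyVect_d, ext_const]

/-- A vector field is determined by the push-forwards of itself and of its Lie derivative. -/
theorem vect_eq_zero_of_pushforward [CharZero K] (hsep : Separated R K R) (j : Splitting F)
    {X : (vect F).carrier} (h0 : pushforward X = 0) (h1 : pushforward ((vect F).d X) = 0) :
    X = 0 := by
  have hc : ∀ f : R, applyVect X (const f) = 0 := fun f => by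
    rw [← map_pushforward, h0, map_zero]
  refine vect_eq_zero hsep j X hc fun f => ?_
  have := pushforward_d f X
  rw [h1, hc, map_zero, map_zero, zero_sub, applyVect_par, par_dfun, applyVect_neg_right,
    map_neg, neg_neg] at this
  rw [← par_par (applyVect X (dfun f)), ← this, map_zero]

theorem pushforward_sub (X Y : (vect F).carrier) :
    pushforward (X - Y) = pushforward X - pushforward Y := ext_derivation fun _ => rfl

theorem pushforward_deg {k : ℤ} {X : (vect F).carrier} (h : X ∈ (vect F).deg k) :
    pushforward X ∈ deg k := mem_deg.2 fun n v hn => Derivation.ext fun f => by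
  have h1 : applyVect X (const f) ∈ deg (0 + k) := h.1 0 _ (const_deg f)
  rw [zero_add] at h1
  exact mem_deg.1 h1 n v hn

theorem phi_eq (X : (vect F).carrier) : phi X = map F.sections.mkQ (pushforward X) := rfl

theorem phi_smul (a : (functions F).carrier) (X : (vect F).carrier) :
    phi (a • X) = a • phi X := by
  have h := map_form_smul F.sections.mkQ (show Forms R F.sections R from a) (pushforward X)
  rw [← pushforward_smul] at h
  exact h

theorem phi_par (X : (vect F).carrier) :
    phi ((vect F).par X) = (complex (Conn.bott F)).par (phi X) := by
  rw [phi_eq, phi_eq, pushforward_par]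
  exact (par_map _ _).symm

theorem psi_par (j : Splitting F) (z : (complex (Conn.bott F)).carrier) :
    psi j ((complex (Conn.bott F)).par z) = (vect F).par (psi j z) := by
  have := par_vectOf (isFormDerivation_splitLie j) z
  rw [one_smul] at this
  exact this.symm

theorem homotopyMap_eq (j : Splitting F) (X : (vect F).carrier) :
    homotopyMap j X
      = vectOf isFormDerivation_flat (map (prF j) (pushforward ((vect F).par X))) := rfl

/-- The sign reflects that interior products are odd. -/
theorem homotopyMap_par (j : Splitting F) (X : (vect F).carrier) :
    homotopyMap j ((vect F).par X) = -(vect F).par (homotopyMap j X) := by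
  rw [homotopyMap_eq, homotopyMap_eq, par_vectOf, par_map, ← pushforward_par, neg_smul, one_smul,
    neg_neg]

theorem homotopyMap_smul (j : Splitting F) (a : (functions F).carrier) (X : (vect F).carrier) :
    homotopyMap j (a • X) = (functions F).par a • homotopyMap j X := by
  rw [homotopyMap_eq, (vect F).par_smul]
  have h := pushforward_smul (show Forms R F.sections R from (functions F).par a)
    ((vect F).par X)
  refine (congrArg (fun b => vectOf isFormDerivation_flat (map (prF j) b)) h).trans ?_
  rw [map_form_smul]
  exact vectOf_smul isFormDerivation_flat _ _

theorem splitLie_const (j : Splitting F) (f : R) :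
    splitLie j (const f) = const (evalAt K f ∘ₗ j.map) := ext_dual fun z => by
  rw [map_splitLie, SectionDerivation.lie_const, Forms.map_const]; rfl

/-- Elements of the Chevalley-Eilenberg complex as forms. -/
def asForm {P : Conn F} : (complex P).carrier →+ Forms R F.sections P.carrier :=
  AddMonoidHom.id _

theorem pushforward_psi (j : Splitting F) (z : (complex (Conn.bott F)).carrier) :
    pushforward (psi j z) = map j.map (asForm z) := ext_derivation fun f => by
  refine (applyVect_psi j z (const f)).trans ?_
  rw [splitLie_const]
  exact wedge_const_eq _ _ _

/-- Interior products kill functions, so h takes vertical values. -/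
theorem pushforward_homotopyMap (j : Splitting F) (X : (vect F).carrier) :
    pushforward (homotopyMap j X) = 0 := ext_derivation fun f => by
  have : flatHom (F := F) (const f) = 0 := rfl
  rw [map_pushforward, applyVect_homotopyMap, this, wedge_zero_right, map_zero]

theorem phi_psi (j : Splitting F) (z : (complex (Conn.bott F)).carrier) :
    phi (psi j z) = z := by
  rw [phi_eq]
  refine (congrArg (map F.sections.mkQ) (pushforward_psi j z)).trans ?_
  exact ext_app fun n v => j.mkQ_map _

/-- Since h(X) depends only on pr_F π_* X, both hψ = 0 and h² = 0 reduce to the vanishing of this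
form: in one case by pr_F j = 0, in the other by verticality. -/
theorem homotopyMap_eq_zero (j : Splitting F) {X : (vect F).carrier}
    (h : map (prF j) (pushforward X) = 0) : homotopyMap j X = 0 := by
  rw [homotopyMap_eq, pushforward_par, ← par_map, h, map_zero, map_zero]

theorem homotopyMap_psi (j : Splitting F) (z : (complex (Conn.bott F)).carrier) :
    homotopyMap j (psi j z) = 0 := homotopyMap_eq_zero j (by
  rw [pushforward_psi]
  exact ext_app fun n v => prF_map j _)

theorem homotopyMap_homotopyMap (j : Splitting F) (X : (vect F).carrier) :
    homotopyMap j (homotopyMap j X) = 0 := homotopyMap_eq_zero j (by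
  rw [pushforward_homotopyMap, map_zero])

theorem phi_homotopyMap (j : Splitting F) (X : (vect F).carrier) :
    phi (homotopyMap j X) = 0 := by
  rw [phi_eq, pushforward_homotopyMap, map_zero]; rfl

theorem Forms.lie_const {P : Conn F} (x : F.sections) (e : P.carrier) :
    lie x (const e : Forms R F.sections P.carrier) = const (P.nabla x e) := by
  refine eq_of_ins (fun v => rfl) fun y => ?_
  rw [ins_lie, ins_const, ins_const, ins_const, lie_zero, sub_zero]

theorem bott_nabla (j : Splitting F) (V : F.sections) (z : F.Quot) :
    (Conn.bott F).nabla V z = F.sections.mkQ ⁅V.1, j.map z⁆ :=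
  congrArg ((Conn.bott F).nabla V) (j.mkQ_map z).symm

/-- The computation behind the cochain property of ψ_j. Evaluated at V and z it reads V(j(z)f) -
j(∇_V z)f = j(z)(Vf) - (pr_F[j(z),V])f, which is the decomposition of [V, j(z)] into its component
j(∇_V z) and its component in F. -/
theorem ext_const_split (j : Splitting F) (f : R) :
    ext (P := Conn.dual (Conn.bott F)) (const (evalAt K f ∘ₗ j.map)) = splitLie j (dfun f) := by
  refine ext_dual (S := R) (P := F.Quot) fun z => ?_
  rw [map_splitLie]
  refine eq_of_ins (fun v => ?_) fun V => ?_
  · rw [SectionDerivation.lie_zero_app]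
    exact (map_zero _).symm
  · have h0 : ins V (ext (P := Conn.dual (Conn.bott F)) (const (evalAt K f ∘ₗ j.map)))
        = const ((Conn.dual (Conn.bott F)).nabla V (evalAt K f ∘ₗ j.map)) := by
      rw [ins_ext, ins_const, map_zero, sub_zero, Forms.lie_const]
    refine (congrArg (map (LinearMap.applyₗ z)) h0).trans ?_
    rw [SectionDerivation.ins_lie, ins_dfun, ins_dfun, SectionDerivation.lie_const,
      splitDerivation_act, splitDerivation_base]
    refine (Forms.map_const (LinearMap.applyₗ z) _).trans ?_
    have h : V.1 (j.map z f) - j.map ((Conn.bott F).nabla V z) f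
        = j.map z (V.1 f) - (prF j ⁅j.map z, V.1⁆).1 f := by
      have h1 : (prF j ⁅j.map z, V.1⁆).1 f
          = -(⁅V.1, j.map z⁆ f - j.map (F.sections.mkQ ⁅V.1, j.map z⁆) f) := by
        rw [← lie_skew (j.map z) V.1, map_neg]
        rfl
      rw [bott_nabla j, h1, Derivation.commutator_apply]
      ring
    have h2 : (const (j.map z (V.1 f) - (prF j ⁅j.map z, V.1⁆).1 f) : Forms R F.sections R)
        = const (j.map z (V.1 f)) - const ((prF j ⁅j.map z, V.1⁆).1 f) := by
      rw [eq_sub_iff_add_eq, ← const_add, sub_add_cancel]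
    rw [← h2, ← h]
    rfl

/-- The Leibniz rule is applied to the pairing of z with the B^∨-valued function w ↦ j(w)f. By
`ext_const_split` the term where d falls on the latter is the value on df of the field of `par z`,
which the Lie derivative subtracts; the term with dz remains. -/
theorem pushforward_d_psi (j : Splitting F) (z : (complex (Conn.bott F)).carrier) :
    pushforward ((vect F).d (psi j z)) = map j.map (asForm ((complex (Conn.bott F)).d z)) :=
  ext_derivation fun f => by
    have h := ext_wedge (P := Conn.bott F) (Q := Conn.dual (Conn.bott F)) (S := Conn.trivial F)
      (Module.Dual.eval R F.Quot) (fun x e e' => by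
        show x.1 (e' e) = e' ((Conn.bott F).nabla x e) + (x.1 (e' e) - e' ((Conn.bott F).nabla x e))
        ring) z (const (evalAt K f ∘ₗ j.map))
    rw [pushforward_d, ← psi_par]
    have h1 := applyVect_psi j z (const f)
    have h2 := applyVect_psi j (par (asForm z)) (dfun f)
    rw [splitLie_const] at h1
    rw [← ext_const_split] at h2
    refine (congrArg₂ (· - ·) ((congrArg (ext (P := Conn.trivial F)) h1).trans h) h2).trans ?_
    refine (add_sub_cancel_right _ _).trans ?_
    exact wedge_const_eq _ _ _

/-- Both sides have push-forward j(dz). The push-forwards of their Lie derivatives vanish, by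
flatness of the Bott connection on one side and by L² = 0 on the other. -/
theorem psi_d [CharZero K] (hsep : Separated R K R) (j : Splitting F)
    (z : (complex (Conn.bott F)).carrier) :
    psi j ((complex (Conn.bott F)).d z) = (vect F).d (psi j z) := by
  refine sub_eq_zero.1 (vect_eq_zero_of_pushforward hsep j ?_ ?_)
  · rw [pushforward_sub, pushforward_d_psi, pushforward_psi, sub_self]
  · rw [map_sub, pushforward_sub, pushforward_d_psi, vect_d_d, pushforward_zero, sub_zero]
    exact (congrArg _ (ext_ext Conn.isFlat_bott z)).trans (map_zero _)

theorem flat_dfun (f : R) :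
    flatHom (F := F) (dfun f) = const (evalAt K f ∘ₗ F.sections.subtype) := ext_dual fun V => by
  rw [map_flat, ins_dfun, Forms.map_const]; rfl

/-- As h(X) is vertical, only its value on df contributes, and contracting df with pr_F π_* X gives
the derivative of f along pr_F π_* X. The sign of L, that of `homotopyMap_par` and that in the
definition of h cancel. -/
theorem pushforward_d_homotopyMap (j : Splitting F) (X : (vect F).carrier) :
    pushforward ((vect F).d (homotopyMap j X))
      = map (F.sections.subtype ∘ₗ prF j) (pushforward X) := ext_derivation fun f => by
  have h : (vect F).par (homotopyMap j X) = -homotopyMap j ((vect F).par X) := by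
    rw [homotopyMap_par, neg_neg]
  have h' : applyVect (-homotopyMap j ((vect F).par X)) (dfun f)
    = -applyVect (homotopyMap j ((vect F).par X)) (dfun f) := rfl
  rw [pushforward_d, ← map_pushforward, pushforward_homotopyMap, map_zero, map_zero, zero_sub, h,
    h', neg_neg, applyVect_homotopyMap, flat_dfun, wedge_const_eq, (vect F).par_par]
  rfl

/-- Vertical vector fields have vertical Lie derivative modulo `F`. -/
theorem phi_d_of_vertical (hsep : Separated R K R) (j : Splitting F) {Y : (vect F).carrier}
    (hY : pushforward Y = 0) : phi ((vect F).d Y) = 0 := by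
  have hc : ∀ f : R, applyVect Y (const f) = 0 := fun f => by
    rw [← map_pushforward, hY, map_zero]
  have hc' : ∀ f : R, applyVect ((vect F).par Y) (const f) = 0 := fun f => by
    rw [applyVect_par, par_const, hc, map_zero]
  -- A vertical field kills functions and hence is R-linear on forms.
  let T : Forms R F.sections R →ₗ[R] Forms R F.sections R :=
    { toFun := applyVect ((vect F).par Y)
      map_add' := applyVect_add_right _
      map_smul' := fun f b => by rw [applyVect_fun_smul, hc', zero_mul, zero_add]; rfl }
  have hT : ∀ f, map (evalAt K f) (pushforward ((vect F).d Y)) = -T (dfun f) := fun f => by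
    rw [pushforward_d, hc, map_zero, zero_sub]; rfl
  -- It suffices to work after applying j, since pr_B j = id. This converts the claim into one about
  -- 1-forms θ on M that annihilate F.
  have key : map j.map (phi ((vect F).d Y)) = 0 := ext_derivation fun f => by
    let θ : Derivation K R R →ₗ[R] R := evalAt K f ∘ₗ j.map ∘ₗ F.sections.mkQ
    show map θ (pushforward ((vect F).d Y)) = map (evalAt K f) 0
    rw [map_zero]
    refine hsep.forms _ ?_
    rintro χ ⟨n, x, e, h⟩
    refine mem_tors_of_pow_smul 1 ?_
    have hθ : ∀ X, χ * θ X = χ * ∑ i, θ (e i) * X (x i) := fun X => by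
      have := congrArg θ (h X)
      simp only [map_smul, map_sum, smul_eq_mul] at this
      rw [this]
      exact congrArg _ (Finset.sum_congr rfl fun i _ => mul_comm _ _)
    have h1 : χ • map θ (pushforward ((vect F).d Y))
        = χ • ∑ i, θ (e i) • map (evalAt K (x i)) (pushforward ((vect F).d Y)) := by
      refine ext_app fun m v => ?_
      have hs : (∑ i, θ (e i) • map (evalAt K (x i)) (pushforward ((vect F).d Y))) m v
          = ∑ i, θ (e i) * (pushforward ((vect F).d Y) m v) (x i) :=
        map_sum (eval (R := R) (E := R) m v)
          (fun i => θ (e i) • map (evalAt K (x i)) (pushforward ((vect F).d Y))) _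
      rw [smul_app, smul_app, hs]
      exact hθ _
    -- The sum ∑ θ(eᵢ) dxᵢ represents, up to χ, the restriction of θ to F, and θ factors through the
    -- quotient by F.
    have h2 : χ • ∑ i, θ (e i) • dfun (F := F) (x i) = 0 := by
      refine eq_of_ins (fun v => ?_) fun V => ?_
      · have hs : (∑ i, θ (e i) • dfun (F := F) (x i)) 0 v
            = ∑ i, θ (e i) * dfun (F := F) (x i) 0 v :=
          map_sum (eval (R := R) (E := R) 0 v) (fun i => θ (e i) • dfun (F := F) (x i)) _
        rw [smul_app, hs, zero_app]
        simp [dfun]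
      · simp only [map_smul, map_sum, ins_dfun, map_zero]
        refine ext_app fun m v => ?_
        have hs : (∑ i, θ (e i) • (const (V.1 (x i)) : Forms R F.sections R)) m v
            = ∑ i, θ (e i) * (const (V.1 (x i)) : Forms R F.sections R) m v :=
          map_sum (eval (R := R) (E := R) m v)
            (fun i => θ (e i) • (const (V.1 (x i)) : Forms R F.sections R)) _
        rw [smul_app, hs, zero_app]
        cases m with
        | zero =>
          simp only [const_zero_app, smul_eq_mul]
          rw [← hθ]
          have : F.sections.mkQ V.1 = 0 := (Submodule.Quotient.mk_eq_zero _).2 V.2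
          simp [θ, this]
        | succ m => simp [const_succ_app]
    rw [pow_one, h1]
    simp only [hT, smul_neg, Finset.sum_neg_distrib]
    rw [← neg_mem_iff, neg_neg]
    have h3 : χ • ∑ i, θ (e i) • T (dfun (x i)) = 0 := by
      have := congrArg T h2
      simpa only [map_smul, map_sum, map_zero] using this
    rw [h3]
    exact zero_mem _
  refine ext_app fun n v => ?_
  have := congrArg (fun c : Forms R F.sections (Derivation K R R) => F.sections.mkQ (c n v)) key
  exact (j.mkQ_map _).symm.trans (this.trans (map_zero _))

theorem decompose (j : Splitting F) (X : Derivation K R R) :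
    j.map (F.sections.mkQ X) + (prF j X).1 = X := by
  rw [prF_coe, add_sub_cancel]

/-- Subtracting ψφX and L h X from X leaves a vertical field, for which φ L = 0. On the subtracted
terms φ L is known: φ L ψ = φ ψ d = d, and L L = 0. -/
theorem phi_d [CharZero K] (hsep : Separated R K R) (j : Splitting F) (X : (vect F).carrier) :
    phi ((vect F).d X) = (complex (Conn.bott F)).d (phi X) := by
  have hv : pushforward (X - psi j (phi X) - (vect F).d (homotopyMap j X)) = 0 := by
    rw [pushforward_sub, pushforward_sub, pushforward_psi, pushforward_d_homotopyMap]
    refine ext_app fun n v => ?_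
    have := decompose j (pushforward X n v)
    rw [sub_app, sub_app, zero_app, sub_sub]
    exact sub_eq_zero.2 this.symm
  have h := phi_d_of_vertical hsep j hv
  rw [map_sub, vect_d_d, sub_zero, map_sub, ← psi_d hsep, map_sub, phi_psi, sub_eq_zero] at h
  exact h

/-- Under π_* the left side becomes j pr_B π_* X + pr_F π_* X. Under π_* L it becomes the same
decomposition of π_*(L X), because φ commutes with the differentials. -/
theorem homotopy_vect [CharZero K] (hsep : Separated R K R) (j : Splitting F)
    (X : (vect F).carrier) : psi j (phi X) + ((vect F).d (homotopyMap j X)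
      + homotopyMap j ((vect F).d X)) = X := by
  refine sub_eq_zero.1 (vect_eq_zero_of_pushforward hsep j ?_ ?_)
  · rw [pushforward_sub, pushforward_add, pushforward_add, pushforward_psi,
      pushforward_d_homotopyMap, pushforward_homotopyMap, add_zero]
    refine ext_app fun n v => ?_
    rw [sub_app, add_app]
    exact sub_eq_zero.2 (decompose j (pushforward X n v))
  · rw [map_sub, map_add, map_add, vect_d_d, zero_add, pushforward_sub, pushforward_add,
      pushforward_d_psi, pushforward_d_homotopyMap, ← phi_d hsep j]
    refine ext_app fun n v => ?_
    rw [sub_app, add_app]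
    exact sub_eq_zero.2 (decompose j (pushforward ((vect F).d X) n v))

theorem psi_deg (j : Splitting F) {k : ℤ} {z : (complex (Conn.bott F)).carrier}
    (hz : z ∈ (complex (Conn.bott F)).deg k) : psi j z ∈ (vect F).deg k := by
  have := vectOf_deg (isFormDerivation_splitLie j) (δ := 0)
    ⟨fun _ => rfl, fun h => absurd h (by decide)⟩ (fun l a ha => mem_deg.2 fun n v hn =>
      LinearMap.ext fun z => mem_deg.1 ((splitDerivation j z).lie_deg ha) n v (by simpa using hn)) hz
  rwa [add_zero] at this

theorem homotopyMap_deg (j : Splitting F) {k : ℤ} {X : (vect F).carrier}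
    (hX : X ∈ (vect F).deg k) : homotopyMap j X ∈ (vect F).deg (k - 1) :=
  vectOf_deg isFormDerivation_flat (δ := -1)
    ⟨fun h => absurd h (by decide), fun _ => rfl⟩ (fun l a ha => mem_deg.2 fun n v hn =>
      LinearMap.ext fun z => mem_deg.1 (ins_deg z ha) n v hn)
    (map_deg _ (pushforward_deg ((vect F).par_mem hX)))

theorem isContraction_vect [CharZero K] (hsep : Separated R K R) (j : Splitting F) :
    DGMod.IsContraction (vect F) (complex (Conn.bott F)) phi (psi j) (homotopyMap j) where
  d_d_left := vect_d_d
  d_d_right := ext_ext Conn.isFlat_bott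
  p_deg _ _ h := map_deg _ (pushforward_deg h)
  i_deg _ _ h := psi_deg j h
  h_deg _ _ h := homotopyMap_deg j h
  p_smul := phi_smul
  i_smul := (isPsi_psi j).smul
  h_smul := homotopyMap_smul j
  p_d := phi_d hsep j
  i_d := psi_d hsep j
  p_i := phi_psi j
  homotopy := homotopy_vect hsep j
  h_i := homotopyMap_psi j
  p_h := phi_homotopyMap j
  h_h := homotopyMap_homotopyMap j

end Functions
end FoliationDG
end

noncomputable section
namespace FoliationDG
universe u v w

/-! ### Contractions of modules of graded linear maps -/

namespace DGMod

variable {K : Type v} [Field K] {A : DGAlg.{v, w} K} {E Y T S : DGMod A}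

/-- Contractions that are compatible with the parity operators. -/
structure IsParContraction (E Y : DGMod A) (p : E.carrier →+ Y.carrier)
    (i : Y.carrier →+ E.carrier) (h : E.carrier →+ E.carrier) : Prop
    extends IsContraction E Y p i h where
  p_par : ∀ x, p (E.par x) = Y.par (p x)
  i_par : ∀ y, i (Y.par y) = E.par (i y)
  h_par : ∀ x, h (E.par x) = -E.par (h x)

theorem hom_ext {f g : (hom E T).carrier} (h : ∀ x, f.1 x = g.1 x) : f = g :=
  Subtype.ext (AddMonoidHom.ext h)

theorem hom_add_apply (f g : (hom E T).carrier) (x : E.carrier) :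
    (f + g).1 x = f.1 x + g.1 x := rfl

theorem hom_neg_apply (f : (hom E T).carrier) (x : E.carrier) : (-f).1 x = -f.1 x := rfl

theorem hom_zero_apply (x : E.carrier) : (0 : (hom E T).carrier).1 x = 0 := rfl

theorem hom_smul_apply (a : A.carrier) (f : (hom E T).carrier) (x : E.carrier) :
    (a • f).1 x = a • f.1 x := rfl

theorem hom_par_apply (f : (hom E T).carrier) (x : E.carrier) :
    ((hom E T).par f).1 x = T.par (f.1 (E.par x)) := rfl

theorem hom_d_apply (f : (hom E T).carrier) (x : E.carrier) :
    ((hom E T).d f).1 x = T.d (f.1 x) - T.par (f.1 (E.par (E.d x))) := rfl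

theorem hom_smul_even (f : (hom E T).carrier) {a : A.carrier} (ha : A.par a = a) (x : E.carrier) :
    f.1 (a • x) = a • f.1 x := f.2.1 a x ha

theorem hom_smul_odd (f : (hom E T).carrier) {a : A.carrier} (ha : A.par a = -a) (x : E.carrier) :
    f.1 (a • x) = a • T.par (f.1 (E.par x)) := f.2.2 a x ha

theorem mem_hom_deg {k : ℤ} {f : (hom E T).carrier}
    (h : ∀ l x, x ∈ E.deg l → f.1 x ∈ T.deg (l + k))
    (h0 : Even k → (hom E T).par f = f) (h1 : Odd k → (hom E T).par f = -f) :
    f ∈ (hom E T).deg k :=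
  ⟨h, fun hk => congrArg Subtype.val (h0 hk), fun hk => congrArg Subtype.val (h1 hk)⟩

theorem hom_deg_apply {k l : ℤ} {f : (hom E T).carrier} (hf : f ∈ (hom E T).deg k)
    {x : E.carrier} (hx : x ∈ E.deg l) : f.1 x ∈ T.deg (l + k) := hf.1 l x hx

theorem hom_d_d (hE : ∀ x, E.d (E.d x) = 0) (hT : ∀ x, T.d (T.d x) = 0) (f : (hom E T).carrier) :
    (hom E T).d ((hom E T).d f) = 0 := hom_ext fun x => by
  simp only [hom_d_apply, map_sub, hT, E.par_d, T.par_d, map_neg, hE, map_zero,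
    hom_zero_apply]
  abel

/-- Degree `0` linear maps. -/
structure IsStrict (E T : DGMod A) (f : E.carrier →+ T.carrier) : Prop where
  smul : ∀ (a : A.carrier) x, f (a • x) = a • f x
  par : ∀ x, f (E.par x) = T.par (f x)

/-- Composition with degree `0` maps on both sides. -/
def homMap {i : Y.carrier →+ E.carrier} (hi : IsStrict Y E i) {q : T.carrier →+ S.carrier}
    (hq : IsStrict T S q) : (hom E T).carrier →+ (hom Y S).carrier where
  toFun f := ⟨q.comp (f.1.comp i),
    fun a x ha => by
      simp only [AddMonoidHom.comp_apply, hi.smul, hom_smul_even f ha, hq.smul],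
    fun a x ha => by
      simp only [AddMonoidHom.comp_apply, hi.smul, hom_smul_odd f ha, hq.smul, hi.par, hq.par]⟩
  map_zero' := hom_ext fun _ => q.map_zero
  map_add' _ _ := hom_ext fun _ => q.map_add _ _

theorem homMap_apply {i : Y.carrier →+ E.carrier} (hi : IsStrict Y E i)
    {q : T.carrier →+ S.carrier} (hq : IsStrict T S q) (f : (hom E T).carrier) (x : Y.carrier) :
    (homMap hi hq f).1 x = q (f.1 (i x)) := rfl

theorem homMap_par {i : Y.carrier →+ E.carrier} (hi : IsStrict Y E i)
    {q : T.carrier →+ S.carrier} (hq : IsStrict T S q) (f : (hom E T).carrier) :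
    homMap hi hq ((hom E T).par f) = (hom Y S).par (homMap hi hq f) := hom_ext fun x => by
  simp only [homMap_apply, hom_par_apply, hi.par, hq.par]

theorem homMap_deg {i : Y.carrier →+ E.carrier} (hi : IsStrict Y E i)
    {q : T.carrier →+ S.carrier} (hq : IsStrict T S q) (hid : ∀ k, ∀ x ∈ Y.deg k, i x ∈ E.deg k)
    (hqd : ∀ k, ∀ x ∈ T.deg k, q x ∈ S.deg k) {k : ℤ} {f : (hom E T).carrier}
    (hf : f ∈ (hom E T).deg k) : homMap hi hq f ∈ (hom Y S).deg k :=
  mem_hom_deg (fun l x hx => hqd _ _ (hom_deg_apply hf (hid _ _ hx)))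
    (fun hk => by rw [← homMap_par, (hom E T).par_of_even k f hf hk])
    (fun hk => by rw [← homMap_par, (hom E T).par_of_odd k f hf hk, map_neg])

theorem homMap_d {i : Y.carrier →+ E.carrier} (hi : IsStrict Y E i)
    {q : T.carrier →+ S.carrier} (hq : IsStrict T S q) (hid : ∀ x, i (Y.d x) = E.d (i x))
    (hqd : ∀ x, q (T.d x) = S.d (q x)) (f : (hom E T).carrier) :
    homMap hi hq ((hom E T).d f) = (hom Y S).d (homMap hi hq f) := hom_ext fun x => by
  simp only [homMap_apply, hom_d_apply, hi.par, hq.par, map_sub, hid, hqd]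

theorem homMap_smul {i : Y.carrier →+ E.carrier} (hi : IsStrict Y E i)
    {q : T.carrier →+ S.carrier} (hq : IsStrict T S q) (a : A.carrier) (f : (hom E T).carrier) :
    homMap hi hq (a • f) = a • homMap hi hq f := hom_ext fun _ => hq.smul _ _

namespace IsParContraction

variable {p : E.carrier →+ Y.carrier} {i : Y.carrier →+ E.carrier} {h : E.carrier →+ E.carrier}
  {p' : T.carrier →+ S.carrier} {i' : S.carrier →+ T.carrier} {h' : T.carrier →+ T.carrier}

theorem strict_p (c : IsParContraction E Y p i h) : IsStrict E Y p := ⟨c.p_smul, c.p_par⟩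

theorem strict_i (c : IsParContraction E Y p i h) : IsStrict Y E i := ⟨c.i_smul, c.i_par⟩

/-- The homotopy `f ↦ (-1)^|f| f h + h' f i p` on `Hom(E, T)`. -/
def homHomotopy (c : IsParContraction E Y p i h) (c' : IsParContraction T S p' i' h') :
    (hom E T).carrier →+ (hom E T).carrier where
  toFun f := ⟨(twist E T f.1).comp h + h'.comp (f.1.comp (i.comp p)),
    fun a x ha => by
      have h1 := (twist_mem f.2).1 a (h x) ha
      simp only [AddMonoidHom.add_apply, AddMonoidHom.comp_apply, c.h_smul, c.p_smul, c.i_smul,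
        hom_smul_even f ha, c'.h_smul, ha, h1, smul_add],
    fun a x ha => by
      have h1 := (twist_mem f.2).2 a (h x) ha
      simp only [AddMonoidHom.add_apply, AddMonoidHom.comp_apply, c.h_smul, c.p_smul, c.i_smul,
        hom_smul_odd f ha, c'.h_smul, ha, h1, smul_add, c.h_par, c.p_par, c.i_par, c'.h_par,
        neg_smul, map_neg, smul_neg, map_add, neg_neg]⟩
  map_zero' := hom_ext fun x => by
    have : twist E T (0 : (hom E T).carrier).1 = 0 := congrArg Subtype.val ((hom E T).par.map_zero)
    show (twist E T (0 : (hom E T).carrier).1) (h x) + h' 0 = 0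
    rw [this, map_zero]
    exact add_zero _
  map_add' f g := hom_ext fun x => by
    show (twist E T (f.1 + g.1)) (h x) + h' (f.1 (i (p x)) + g.1 (i (p x))) = (_ + _) + (_ + _)
    rw [twist_add, map_add]
    exact add_add_add_comm _ _ _ _

theorem homHomotopy_apply (c : IsParContraction E Y p i h) (c' : IsParContraction T S p' i' h')
    (f : (hom E T).carrier) (x : E.carrier) :
    (homHomotopy c c' f).1 x = T.par (f.1 (E.par (h x))) + h' (f.1 (i (p x))) := rfl

theorem par_p (c : IsParContraction E Y p i h) (x) : Y.par (p x) = p (E.par x) := (c.p_par x).symm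

theorem par_i (c : IsParContraction E Y p i h) (x) : E.par (i x) = i (Y.par x) := (c.i_par x).symm

theorem par_h (c : IsParContraction E Y p i h) (x) : E.par (h x) = -h (E.par x) := by
  rw [c.h_par, neg_neg]

theorem homHomotopy_par (c : IsParContraction E Y p i h) (c' : IsParContraction T S p' i' h')
    (f : (hom E T).carrier) :
    homHomotopy c c' ((hom E T).par f) = -(hom E T).par (homHomotopy c c' f) :=
  hom_ext fun x => by
    simp only [hom_neg_apply, homHomotopy_apply, hom_par_apply, c.par_h, c.par_p, c.par_i,
      c'.par_h, map_add, map_neg, E.par_par, T.par_par]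
    abel

/-- Contractions induce contractions between modules of graded linear maps. -/
theorem hom (c : IsParContraction E Y p i h) (c' : IsParContraction T S p' i' h') :
    IsParContraction (DGMod.hom E T) (DGMod.hom Y S) (homMap c.strict_i c'.strict_p)
      (homMap c.strict_p c'.strict_i) (homHomotopy c c') where
  d_d_left := hom_d_d c.d_d_left c'.d_d_left
  d_d_right := hom_d_d c.d_d_right c'.d_d_right
  p_deg _ _ hf := homMap_deg _ _ c.i_deg c'.p_deg hf
  i_deg _ _ hf := homMap_deg _ _ c.p_deg c'.i_deg hf
  h_deg k f hf := by
    refine mem_hom_deg (fun l x hx => ?_) (fun hk => ?_) (fun hk => ?_)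
    · rw [homHomotopy_apply]
      have h1 := T.par_mem (hom_deg_apply hf (E.par_mem (c.h_deg _ _ hx)))
      have h2 := c'.h_deg _ _ (hom_deg_apply hf (c.i_deg _ _ (c.p_deg _ _ hx)))
      rw [show l - 1 + k = l + (k - 1) by ring] at h1
      rw [show l + k - 1 = l + (k - 1) by ring] at h2
      exact add_mem h1 h2
    · have hk' : Odd k := by
        have := hk.add_one
        rwa [sub_add_cancel] at this
      have := homHomotopy_par c c' f
      rw [(DGMod.hom E T).par_of_odd k f hf hk', map_neg] at this
      exact (neg_injective this).symm
    · have hk' : Even k := by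
        have := hk.add_one
        rwa [sub_add_cancel] at this
      have := homHomotopy_par c c' f
      rw [(DGMod.hom E T).par_of_even k f hf hk'] at this
      exact (neg_eq_iff_eq_neg.1 this.symm)
  p_smul a f := homMap_smul _ _ a f
  i_smul a f := homMap_smul _ _ a f
  h_smul a f := hom_ext fun x => by
    simp only [homHomotopy_apply, hom_smul_apply, T.par_smul, c'.h_smul, smul_add]
  p_d f := homMap_d _ _ c.i_d c'.p_d f
  i_d f := homMap_d _ _ c.p_d c'.i_d f
  p_i f := hom_ext fun x => by simp only [homMap_apply, c.p_i, c'.p_i]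
  -- The commutators of d with h and h' are id - ip and id - i'p', so the two halves of the homotopy
  -- contribute f - f i p and f i p - i'p' f i p; adding i'p' f i p leaves f.
  homotopy f := hom_ext fun x => by
    have h1 : ∀ x, E.d (h x) = x - i (p x) - h (E.d x) := fun x => by
      have := c.homotopy x
      nth_rewrite 2 [← this]; abel
    have h2 : ∀ x, T.d (h' x) = x - i' (p' x) - h' (T.d x) := fun x => by
      have := c'.homotopy x
      nth_rewrite 2 [← this]; abel
    simp only [hom_add_apply, homMap_apply, hom_d_apply, homHomotopy_apply, c.par_h, c.par_p,
      c.par_i, c'.par_h, map_add, map_sub, map_neg, E.par_par, T.par_par, E.par_d, T.par_d,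
      c.p_d, c.i_d, h1, h2, neg_neg]
    abel
  h_i f := hom_ext fun x => by
    simp only [homMap_apply, homHomotopy_apply, c.par_h, c.p_h, map_neg, map_zero, neg_zero,
      c'.h_i, add_zero, hom_zero_apply]
  p_h f := hom_ext fun x => by
    simp only [homMap_apply, homHomotopy_apply, c.h_i, map_zero, c'.p_h, map_add, add_zero,
      hom_zero_apply]
  -- Every term of the square contains one of h h, h i, p h, h' h'.
  h_h f := hom_ext fun x => by
    simp only [homHomotopy_apply, c.par_h, c.h_h, c.p_h, c.h_i, c'.h_h, c.p_i, map_neg,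
      map_add, map_zero, neg_zero, add_zero, hom_zero_apply]
  p_par f := homMap_par _ _ f
  i_par f := homMap_par _ _ f
  h_par f := homHomotopy_par c c' f

/-- The identity contraction. -/
theorem refl (hd : ∀ x, E.d (E.d x) = 0) :
    IsParContraction E E (AddMonoidHom.id _) (AddMonoidHom.id _) 0 where
  d_d_left := hd
  d_d_right := hd
  p_deg _ _ h := h
  i_deg _ _ h := h
  h_deg _ _ _ := zero_mem _
  p_smul _ _ := rfl
  i_smul _ _ := rfl
  h_smul _ _ := (smul_zero _).symm
  p_d _ := rfl
  i_d _ := rfl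
  p_i _ := rfl
  homotopy x := by simp
  h_i _ := rfl
  p_h _ := rfl
  h_h _ := rfl
  p_par _ := rfl
  i_par _ := rfl
  h_par _ := by simp

/-- Transport of a contraction along an isomorphism of the small complex. -/
theorem trans_equiv (c : IsParContraction E Y p i h) (e : Y.carrier ≃+ S.carrier)
    (he : IsStrict Y S e) (hd : ∀ y, e (Y.d y) = S.d (e y))
    (hdeg : ∀ k, ∀ y ∈ Y.deg k, e y ∈ S.deg k) (hdeg' : ∀ k, ∀ s ∈ S.deg k, e.symm s ∈ Y.deg k) :
    IsParContraction E S (e.toAddMonoidHom.comp p) (i.comp e.symm.toAddMonoidHom) h where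
  d_d_left := c.d_d_left
  d_d_right s := by
    have := congrArg e (c.d_d_right (e.symm s))
    rwa [hd, hd, e.apply_symm_apply, map_zero] at this
  p_deg k x hx := hdeg k _ (c.p_deg k x hx)
  i_deg k s hs := c.i_deg k _ (hdeg' k s hs)
  h_deg := c.h_deg
  p_smul a x := (congrArg e (c.p_smul a x)).trans (he.smul _ _)
  i_smul a s := by
    have h1 : e (a • e.symm s) = a • e (e.symm s) := he.smul _ _
    have : e.symm (a • s) = a • e.symm s := e.injective (by
      rw [h1, e.apply_symm_apply, e.apply_symm_apply])
    exact (congrArg i this).trans (c.i_smul _ _)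
  h_smul := c.h_smul
  p_d x := (congrArg e (c.p_d x)).trans (hd _)
  i_d s := by
    have : e.symm (S.d s) = Y.d (e.symm s) := e.injective (by
      rw [hd, e.apply_symm_apply, e.apply_symm_apply])
    exact (congrArg i this).trans (c.i_d _)
  p_i s := (congrArg e (c.p_i _)).trans (e.apply_symm_apply s)
  homotopy x := by
    refine Eq.trans ?_ (c.homotopy x)
    exact congrArg (fun y => i y + _) (e.symm_apply_apply (p x))
  h_i s := c.h_i _
  p_h x := (congrArg e (c.p_h x)).trans e.map_zero
  h_h := c.h_h
  p_par x := (congrArg e (c.p_par x)).trans (he.par _)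
  i_par s := by
    have h1 : e (Y.par (e.symm s)) = S.par (e (e.symm s)) := he.par _
    have : e.symm (S.par s) = Y.par (e.symm s) := e.injective (by
      rw [h1, e.apply_symm_apply, e.apply_symm_apply])
    exact (congrArg i this).trans (c.i_par _)
  h_par := c.h_par

end IsParContraction

/-! ### Decomposable tensors -/

/-- Characteristic zero is needed for the factor 1/2 in the parity projections. -/
theorem even_add_odd [CharZero K] (x : E.carrier) : E.even x + E.odd x = x := by
  rw [even, odd, ← smul_add, add_add_sub_cancel, smul_add, ← add_smul, ← map_add]
  have : (2⁻¹ + 2⁻¹ : K) = 1 := by norm_num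
  rw [this, map_one, one_smul]

theorem even_of_par [CharZero K] {x : E.carrier} (h : E.par x = x) :
    E.even x = x ∧ E.odd x = 0 := by
  have h0 : E.odd x = 0 := by rw [odd, h, sub_self, smul_zero]
  refine ⟨?_, h0⟩
  have := even_add_odd x
  rwa [h0, add_zero] at this

theorem dualTmul_apply (α : (dual E).carrier) (t : T.carrier) (x : E.carrier) :
    (dualTmul α t).1 x = pair α (E.even x) • t + pair α (E.odd x) • T.par t := rfl

theorem pair_par (α : (dual E).carrier) (x : E.carrier) :
    pair ((dual E).par α) x = A.par (pair α (E.par x)) := rfl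

theorem map_even {f : E.carrier →+ T.carrier} (hf : IsStrict E T f) (x : E.carrier) :
    f (E.even x) = T.even (f x) := by rw [even, even, hf.smul, map_add, hf.par]

theorem map_odd {f : E.carrier →+ T.carrier} (hf : IsStrict E T f) (x : E.carrier) :
    f (E.odd x) = T.odd (f x) := by rw [odd, odd, hf.smul, map_sub, hf.par]

theorem bidual_apply (x : E.carrier) (α : (dual E).carrier) :
    pair (bidual x) α = pair α (E.even x) + pair ((dual E).par α) (E.odd x) := rfl

end DGMod

end FoliationDG
end

noncomputable section
namespace FoliationDG
universe u v w

/-! ### Linear maps of Chevalley-Eilenberg complexes as bundle-valued forms -/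

section FormHom

variable {K : Type v} {R : Type w} [Field K] [CommRing R] [Algebra K R] {F : Distribution K R}
  {P S : Conn F}

open Forms

/-- The wedge product with a form with values in `Hom(P, S)`. -/
def wedgeHom : (complex (Conn.hom P S)).carrier →+ (DGMod.hom (complex P) (complex S)).carrier where
  toFun s := ⟨AddMonoidHom.mk' (fun y : Forms R F.sections P.carrier =>
      Forms.wedge (E := P.carrier →ₗ[R] S.carrier) (E'' := S.carrier) LinearMap.id s y)
      (Forms.wedge_add_right _ s),
    fun a y ha => wedge_smul_even (E := P.carrier →ₗ[R] S.carrier) (E'' := S.carrier)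
      LinearMap.id ha s y,
    fun a y ha => by
      refine (wedge_smul_odd (E := P.carrier →ₗ[R] S.carrier) (E'' := S.carrier)
        LinearMap.id ha s y).trans (congrArg (fun b : (complex S).carrier => a • b) ?_)
      refine Eq.trans ?_ (Forms.par_wedge _ _ _).symm
      exact congrArg _ (Forms.par_par y).symm⟩
  map_zero' := DGMod.hom_ext fun y => Forms.wedge_zero_left _ y
  map_add' s s' := DGMod.hom_ext fun y => Forms.wedge_add_left _ s s' y

theorem hom_const_smul (f : (DGMod.hom (complex P) (complex S)).carrier) (c : R) (z : P.carrier) :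
    asForm (f.1 (Forms.const (c • z))) = c • asForm (f.1 (Forms.const z)) := by
  have h : (Forms.const (c • z) : Forms R F.sections P.carrier)
      = (Forms.const c : Forms R F.sections R) • Forms.const z :=
    (const_smul c z).trans (const_form_smul c _).symm
  refine (congrArg (fun y => asForm (f.1 y)) h).trans ?_
  exact (f.2.1 (Forms.const c : Forms R F.sections R) (Forms.const z) (par_const c)).trans
    (const_form_smul c _)

theorem hom_const_add (f : (DGMod.hom (complex P) (complex S)).carrier) (z z' : P.carrier) :
    asForm (f.1 (Forms.const (z + z'))) = asForm (f.1 (Forms.const z)) +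
      asForm (f.1 (Forms.const z')) := by
  rw [Forms.const_add]
  exact f.1.map_add _ _

/-- The form with values in `Hom(P, S)` given by the values of a linear map on sections of `P`. -/
def symbol : (DGMod.hom (complex P) (complex S)).carrier →+ (complex (Conn.hom P S)).carrier where
  toFun f := fun n =>
    { toFun := fun v =>
        { toFun := fun z => asForm (f.1 (Forms.const z)) n v
          map_add' := fun z z' => by rw [hom_const_add]; rfl
          map_smul' := fun c z => by rw [hom_const_smul]; rfl }
      map_update_add' := fun v i x y => LinearMap.ext fun z =>
        (asForm (f.1 (Forms.const z)) n).map_update_add v i x y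
      map_update_smul' := fun v i c x => LinearMap.ext fun z =>
        (asForm (f.1 (Forms.const z)) n).map_update_smul v i c x
      map_eq_zero_of_eq' := fun v i j hv hij => LinearMap.ext fun z =>
        (asForm (f.1 (Forms.const z)) n).map_eq_zero_of_eq v hv hij }
  map_zero' := rfl
  map_add' _ _ := rfl

theorem map_applyₗ (s : (complex (Conn.hom P S)).carrier) (z : P.carrier) :
    map (LinearMap.applyₗ z) (asForm s) = (wedgeHom s).1 (Forms.const z) :=
  (wedge_const_eq (LinearMap.id : (P.carrier →ₗ[R] S.carrier) →ₗ[R] _) (asForm s) z).symm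

/-- Forms with values in Hom(P, S) are recovered from their wedge products with constant sections.
This direction requires no frames. -/
theorem symbol_wedgeHom (s : (complex (Conn.hom P S)).carrier) : symbol (wedgeHom s) = s :=
  ext_dual fun z => (map_applyₗ s z).symm

/-- With a local frame of P, the Ω_F-module Ω_F(P) is locally generated by degree 0 forms, so a
graded linear map is determined by its values on them; `Separated` passes from local to global. -/
theorem hom_eq_zero_of_const [CharZero K] (hP : HasFrames R K P.carrier)
    (hS : Separated R K S.carrier) {f : (DGMod.hom (complex P) (complex S)).carrier}
    (h : ∀ z, f.1 (Forms.const z) = (0 : Forms R F.sections S.carrier)) : f = 0 := by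
  -- Graded linearity gives a rule for even and one for odd scalars, so the scalar is split into its
  -- two parts.
  have key : ∀ (a : Forms R F.sections R) z,
      f.1 (a • (Forms.const z : Forms R F.sections P.carrier)) = 0 := by
    intro a z
    let y : (complex P).carrier := Forms.const z
    let ae : (functions F).carrier := (functions F).self.even a
    let ao : (functions F).carrier := (functions F).self.odd a
    have h0 : f.1 y = 0 := h z
    have hp : (complex P).par y = y := par_const z
    have h1 : f.1 (ae • y) = 0 := by
      have e := f.2.1 ae y ((functions F).self.par_even a)
      rw [h0] at e
      exact e.trans (smul_zero ae)
    have h2 : f.1 (ao • y) = 0 := by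
      have e := f.2.2 ao y ((functions F).self.par_odd a)
      rw [hp, h0, map_zero] at e
      exact e.trans (smul_zero ao)
    have h3 : (ae + ao) • y = ae • y + ao • y := add_smul _ _ _
    have h4 : (ae + ao) • y = (show (functions F).carrier from a) • y :=
      congrArg (fun b : (functions F).carrier => b • y)
        (DGMod.even_add_odd (E := (functions F).self) a)
    refine (congrArg f.1 (h4.symm.trans h3)).trans ((f.1.map_add _ _).trans ?_)
    exact (congrArg₂ (· + ·) h1 h2).trans (add_zero _)
  have hsm : ∀ (c : R) (y : Forms R F.sections P.carrier),
      asForm (f.1 (c • y)) = c • asForm (f.1 y) := fun c y => by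
    rw [← const_form_smul c y]
    exact (f.2.1 (Forms.const c : Forms R F.sections R) y (par_const c)).trans
      (const_form_smul c _)
  refine DGMod.hom_ext fun y => hS.forms (asForm (f.1 y)) fun χ hχ => ?_
  obtain ⟨n, l, e, hle⟩ := hP χ hχ
  refine ⟨1, ?_⟩
  -- The frame expansion is applied to each value of the form y; the coefficients become the scalar
  -- forms lᵢ(y).
  have hy : χ • asForm y
      = χ • ∑ i, map (l i) (asForm y) • (Forms.const (e i) : Forms R F.sections P.carrier) := by
    have h1 : ∀ i, map (l i) (asForm y) • (Forms.const (e i) : Forms R F.sections P.carrier)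
        = map ((act P.carrier).flip (e i) ∘ₗ l i) (asForm y) := fun i =>
      wedge_const_eq (act P.carrier) (map (l i) (asForm y)) (e i)
    refine ext_app fun k v => ?_
    have h2 := hle (asForm y k v)
    rw [Finset.sum_congr rfl fun i _ => h1 i]
    have h3 := map_sum (Forms.eval k v) (fun i => map ((act P.carrier).flip (e i) ∘ₗ l i) (asForm y))
      Finset.univ
    exact h2.trans (congrArg (χ • ·) h3.symm)
  refine (congrArg (· • asForm (f.1 y)) (pow_one χ)).trans ((hsm χ y).symm.trans ?_)
  refine (congrArg (fun y => asForm (f.1 y)) hy).trans ((hsm _ _).trans ?_)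
  have h4 : f.1 (∑ i, map (l i) (asForm y) • (Forms.const (e i) : Forms R F.sections P.carrier))
      = ∑ i, f.1 (map (l i) (asForm y) • (Forms.const (e i) : Forms R F.sections P.carrier)) :=
    map_sum f.1 _ _
  have h5 : ∑ i, f.1 (map (l i) (asForm y) • (Forms.const (e i) : Forms R F.sections P.carrier))
      = 0 := Finset.sum_eq_zero fun i _ => key _ _
  have h6 : asForm (f.1 (∑ i, map (l i) (asForm y) •
      (Forms.const (e i) : Forms R F.sections P.carrier))) = 0 := congrArg asForm (h4.trans h5)
  exact (congrArg (χ • ·) h6).trans (smul_zero χ)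

theorem hom_ext_const [CharZero K] (hP : HasFrames R K P.carrier) (hS : Separated R K S.carrier)
    {f g : (DGMod.hom (complex P) (complex S)).carrier}
    (h : ∀ z : P.carrier, f.1 (Forms.const z) = g.1 (Forms.const z)) : f = g :=
  sub_eq_zero.1 (hom_eq_zero_of_const hP hS fun z => sub_eq_zero.2 (h z))

theorem wedgeHom_symbol [CharZero K] (hP : HasFrames R K P.carrier) (hS : Separated R K S.carrier)
    (f : (DGMod.hom (complex P) (complex S)).carrier) : wedgeHom (symbol f) = f :=
  hom_ext_const hP hS fun z => (map_applyₗ (symbol f) z).symm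

theorem wedgeHom_smul (a : (functions F).carrier) (s : (complex (Conn.hom P S)).carrier) :
    wedgeHom (a • s) = a • wedgeHom s := DGMod.hom_ext fun y =>
  smul_wedge (E := P.carrier →ₗ[R] S.carrier) (E'' := S.carrier) LinearMap.id a s y

theorem wedgeHom_par (s : (complex (Conn.hom P S)).carrier) :
    wedgeHom ((complex (Conn.hom P S)).par s) = (DGMod.hom (complex P) (complex S)).par (wedgeHom s) :=
  DGMod.hom_ext fun y => by
    refine Eq.trans ?_ (Forms.par_wedge _ s (Forms.par y)).symm
    exact congrArg _ (Forms.par_par y).symm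

/-- This is the Leibniz rule for the evaluation Hom(P, S) × P → S, which is parallel by the
definition of the induced connection. -/
theorem wedgeHom_d (s : (complex (Conn.hom P S)).carrier) :
    wedgeHom ((complex (Conn.hom P S)).d s) = (DGMod.hom (complex P) (complex S)).d (wedgeHom s) :=
  DGMod.hom_ext fun y => by
    have h1 := ext_wedge (P := Conn.hom P S) (Q := P) (S := S) LinearMap.id
      (fun x f e => (sub_add_cancel _ _).symm) s y
    have h2 := (Forms.par_wedge (LinearMap.id : (P.carrier →ₗ[R] S.carrier) →ₗ[R] _) s
      (Forms.par (Forms.ext (P := P) y)))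
    rw [Forms.par_par] at h2
    refine Eq.trans ?_ (congrArg₂ (· - ·) h1.symm h2.symm)
    exact (add_sub_cancel_right _ _).symm

theorem wedgeHom_deg {k : ℤ} {s : (complex (Conn.hom P S)).carrier}
    (hs : s ∈ (complex (Conn.hom P S)).deg k) :
    wedgeHom s ∈ (DGMod.hom (complex P) (complex S)).deg k :=
  DGMod.mem_hom_deg (fun l x hx => by
      rw [add_comm l k]
      exact wedge_deg (LinearMap.id : (P.carrier →ₗ[R] S.carrier) →ₗ[R] _) hs hx)
    (fun hk => by rw [← wedgeHom_par, (complex (Conn.hom P S)).par_of_even k s hs hk])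
    (fun hk => by rw [← wedgeHom_par, (complex (Conn.hom P S)).par_of_odd k s hs hk, map_neg])

theorem symbol_deg {k : ℤ} {f : (DGMod.hom (complex P) (complex S)).carrier}
    (hf : f ∈ (DGMod.hom (complex P) (complex S)).deg k) :
    symbol f ∈ (complex (Conn.hom P S)).deg k :=
  mem_deg.2 fun n v hn => LinearMap.ext fun z => by
    have h := hf.1 0 _ (const_deg z)
    rw [zero_add] at h
    exact mem_deg.1 h n v hn

/-- Linear maps `Ω_F(P) → Ω_F(S)` are forms with values in `Hom(P, S)`. -/
def symbolEquiv [CharZero K] (hP : HasFrames R K P.carrier) (hS : Separated R K S.carrier) :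
    (DGMod.hom (complex P) (complex S)).carrier ≃+ (complex (Conn.hom P S)).carrier :=
  { symbol with
    invFun := wedgeHom
    left_inv := wedgeHom_symbol hP hS
    right_inv := symbol_wedgeHom }

/-- Compatibility is visible for the wedge product, and is transported to its inverse. -/
theorem isStrict_symbol [CharZero K] (hP : HasFrames R K P.carrier)
    (hS : Separated R K S.carrier) :
    DGMod.IsStrict (DGMod.hom (complex P) (complex S)) (complex (Conn.hom P S))
      (symbolEquiv hP hS).toAddMonoidHom where
  smul a f := by
    refine (congrArg (fun f => symbol (a • f)) (wedgeHom_symbol hP hS f).symm).trans ?_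
    exact (congrArg symbol (wedgeHom_smul a _).symm).trans (symbol_wedgeHom _)
  par f := by
    refine (congrArg (fun f => symbol ((DGMod.hom _ _).par f))
      (wedgeHom_symbol hP hS f).symm).trans ?_
    exact (congrArg symbol (wedgeHom_par _).symm).trans (symbol_wedgeHom _)

namespace DGMod.IsParContraction

variable {E T : DGMod (functions F)} {p : E.carrier →+ (complex P).carrier}
  {i : (complex P).carrier →+ E.carrier} {h : E.carrier →+ E.carrier}
  {p' : T.carrier →+ (complex S).carrier} {i' : (complex S).carrier →+ T.carrier}
  {h' : T.carrier →+ T.carrier}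

/-- The projection of the contraction of `Hom(E, T)` onto forms with values in `Hom(P, S)`. -/
def homProj (c : IsParContraction E (complex P) p i h)
    (c' : IsParContraction T (complex S) p' i' h') :
    (DGMod.hom E T).carrier →+ (complex (Conn.hom P S)).carrier :=
  symbol.comp (homMap c.strict_i c'.strict_p)

/-- The inclusion of the contraction of `Hom(E, T)` onto forms with values in `Hom(P, S)`. -/
def homIncl (c : IsParContraction E (complex P) p i h)
    (c' : IsParContraction T (complex S) p' i' h') :
    (complex (Conn.hom P S)).carrier →+ (DGMod.hom E T).carrier :=
  (homMap c.strict_p c'.strict_i).comp wedgeHom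

theorem homForms [CharZero K] (hP : HasFrames R K P.carrier) (hS : Separated R K S.carrier)
    (c : IsParContraction E (complex P) p i h) (c' : IsParContraction T (complex S) p' i' h') :
    IsParContraction (DGMod.hom E T) (complex (Conn.hom P S)) (homProj c c') (homIncl c c')
      (homHomotopy c c') := by
  refine trans_equiv (c.hom c') (symbolEquiv hP hS) (isStrict_symbol hP hS) (fun f => ?_)
    (fun k f hf => symbol_deg hf) (fun k s hs => wedgeHom_deg hs)
  refine (congrArg (fun f => symbol ((DGMod.hom _ _).d f)) (wedgeHom_symbol hP hS f).symm).trans ?_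
  exact (congrArg symbol (wedgeHom_d _).symm).trans (symbol_wedgeHom _)

end DGMod.IsParContraction

end FormHom

end FoliationDG
end

noncomputable section
namespace FoliationDG
universe u v w

/-! ### Dual contractions and Koszul signs on decomposable tensors -/

namespace DGMod

section Abstract

variable {K : Type v} [Field K] {A : DGAlg.{v, w} K} {E Y T S Z : DGMod A}
  {p : E.carrier →+ Y.carrier} {i : Y.carrier →+ E.carrier} {h : E.carrier →+ E.carrier}
  {p' : T.carrier →+ S.carrier} {i' : S.carrier →+ T.carrier} {h' : T.carrier →+ T.carrier}

theorem bidual_par (x : E.carrier) :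
    (dual (dual E)).par (bidual x) = bidual (E.par x) := hom_ext fun α => by
  have h1 : pair ((dual E).par α) (E.even x) = A.par (pair α (E.even x)) := by
    rw [pair_par, E.par_even]
  have h2 : pair ((dual E).par α) (E.odd x) = -A.par (pair α (E.odd x)) := by
    rw [pair_par, E.par_odd, pair_neg, map_neg]
  have h3 : pair (bidual (E.par x)) α = pair α (E.even x) - pair ((dual E).par α) (E.odd x) := by
    rw [bidual_apply, E.even_par, E.odd_par, pair_neg, sub_eq_add_neg]
  have h4 : pair (bidual x) ((dual E).par α)
      = pair ((dual E).par α) (E.even x) + pair α (E.odd x) := by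
    rw [bidual_apply, (dual E).par_par]
  refine Eq.trans (b := A.par (pair (bidual x) ((dual E).par α))) rfl (Eq.trans ?_ h3.symm)
  rw [h4, map_add, h1, h2, A.par_par, sub_neg_eq_add]

namespace IsParContraction

/-- Being odd, h exchanges even and odd parts; the scalar 1/2 is even and passes through h
unchanged. -/
theorem even_h (c : IsParContraction E Y p i h) (x : E.carrier) : E.even (h x) = h (E.odd x) := by
  have h2 : A.par (algebraMap K A.carrier 2⁻¹) = algebraMap K A.carrier 2⁻¹ := by
    rw [Algebra.algebraMap_eq_smul_one, map_smul, A.par_one]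
  rw [even, odd, c.h_smul, h2, map_sub, c.h_par, sub_neg_eq_add]

theorem odd_h (c : IsParContraction E Y p i h) (x : E.carrier) : E.odd (h x) = h (E.even x) := by
  have h2 : A.par (algebraMap K A.carrier 2⁻¹) = algebraMap K A.carrier 2⁻¹ := by
    rw [Algebra.algebraMap_eq_smul_one, map_smul, A.par_one]
  rw [even, odd, c.h_smul, h2, map_add, c.h_par, ← sub_eq_add_neg]

/-- Of the two terms of the homotopy, precomposition with h moves onto α and gives δ, while h' acts
on t after α has been composed with ip, giving γ. Passing h' across α costs (-1)^|α|, which is the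
parity operator in `hγ`; the one in `hδ` belongs to the definition of the dual of h. -/
theorem homHomotopy_dualTmul (c : IsParContraction E Y p i h)
    (c' : IsParContraction T S p' i' h') {α γ δ : (dual E).carrier}
    (hγ : ∀ x, pair γ x = pair ((dual E).par α) (i (p x)))
    (hδ : ∀ x, pair δ x = pair ((dual E).par α) (h x)) (t : T.carrier) :
    homHomotopy c c' (dualTmul α t) = dualTmul δ t + dualTmul γ (h' t) := hom_ext fun x => by
  rw [homHomotopy_apply, hom_add_apply, dualTmul_apply, dualTmul_apply, dualTmul_apply,
    dualTmul_apply, E.even_par, E.odd_par, c.even_h, c.odd_h, hγ, hγ, hδ, hδ,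
    map_even c.strict_p, map_even c.strict_i, map_odd c.strict_p, map_odd c.strict_i, pair_par,
    pair_par, pair_par, pair_par, E.par_even, E.par_odd, c.par_h, c.par_h, E.par_even, E.par_odd,
    map_neg h, neg_neg, pair_neg, pair_neg, map_add, map_add, T.par_smul, T.par_smul, c'.h_smul,
    c'.h_smul, c'.h_par, T.par_par, map_neg, map_neg, neg_smul, neg_smul, smul_neg]
  abel

variable {φd : Z.carrier →+ (dual E).carrier} {ψd : (dual E).carrier →+ Z.carrier}
  {hd : (dual E).carrier →+ (dual E).carrier}

/-- A tensor x ⊗ t is by definition `dualTmul` of the bidual of x, so the previous formula applies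
with E^∨ in place of E. What remains is that dualizing twice returns ip and h; the sign (-1)^|x| for
passing h' appears as `E.par x`. -/
theorem homHomotopy_tmul (c : IsParContraction E Y p i h) (cd : IsParContraction (dual E) Z ψd φd hd)
    (c' : IsParContraction T S p' i' h')
    (hip : ∀ α x, pair (φd (ψd α)) x = pair α (i (p x)))
    (hh : ∀ α x, pair (hd α) x = pair ((dual E).par α) (h x)) (x : E.carrier) (t : T.carrier) :
    homHomotopy cd c' (tmul x t) = tmul (h x) t + tmul (i (p (E.par x))) (h' t) := by
  refine homHomotopy_dualTmul cd c' (fun α => ?_) (fun α => ?_) t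
  · rw [bidual_par, bidual_apply, bidual_apply, ← cd.i_par, ← cd.p_par, hip, hip,
      map_even c.strict_p, map_even c.strict_i, map_odd c.strict_p, map_odd c.strict_i]
  · rw [bidual_par, bidual_apply, bidual_apply, ← neg_eq_iff_eq_neg.2 (cd.h_par α), c.even_h,
      c.odd_h, E.even_par, E.odd_par]
    have h1 : pair (-hd ((dual E).par α)) (-E.odd x) = pair (hd ((dual E).par α)) (E.odd x) := by
      rw [pair_neg]; exact neg_neg _
    rw [h1, hh, hh, (dual E).par_par]
    exact add_comm _ _

end IsParContraction

end Abstract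

end DGMod

section Tensors

variable {K : Type v} {R : Type w} [Field K] [CommRing R] [Algebra K R] {F : Distribution K R}
  {P S : Conn F}

open Forms

theorem isParContraction_self : DGMod.IsParContraction (functions F).self
    (complex (Conn.trivial F)) (AddMonoidHom.id _) (AddMonoidHom.id _) 0 :=
  DGMod.IsParContraction.refl (ext_ext (P := Conn.trivial F) Conn.isFlat_trivial)

/-- The form z is commuted to the front, regrouped with β, and commuted back. For odd z the two
exchanges do not involve the same factors, and the remaining sign is that of z with s, hence `par
s`. -/
theorem formDualTmul_even {β : (complex (Conn.dual P)).carrier} {s : (complex S).carrier}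
    {z : (complex P).carrier} (hz : (complex P).par z = z) :
    (wedgeHom (formDualTmul β s)).1 z = formPair β z • s := by
  have h1 := wedge_comm_even (LinearMap.id : (P.carrier →ₗ[R] S.carrier) →ₗ[R] _).flip
    LinearMap.id (fun _ _ => rfl) (formDualTmul β s) hz
  have h2 := wedge_comm_even (LinearMap.id : (P.carrier →ₗ[R] R) →ₗ[R] _).flip
    LinearMap.id (fun _ _ => rfl) β hz
  have h3 := wedge_assoc (act S.carrier) (LinearMap.id : (P.carrier →ₗ[R] R) →ₗ[R] _).flip
    (LinearMap.id : (P.carrier →ₗ[R] S.carrier) →ₗ[R] _).flip LinearMap.smulRightₗ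
    (fun x y z => by simp) z β s
  exact h1.symm.trans (h3.symm.trans (congrArg (fun a => wedge (act S.carrier) a s) h2))

theorem formDualTmul_odd {β : (complex (Conn.dual P)).carrier} {s : (complex S).carrier}
    {z : (complex P).carrier} (hz : (complex P).par z = -z) :
    (wedgeHom (formDualTmul β s)).1 z = formPair β z • (complex S).par s := by
  have h0 : formDualTmul ((complex (Conn.dual P)).par β) ((complex S).par s)
      = (complex (Conn.hom P S)).par (formDualTmul β s) := (par_wedge _ _ _).symm
  have h1 := wedge_comm_odd (LinearMap.id : (P.carrier →ₗ[R] S.carrier) →ₗ[R] _).flip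
    LinearMap.id (fun _ _ => rfl)
    (formDualTmul ((complex (Conn.dual P)).par β) ((complex S).par s)) hz
  have h2 := wedge_comm_odd (LinearMap.id : (P.carrier →ₗ[R] R) →ₗ[R] _).flip
    LinearMap.id (fun _ _ => rfl) ((complex (Conn.dual P)).par β) hz
  have h3 := wedge_assoc (act S.carrier) (LinearMap.id : (P.carrier →ₗ[R] R) →ₗ[R] _).flip
    (LinearMap.id : (P.carrier →ₗ[R] S.carrier) →ₗ[R] _).flip LinearMap.smulRightₗ
    (fun x y z => by simp) z ((complex (Conn.dual P)).par β) ((complex S).par s)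
  have h4 : Forms.par (formDualTmul ((complex (Conn.dual P)).par β) ((complex S).par s))
      = formDualTmul β s := by
    rw [h0]; exact Forms.par_par _
  have h5 : Forms.par ((complex (Conn.dual P)).par β) = β := Forms.par_par _
  rw [h4] at h1
  rw [h5] at h2
  exact h1.symm.trans (h3.symm.trans
    (congrArg (fun a => wedge (act S.carrier) a ((complex S).par s)) h2))

theorem wedgeHom_formDualTmul [CharZero K] (β : (complex (Conn.dual P)).carrier)
    (s : (complex S).carrier) (z : (complex P).carrier) :
    (wedgeHom (formDualTmul β s)).1 z = formPair β ((complex P).even z) • s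
      + formPair β ((complex P).odd z) • (complex S).par s := by
  refine (congrArg (wedgeHom (formDualTmul β s)).1 (DGMod.even_add_odd z).symm).trans ?_
  refine ((wedgeHom (formDualTmul β s)).1.map_add _ _).trans ?_
  rw [formDualTmul_even ((complex P).par_even z), formDualTmul_odd ((complex P).par_odd z)]

/-- The form with values in the bidual. -/
def formBidual (z : (complex P).carrier) : (complex (Conn.dual (Conn.dual P))).carrier :=
  map (Module.Dual.eval R P.carrier) z

/-- The counterpart for forms of the definition of `tmul` through the bidual. It lets vector factors
be treated by the formulas for covector factors. -/
theorem formTmul_eq (z : (complex P).carrier) (s : (complex S).carrier) :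
    formTmul z s = formDualTmul (formBidual z) s :=
  map_wedge (LinearMap.smulRightₗ ∘ₗ Module.Dual.eval R P.carrier) LinearMap.smulRightₗ
    LinearMap.id (Module.Dual.eval R P.carrier) LinearMap.id (fun _ _ => rfl) z s

theorem formPair_bidual (z : (complex P).carrier) (β : (complex (Conn.dual P)).carrier) :
    formPair (formBidual z) β = wedge (Module.Dual.eval R P.carrier) z β :=
  (map_wedge (Module.Dual.eval R P.carrier)
    (LinearMap.id : (Module.Dual R P.carrier →ₗ[R] R) →ₗ[R] _)
    LinearMap.id (Module.Dual.eval R P.carrier) LinearMap.id (fun _ _ => rfl) z β).symm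

/-- Exchanging z and β yields exactly the sign built into `bidual`. -/
theorem formPair_formBidual [CharZero K] (z : (complex P).carrier)
    (β : (complex (Conn.dual P)).carrier) :
    formPair (formBidual z) β = formPair β ((complex P).even z)
      + formPair ((complex (Conn.dual P)).par β) ((complex P).odd z) := by
  refine (formPair_bidual z β).trans ?_
  have h1 := wedge_comm_even (Module.Dual.eval R P.carrier) LinearMap.id (fun _ _ => rfl) β
    ((complex P).par_even z)
  have h2 := wedge_comm_odd (Module.Dual.eval R P.carrier) LinearMap.id (fun _ _ => rfl) β
    ((complex P).par_odd z)
  refine (congrArg (fun y => wedge (Module.Dual.eval R P.carrier) y β)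
    (DGMod.even_add_odd z).symm).trans ?_
  exact (wedge_add_left _ _ _ _).trans (congrArg₂ (· + ·) h1 h2)

namespace DGMod.IsParContraction

variable {E T : DGMod (functions F)} {p : E.carrier →+ (complex P).carrier}
  {i : (complex P).carrier →+ E.carrier} {h : E.carrier →+ E.carrier}
  {p' : T.carrier →+ (complex S).carrier} {i' : (complex S).carrier →+ T.carrier}
  {h' : T.carrier →+ T.carrier}

/-- The dual of the inclusion. -/
def dualProj (c : IsParContraction E (complex P) p i h) :
    (DGMod.dual E).carrier →+ (complex (Conn.dual P)).carrier := homProj c isParContraction_self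

/-- The dual of the projection. -/
def dualIncl (c : IsParContraction E (complex P) p i h) :
    (complex (Conn.dual P)).carrier →+ (DGMod.dual E).carrier := homIncl c isParContraction_self

/-- The dual of the homotopy. -/
def dualHomotopy (c : IsParContraction E (complex P) p i h) :
    (DGMod.dual E).carrier →+ (DGMod.dual E).carrier := homHomotopy c isParContraction_self

theorem pair_dualIncl (c : IsParContraction E (complex P) p i h)
    (β : (complex (Conn.dual P)).carrier) (x : E.carrier) :
    pair (c.dualIncl β) x = formPair β (p x) := rfl

theorem pair_dualHomotopy (c : IsParContraction E (complex P) p i h) (α : (DGMod.dual E).carrier)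
    (x : E.carrier) : pair (c.dualHomotopy α) x = pair ((DGMod.dual E).par α) (h x) :=
  add_zero _

theorem map_dualProj (c : IsParContraction E (complex P) p i h) (α : (DGMod.dual E).carrier)
    (z : P.carrier) :
    map (LinearMap.applyₗ z) (asForm (c.dualProj α)) = pair α (i (Forms.const z)) := rfl

theorem i_const_even (c : IsParContraction E (complex P) p i h) (z : P.carrier) :
    E.par (i (Forms.const z)) = i (Forms.const z) := 
  (c.i_par _).symm.trans (congrArg i (par_const z))

variable [CharZero K]

/-- The dual is the case of linear maps into Ω_F, contracted onto itself by the identity with zero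
homotopy. -/
theorem dual (hP : HasFrames R K P.carrier) (hR : Separated R K R)
    (c : IsParContraction E (complex P) p i h) :
    IsParContraction (DGMod.dual E) (complex (Conn.dual P)) c.dualProj c.dualIncl
      c.dualHomotopy :=
  homForms (S := Conn.trivial F) hP hR c isParContraction_self

/-- The form ψ^∨ α is constructed from the values of α ∘ ψ on constant sections. The frames of P
guarantee that the pairing is then correct on all forms z. -/
theorem formPair_dualProj (hP : HasFrames R K P.carrier) (hR : Separated R K R)
    (c : IsParContraction E (complex P) p i h) (α : (DGMod.dual E).carrier)
    (z : (complex P).carrier) : formPair (c.dualProj α) z = pair α (i z) :=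
  congrArg (fun f => f.1 z) (wedgeHom_symbol (S := Conn.trivial F) hP hR
    (homMap c.strict_i isParContraction_self.strict_p α))

theorem homProj_dualTmul (c : IsParContraction E (complex P) p i h)
    (c' : IsParContraction T (complex S) p' i' h') (α : (DGMod.dual E).carrier) (t : T.carrier) :
    homProj c c' (dualTmul α t) = formDualTmul (c.dualProj α) (p' t) := ext_dual fun z => by
  have h1 : map (LinearMap.applyₗ z) (asForm (homProj c c' (dualTmul α t)))
      = p' ((dualTmul α t).1 (i (Forms.const z))) := rfl
  refine h1.trans ?_
  -- A constant section is even, so only one of the two terms of the decomposable tensor survives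
  -- and no sign occurs.
  rw [dualTmul_apply, (even_of_par (c.i_const_even z)).1, (even_of_par (c.i_const_even z)).2]
  have h2 : pair α (0 : E.carrier) = 0 := α.1.map_zero
  rw [h2, zero_smul, add_zero, c'.p_smul]
  exact (map_wedge (LinearMap.smulRightₗ : (P.carrier →ₗ[R] R) →ₗ[R] _) (act S.carrier)
    (LinearMap.applyₗ z) (LinearMap.applyₗ z) LinearMap.id (fun _ _ => rfl)
    (asForm (c.dualProj α)) (asForm (p' t))).symm

theorem homIncl_formDualTmul (c : IsParContraction E (complex P) p i h)
    (c' : IsParContraction T (complex S) p' i' h') (β : (complex (Conn.dual P)).carrier)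
    (s : (complex S).carrier) :
    homIncl c c' (formDualTmul β s) = dualTmul (c.dualIncl β) (i' s) := hom_ext fun x => by
  have h1 : (homIncl c c' (formDualTmul β s)).1 x
      = i' ((wedgeHom (formDualTmul β s)).1 (p x)) := rfl
  rw [h1, wedgeHom_formDualTmul, dualTmul_apply, map_add, c'.i_smul, c'.i_smul, c'.i_par,
    ← map_even c.strict_p, ← map_odd c.strict_p]
  rfl

/-- Tested on a constant ζ, which is even; the two terms of the bidual then recombine to the value
of φ^∨ ζ at x. -/
theorem dualProj_bidual {φd : (complex (Conn.dual P)).carrier →+ (DGMod.dual E).carrier}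
    {ψd : (DGMod.dual E).carrier →+ (complex (Conn.dual P)).carrier}
    {hd : (DGMod.dual E).carrier →+ (DGMod.dual E).carrier}
    (cd : IsParContraction (DGMod.dual E) (complex (Conn.dual P)) ψd φd hd)
    (hφ : ∀ β x, pair (φd β) x = formPair β (p x)) (x : E.carrier) :
    cd.dualProj (bidual x) = formBidual (p x) := ext_dual fun ζ => by
  refine (cd.map_dualProj (bidual x) ζ).trans ?_
  rw [bidual_apply, cd.i_const_even ζ, ← pair_add, even_add_odd]
  refine (hφ _ x).trans ?_
  exact const_wedge_eq _ ζ (p x)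

theorem dualIncl_formBidual (c : IsParContraction E (complex P) p i h)
    {φd : (complex (Conn.dual P)).carrier →+ (DGMod.dual E).carrier}
    {ψd : (DGMod.dual E).carrier →+ (complex (Conn.dual P)).carrier}
    {hd : (DGMod.dual E).carrier →+ (DGMod.dual E).carrier}
    (cd : IsParContraction (DGMod.dual E) (complex (Conn.dual P)) ψd φd hd)
    (hψ : ∀ α z, formPair (ψd α) z = pair α (i z)) (z : (complex P).carrier) :
    cd.dualIncl (formBidual z) = bidual (i z) := hom_ext fun α => by
  refine (cd.pair_dualIncl (formBidual z) α).trans ((formPair_formBidual z (ψd α)).trans ?_)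
  rw [← cd.p_par, hψ, hψ, map_even c.strict_i, map_odd c.strict_i]
  rfl

end DGMod.IsParContraction

end Tensors

end FoliationDG
end

noncomputable section
namespace FoliationDG
universe u v w

/-! ### Recursion over the tensor powers -/

variable {K : Type v} {R : Type w} [Field K] [CommRing R] [Algebra K R] {F : Distribution K R}
  {P S : Conn F}

open Forms

theorem Separated.tens (hR : Separated R K R) : ∀ m n, Separated R K (P.tens m n).carrier
  | 0, 0 => hR
  | 0, n + 1 => (Separated.tens hR 0 n).linearMap
  | m + 1, n => (Separated.tens hR m n).linearMap

namespace DGMod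

/-- A contraction, with its data. -/
structure ParContraction (E Y : DGMod (functions F)) where
  /-- the projection -/
  p : E.carrier →+ Y.carrier
  /-- the inclusion -/
  i : Y.carrier →+ E.carrier
  /-- the homotopy -/
  h : E.carrier →+ E.carrier
  isPar : IsParContraction E Y p i h

namespace ParContraction

variable {E : DGMod (functions F)} [CharZero K] (hP : HasFrames R K P.carrier)
  (hR : Separated R K R)

/-- The contraction of the module of linear maps. -/
def hom {T : DGMod (functions F)} (hS : Separated R K S.carrier) (c : ParContraction E (complex P))
    (c' : ParContraction T (complex S)) :
    ParContraction (DGMod.hom E T) (complex (Conn.hom P S)) where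
  p := IsParContraction.homProj c.isPar c'.isPar
  i := IsParContraction.homIncl c.isPar c'.isPar
  h := IsParContraction.homHomotopy c.isPar c'.isPar
  isPar := IsParContraction.homForms hP hS c.isPar c'.isPar

/-- The contraction of the dual module. -/
def dual (c : ParContraction E (complex P)) :
    ParContraction (DGMod.dual E) (complex (Conn.dual P)) where
  p := c.isPar.dualProj
  i := c.isPar.dualIncl
  h := c.isPar.dualHomotopy
  isPar := c.isPar.dual hP hR

/-- The contraction of the modules of contravariant tensors. -/
def vecTens (c : ParContraction E (complex P)) :
    ∀ n, ParContraction (E.tens 0 n) (complex (P.tens 0 n))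
  | 0 => ⟨_, _, _, isParContraction_self⟩
  -- A vector factor is Hom out of the dual module, so the dual contraction and the dual frames are
  -- used here; a covector factor in `tens` uses the original ones.
  | n + 1 => hom (S := P.tens 0 n) hP.dual (hR.tens 0 n) (dual hP hR c) (vecTens c n)

/-- The contraction of the modules of tensors. -/
def tens (c : ParContraction E (complex P)) (n : ℕ) :
    ∀ m, ParContraction (E.tens m n) (complex (P.tens m n))
  | 0 => vecTens hP hR c n
  | m + 1 => hom (S := P.tens m n) hP (hR.tens m n) c (tens c n m)

end ParContraction

end DGMod

theorem isDual_dual [CharZero K] (hP : HasFrames R K (Conn.bott F).carrier) (hR : Separated R K R)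
    (c : DGMod.ParContraction (vect F) (complex (Conn.bott F))) :
    IsDual c.p c.i c.h (c.dual hP hR).i (c.dual hP hR).p (c.dual hP hR).h where
  phi_dual := c.isPar.pair_dualIncl
  psi_dual := c.isPar.formPair_dualProj hP hR
  h_dual := c.isPar.pair_dualHomotopy

/-- The recursive formulas are the decomposable-tensor computations at each stage. For vector
factors, the bidual lemmas identify the projection and inclusion of the contraction of the dual with
φ and ψ. -/
theorem isTensorTrick_tens [CharZero K] (hP : HasFrames R K (Conn.bott F).carrier)
    (hR : Separated R K R) (c : DGMod.ParContraction (vect F) (complex (Conn.bott F))) :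
    IsTensorTrick c.p c.i c.h (c.dual hP hR).i (c.dual hP hR).p (c.dual hP hR).h
      (fun m n => (c.tens hP hR n m).p) (fun m n => (c.tens hP hR n m).i)
      (fun m n => (c.tens hP hR n m).h) where
  Φ_zero _ := rfl
  Ψ_zero _ := rfl
  H_zero _ := rfl
  Φ_tmul n X t := by
    have h1 := (c.dual hP hR).isPar.homProj_dualTmul (S := (Conn.bott F).tens 0 n)
      (c.tens hP hR n 0).isPar (DGMod.bidual X) t
    rw [(c.dual hP hR).isPar.dualProj_bidual (isDual_dual hP hR c).phi_dual] at h1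
    exact h1.trans (formTmul_eq (S := (Conn.bott F).tens 0 n) _ _).symm
  Ψ_tmul n z s := by
    have h1 := (c.dual hP hR).isPar.homIncl_formDualTmul (S := (Conn.bott F).tens 0 n)
      (c.tens hP hR n 0).isPar (formBidual z) s
    rw [c.isPar.dualIncl_formBidual (c.dual hP hR).isPar (isDual_dual hP hR c).psi_dual] at h1
    exact (congrArg _ (formTmul_eq (S := (Conn.bott F).tens 0 n) z s)).trans h1
  H_tmul n X t := c.isPar.homHomotopy_tmul (c.dual hP hR).isPar (c.tens hP hR n 0).isPar
    (fun α X => ((isDual_dual hP hR c).phi_dual _ X).trans ((isDual_dual hP hR c).psi_dual α _))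
    (isDual_dual hP hR c).h_dual X t
  Φ_dualTmul m n := c.isPar.homProj_dualTmul (S := (Conn.bott F).tens m n)
    (c.tens hP hR n m).isPar
  Ψ_dualTmul m n := c.isPar.homIncl_formDualTmul (S := (Conn.bott F).tens m n)
    (c.tens hP hR n m).isPar
  H_dualTmul m n α t := c.isPar.homHomotopy_dualTmul (c.tens hP hR n m).isPar
    (fun X => ((isDual_dual hP hR c).phi_dual _ X).trans ((isDual_dual hP hR c).psi_dual _ _))
    ((isDual_dual hP hR c).h_dual α) t

theorem hasFrames_quot (j : Splitting F) : HasFrames R K F.Quot :=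
  hasFrames_derivation.of_retract j.map F.sections.mkQ j.mkQ_map

/-- The contraction of the vector fields. -/
def vectContraction [CharZero K] (hR : Separated R K R) (j : Splitting F) :
    DGMod.ParContraction (vect F) (complex (Conn.bott F)) where
  p := phi
  i := psi j
  h := homotopyMap j
  isPar :=
    { isContraction_vect hR j with
      p_par := phi_par
      i_par := psi_par j
      h_par := homotopyMap_par j }

end FoliationDG
end

noncomputable section
namespace FoliationDG
open Filter Topology

/-! ### Hadamard's lemma -/

section Hadamard

variable {E : Type*} [NormedAddCommGroup E] [NormedSpace ℝ E]
  {V : Type*} [NormedAddCommGroup V] [NormedSpace ℝ V]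

open MeasureTheory in
/-- The integral over `[0,1]` of a smooth function depends smoothly on parameters. -/
theorem contDiff_integral_unitInterval [CompleteSpace V] {G : E → ℝ → V}
    (hG : ContDiff ℝ ∞ ↿G) :
    ContDiff ℝ ∞ fun p => ∫ t in (0 : ℝ)..1, G p t := by
  -- The integral is the convolution at 0 of the indicator of (0, 1] with s ↦ G p (-s). The cutoff σ
  -- supplies the compact support in s required for smoothness, and equals 1 on [-1, 1], where s =
  -- -t lies.
  let σ : ContDiffBump (0 : ℝ) := ⟨1, 2, one_pos, one_lt_two⟩
  let f : ℝ → ℝ := Set.indicator (Set.Ioc 0 1) fun _ => 1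
  have hf : LocallyIntegrable f :=
    ((integrable_indicator_iff measurableSet_Ioc).2
      (integrableOn_const (by simp) (by simp))).locallyIntegrable
  have h1 : ContDiff ℝ ∞ ↿(fun (p : E) (s : ℝ) => σ s • G p (-s)) := by
    have h2 : ContDiff ℝ ∞ fun q : E × ℝ => G q.1 (-q.2) :=
      hG.comp (contDiff_fst.prodMk contDiff_snd.neg)
    exact (σ.contDiff.comp contDiff_snd).smul h2
  have key := contDiffOn_convolution_right_with_param_comp (μ := (volume : Measure ℝ)) (n := (⊤ : ℕ∞))
    (ContinuousLinearMap.lsmul ℝ ℝ : ℝ →L[ℝ] V →L[ℝ] V) (s := (Set.univ : Set E))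
    (v := fun _ => (0 : ℝ)) contDiffOn_const isOpen_univ (isCompact_closedBall (0 : ℝ) 2)
    (g := fun (p : E) (s : ℝ) => σ s • G p (-s)) (f := f)
    (fun p x _ hx => by
      have : σ x = 0 := σ.zero_of_le_dist (by
        have : ¬ dist x 0 ≤ 2 := hx
        exact (not_le.1 this).le)
      simp [this]) hf h1.contDiffOn
  rw [contDiffOn_univ] at key
  convert key using 2 with p
  rw [intervalIntegral.integral_of_le zero_le_one, ← integral_indicator measurableSet_Ioc]
  rw [MeasureTheory.convolution]
  congr 1
  ext t
  by_cases ht : t ∈ Set.Ioc (0 : ℝ) 1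
  · have : σ (0 - t) = 1 := σ.one_of_mem_closedBall (by
      simp [abs_of_pos ht.1, ht.2, σ])
    simp [f, ht, this, -zero_sub]
  · simp [f, ht]

/-- Hadamard's lemma. -/
theorem exists_hadamard [CompleteSpace V] {g : E → V} (hg : ContDiff ℝ ∞ g) (y₀ : E) :
    ∃ u : E → E →L[ℝ] V, ContDiff ℝ ∞ u ∧ u y₀ = fderiv ℝ g y₀ ∧
      ∀ y, g y = g y₀ + u y (y - y₀) := by
  have hd : ContDiff ℝ ∞ (fderiv ℝ g) := hg.fderiv_right (by simp)
  have hG : ContDiff ℝ ∞ ↿(fun (y : E) (t : ℝ) => fderiv ℝ g (y₀ + t • (y - y₀))) :=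
    hd.comp (contDiff_const.add (contDiff_snd.smul (contDiff_fst.sub contDiff_const)))
  -- The witness is u(y) = ∫₀¹ Dg(y₀ + t(y - y₀)) dt, from the fundamental theorem of calculus along
  -- the segment.
  refine ⟨_, contDiff_integral_unitInterval hG, by simp, fun y => ?_⟩
  have hcont : Continuous fun t : ℝ => fderiv ℝ g (y₀ + t • (y - y₀)) :=
    hd.continuous.comp (by fun_prop)
  rw [ContinuousLinearMap.intervalIntegral_apply (hcont.intervalIntegrable _ _)]
  have hderiv : ∀ t ∈ Set.uIcc (0 : ℝ) 1, HasDerivAt (fun t : ℝ => g (y₀ + t • (y - y₀)))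
      (fderiv ℝ g (y₀ + t • (y - y₀)) (y - y₀)) t := fun t _ => by
    have h1 := (hg.differentiable (by simp) (y₀ + t • (y - y₀))).hasFDerivAt
    have h2 : HasDerivAt (fun t : ℝ => y₀ + t • (y - y₀)) (y - y₀) t := by
      simpa using ((hasDerivAt_id t).smul_const (y - y₀)).const_add y₀
    exact h1.comp_hasDerivAt t h2
  rw [intervalIntegral.integral_eq_sub_of_hasDerivAt hderiv
    ((hcont.clm_apply continuous_const).intervalIntegrable _ _)]
  simp

end Hadamard

/-! ### Derivations of smooth functions in charts -/

section ChartFields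

variable {𝕂 : Type*} [RCLike 𝕂] {E : Type*} [NormedAddCommGroup E] [NormedSpace ℝ E]
  {M : Type*} [TopologicalSpace M] [ChartedSpace E M]

section Bump


/-- The product vanishes off the support of ρ, so the values of f outside U do not matter. -/
theorem contMDiff_mul_of_tsupport {ρ : smoothFunctions 𝕂 E M} {U : Set M} (hU : IsOpen U)
    (hρ : tsupport ρ.1 ⊆ U) {f : M → 𝕂} (hf : ContMDiffOn 𝓘(ℝ, E) 𝓘(ℝ, 𝕂) ∞ f U) :
    ContMDiff 𝓘(ℝ, E) 𝓘(ℝ, 𝕂) ∞ fun x => ρ.1 x * f x := by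
  refine contMDiff_of_tsupport fun x hx => ?_
  have hxU : x ∈ U := hρ (tsupport_mul_subset_left hx)
  have h1 : ContMDiffAt 𝓘(ℝ, E) 𝓘(ℝ, 𝕂) ∞ ρ.1 x := ρ.2 x
  have h2 := (hf x hxU).contMDiffAt (hU.mem_nhds hxU)
  exact (contDiff_mul (𝕜 := ℝ) (𝔸 := 𝕂) (n := ∞)).contMDiff.contMDiffAt.comp x
    (h1.prodMk_space h2)

variable [FiniteDimensional ℝ E] [IsManifold 𝓘(ℝ, E) ∞ M] [T2Space M]

theorem exists_bump (q : M) {U : Set M} (hU : U ∈ 𝓝 q) :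
    ∃ ρ : smoothFunctions 𝕂 E M, tsupport ρ.1 ⊆ U ∧ ρ.1 =ᶠ[𝓝 q] 1 := by
  obtain ⟨f, -, hf⟩ := (SmoothBumpFunction.nhds_basis_tsupport (I := 𝓘(ℝ, E)) q).mem_iff.1 hU
  refine ⟨⟨fun x => (f x : 𝕂), ?_⟩, ?_, ?_⟩
  · exact (RCLike.ofRealCLM (K := 𝕂)).contDiff.contMDiff.comp f.contMDiff
  · refine subset_trans (closure_mono fun x hx => ?_) hf
    simp only [Function.mem_support] at hx ⊢
    exact fun h => hx (by rw [h]; simp)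
  · filter_upwards [f.eventuallyEq_one] with x hx
    simp [hx]

theorem exists_extension {U : Set M} (hU : IsOpen U) {q : M} (hq : q ∈ U) {f : M → 𝕂}
    (hf : ContMDiffOn 𝓘(ℝ, E) 𝓘(ℝ, 𝕂) ∞ f U) :
    ∃ g : smoothFunctions 𝕂 E M, g.1 =ᶠ[𝓝 q] f := by
  obtain ⟨ρ, hρ, h1⟩ := exists_bump (𝕂 := 𝕂) (E := E) q (hU.mem_nhds hq)
  refine ⟨⟨_, contMDiff_mul_of_tsupport hU hρ hf⟩, ?_⟩
  filter_upwards [h1] with x hx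
  simp [hx]

/-- Locality of derivations: with ρ supported where f = g, the product ρ(f - g) vanishes
identically, and the Leibniz rule at q, where ρ = 1, gives X(f - g)(q) = 0. -/
theorem derivation_congr (X : SectionsK 𝕂 E M) {q : M} {f g : smoothFunctions 𝕂 E M}
    (h : f.1 =ᶠ[𝓝 q] g.1) : (X f).1 q = (X g).1 q := by
  obtain ⟨ρ, hρ, h1⟩ := exists_bump (𝕂 := 𝕂) (E := E) q h
  have h0 : ρ * (f - g) = 0 := by
    refine Subtype.ext (funext fun x => ?_)
    show ρ.1 x * (f.1 x - g.1 x) = 0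
    by_cases hx : x ∈ tsupport ρ.1
    · rw [show f.1 x = g.1 x from hρ hx, sub_self, mul_zero]
    · rw [image_eq_zero_of_notMem_tsupport hx, zero_mul]
  have h2 : ρ.1 q * ((X f).1 q - (X g).1 q) + (f.1 q - g.1 q) * (X ρ).1 q = 0 := by
    have := congrArg (fun r : smoothFunctions 𝕂 E M => r.1 q) (X.leibniz ρ (f - g))
    rw [h0, map_zero, map_sub] at this
    exact this.symm
  rw [h.eq_of_nhds, sub_self, zero_mul, add_zero, h1.eq_of_nhds] at h2
  simpa [sub_eq_zero] using h2

/-- The vector field `ρ ∂_v` in a chart. -/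
def chartField (p : M) (ρ : smoothFunctions 𝕂 E M) (hρ : tsupport ρ.1 ⊆ (chartAt E p).source)
    (v : E) : SectionsK 𝕂 E M :=
  have hd : ∀ (f : smoothFunctions 𝕂 E M) (x : M), x ∈ (chartAt E p).source →
      DifferentiableAt ℝ (f.1 ∘ (chartAt E p).symm) (chartAt E p x) := fun f x hx => by
    have h := (chartAt E p).map_source hx
    have h1 : ContMDiffOn 𝓘(ℝ, E) 𝓘(ℝ, 𝕂) ∞ (f.1 ∘ (chartAt E p).symm) (chartAt E p).target :=
      (show ContMDiff 𝓘(ℝ, E) 𝓘(ℝ, 𝕂) ∞ f.1 from f.2).comp_contMDiffOn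
        contMDiffOn_chart_symm
    exact ((contMDiffOn_iff_contDiffOn.1 h1).contDiffAt
      ((chartAt E p).open_target.mem_nhds h)).differentiableAt (by simp)
  Derivation.mk'
    { toFun := fun f => ⟨fun x => ρ.1 x *
          fderiv ℝ (f.1 ∘ (chartAt E p).symm) (chartAt E p x) v,
        contMDiff_mul_of_tsupport (chartAt E p).open_source hρ (by
          have h1 : ContMDiffOn 𝓘(ℝ, E) 𝓘(ℝ, 𝕂) ∞ (f.1 ∘ (chartAt E p).symm)
              (chartAt E p).target :=
            (show ContMDiff 𝓘(ℝ, E) 𝓘(ℝ, 𝕂) ∞ f.1 from f.2).comp_contMDiffOn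
              contMDiffOn_chart_symm
          have h2 : ContDiffOn ℝ ∞ (fun y => fderiv ℝ (f.1 ∘ (chartAt E p).symm) y v)
              (chartAt E p).target :=
            ((contMDiffOn_iff_contDiffOn.1 h1).fderiv_of_isOpen (chartAt E p).open_target
              (by simp)).clm_apply contDiffOn_const
          exact (contMDiffOn_iff_contDiffOn.2 h2).comp contMDiffOn_chart
            fun x hx => (chartAt E p).map_source hx)⟩
      map_add' := fun f g => Subtype.ext (funext fun x => by
        by_cases hx : x ∈ tsupport ρ.1
        · have h := fderiv_add (hd f x (hρ hx)) (hd g x (hρ hx))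
          show ρ.1 x * fderiv ℝ (f.1 ∘ (chartAt E p).symm + g.1 ∘ (chartAt E p).symm) _ v
            = ρ.1 x * _ + ρ.1 x * _
          rw [h, _root_.add_apply, mul_add]
        · show ρ.1 x * _ = ρ.1 x * _ + ρ.1 x * _
          rw [image_eq_zero_of_notMem_tsupport hx]; simp)
      map_smul' := fun c f => Subtype.ext (funext fun x => by
        by_cases hx : x ∈ tsupport ρ.1
        · have h := fderiv_const_smul (hd f x (hρ hx)) c
          show ρ.1 x * fderiv ℝ (c • (f.1 ∘ (chartAt E p).symm)) _ v = c * (ρ.1 x * _)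
          rw [h, _root_.smul_apply, smul_eq_mul]; ring
        · show ρ.1 x * _ = c * (ρ.1 x * _)
          rw [image_eq_zero_of_notMem_tsupport hx]; simp) }
    (fun f g => Subtype.ext (funext fun x => by
      by_cases hx : x ∈ tsupport ρ.1
      · have h := fderiv_mul (hd f x (hρ hx)) (hd g x (hρ hx))
        show ρ.1 x * fderiv ℝ ((f.1 ∘ (chartAt E p).symm) * (g.1 ∘ (chartAt E p).symm)) _ v
          = f.1 x * (ρ.1 x * _) + g.1 x * (ρ.1 x * _)
        rw [h]
        simp only [Function.comp_apply, _root_.add_apply,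
          _root_.smul_apply, smul_eq_mul, (chartAt E p).left_inv (hρ hx)]
        ring
      · show ρ.1 x * _ = f.1 x * (ρ.1 x * _) + g.1 x * (ρ.1 x * _)
        rw [image_eq_zero_of_notMem_tsupport hx]; simp))

omit [FiniteDimensional ℝ E] [T2Space M] in
theorem chartField_apply (p : M) (ρ : smoothFunctions 𝕂 E M)
    (hρ : tsupport ρ.1 ⊆ (chartAt E p).source) (v : E) (f : smoothFunctions 𝕂 E M) (x : M) :
    (chartField p ρ hρ v f).1 x
      = ρ.1 x * fderiv ℝ (f.1 ∘ (chartAt E p).symm) (chartAt E p x) v := rfl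

/-- A derivation is determined, near a point, by its values on coordinate functions. -/
theorem derivation_apply_eq_sum (X : SectionsK 𝕂 E M) (p : M) {q : M}
    (hq : q ∈ (chartAt E p).source) {ι : Type*} [Fintype ι] (b : Module.Basis ι ℝ E)
    (x : ι → smoothFunctions 𝕂 E M)
    (hx : ∀ i, (x i).1 =ᶠ[𝓝 q] fun m => ((b.repr (chartAt E p m) i : ℝ) : 𝕂))
    (f : smoothFunctions 𝕂 E M) :
    (X f).1 q = ∑ i, (X (x i)).1 q
      * fderiv ℝ (f.1 ∘ (chartAt E p).symm) (chartAt E p q) (b i) := by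
  have hy := (chartAt E p).map_source hq
  set y₀ := chartAt E p q with hy₀
  obtain ⟨ε, hε, hball⟩ := Metric.isOpen_iff.1 (chartAt E p).open_target y₀ hy
  -- The function is only controlled on the chart target. Cutting it off inside a ball contained
  -- there gives a smooth function on all of E, to which Hadamard's lemma applies.
  let ρ : ContDiffBump y₀ := ⟨ε / 4, ε / 2, by positivity, by linarith⟩
  have h1 : ContDiffOn ℝ ∞ (f.1 ∘ (chartAt E p).symm) (chartAt E p).target :=
    contMDiffOn_iff_contDiffOn.1
      ((show ContMDiff 𝓘(ℝ, E) 𝓘(ℝ, 𝕂) ∞ f.1 from f.2).comp_contMDiffOn contMDiffOn_chart_symm)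
  let g : E → 𝕂 := fun y => ρ y • (f.1 ∘ (chartAt E p).symm) y
  have hg : ContDiff ℝ ∞ g := by
    rw [contDiff_iff_contDiffAt]
    intro y
    by_cases hy : y ∈ Metric.ball y₀ ε
    · exact ρ.contDiff.contDiffAt.smul
        (h1.contDiffAt ((chartAt E p).open_target.mem_nhds (hball hy)))
    · have hev : g =ᶠ[𝓝 y] fun _ => 0 := by
        have : (Metric.closedBall y₀ (ε / 2))ᶜ ∈ 𝓝 y :=
          Metric.isClosed_closedBall.isOpen_compl.mem_nhds fun h => hy
            (Metric.closedBall_subset_ball (by linarith) h)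
        filter_upwards [this] with z hz
        have : ρ z = 0 := ρ.zero_of_le_dist (by
          have : ¬ dist z y₀ ≤ ε / 2 := hz
          exact (not_le.1 this).le)
        simp [g, this]
      exact contDiffAt_const.congr_of_eventuallyEq hev
  have hgf : g =ᶠ[𝓝 y₀] f.1 ∘ (chartAt E p).symm := by
    filter_upwards [ρ.eventuallyEq_one] with y hy
    simp [g, hy]
  obtain ⟨u, hu, hu0, hgu⟩ := exists_hadamard hg y₀
  have hext : ∀ i, ∃ w : smoothFunctions 𝕂 E M,
      w.1 =ᶠ[𝓝 q] fun m => u (chartAt E p m) (b i) := fun i =>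
    exists_extension (chartAt E p).open_source hq
      ((hu.clm_apply contDiff_const).contMDiff.comp_contMDiffOn contMDiffOn_chart)
  choose w hw using hext
  let c : 𝕂 → smoothFunctions 𝕂 E M := algebraMap 𝕂 _
  -- Hadamard's expansion f = f(q) + ∑ (xᵢ - xᵢ(q)) wᵢ near q, with every ingredient extended to a
  -- global smooth function.
  let F : smoothFunctions 𝕂 E M :=
    c (g y₀) + ∑ i, (x i - c ((b.repr y₀ i : ℝ) : 𝕂)) * w i
  have hF : f.1 =ᶠ[𝓝 q] F.1 := by
    have hcont : Filter.Tendsto (chartAt E p) (𝓝 q) (𝓝 y₀) := (chartAt E p).continuousAt hq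
    filter_upwards [hcont.eventually hgf, (chartAt E p).open_source.mem_nhds hq,
      Filter.eventually_all.2 hx, Filter.eventually_all.2 hw] with m hm hms hxm hwm
    have hFm : F.1 m = g y₀ + ∑ i, ((x i).1 m - ((b.repr y₀ i : ℝ) : 𝕂)) * (w i).1 m := by
      have : F.1 = (c (g y₀)).1 + ∑ i, ((x i - c ((b.repr y₀ i : ℝ) : 𝕂)) * w i).1 := by
        simp only [F]
        exact congrArg ((c (g y₀)).1 + ·) (map_sum (smoothFunctions 𝕂 E M).val _ _)
      rw [this, Pi.add_apply, Finset.sum_apply]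
      rfl
    have h3 : f.1 m = g (chartAt E p m) := by
      rw [hm, Function.comp_apply, (chartAt E p).left_inv hms]
    rw [h3, hgu, hFm]
    congr 1
    conv_lhs => rw [← b.sum_repr (chartAt E p m - y₀), map_sum]
    refine Finset.sum_congr rfl fun i _ => ?_
    rw [hxm, hwm, map_smul, map_sub, Finsupp.sub_apply, RCLike.real_smul_eq_coe_mul]
    push_cast
    ring
  rw [derivation_congr X hF]
  have hXF : X F = ∑ i, ((x i - c ((b.repr y₀ i : ℝ) : 𝕂)) * X (w i) + w i * X (x i)) := by
    simp only [F, map_add, map_sum, c, Derivation.map_algebraMap, zero_add, Derivation.leibniz,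
      map_sub, sub_zero, smul_eq_mul]
  have hval : (X F).1 q = ∑ i, (((x i).1 q - ((b.repr y₀ i : ℝ) : 𝕂)) * (X (w i)).1 q
      + (w i).1 q * (X (x i)).1 q) := by
    rw [hXF]
    have := congrFun (map_sum (smoothFunctions 𝕂 E M).val
      (fun i => (x i - c ((b.repr y₀ i : ℝ) : 𝕂)) * X (w i) + w i * X (x i)) Finset.univ) q
    rw [Finset.sum_apply] at this
    exact this
  rw [hval]
  refine Finset.sum_congr rfl fun i _ => ?_
  -- At q the factors xᵢ - xᵢ(q) vanish, and wᵢ(q) is the i-th partial derivative of f.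
  rw [(hx i).eq_of_nhds, (hw i).eq_of_nhds, ← hy₀, sub_self, zero_mul, zero_add, hu0,
    hgf.fderiv_eq, mul_comm]

/-- Two nested bump functions: ρ, supported in the chart, makes the coordinates and coordinate
fields global; χ is supported where ρ is 1 in a neighbourhood, so that there the cut-off coordinates
and fields have their true germs. -/
theorem exists_isChartFn (p : M) : ∃ χ : smoothFunctions 𝕂 E M, χ.1 p = 1 ∧ IsChartFn 𝕂 χ := by
  obtain ⟨ρ, hρ, hρ1⟩ := exists_bump (𝕂 := 𝕂) (E := E) p (chart_source_mem_nhds E p)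
  obtain ⟨χ, hχ, hχ1⟩ := exists_bump (𝕂 := 𝕂) (E := E) p (eventually_eventually_nhds.2 hρ1)
  let b := Module.finBasis ℝ E
  have hsm : ∀ i, ContMDiffOn 𝓘(ℝ, E) 𝓘(ℝ, 𝕂) ∞
      (fun m => ((b.repr (chartAt E p m) i : ℝ) : 𝕂)) (chartAt E p).source := fun i => by
    have h1 : ContDiff ℝ ∞ fun y : E => ((b.repr y i : ℝ) : 𝕂) :=
      (RCLike.ofRealCLM (K := 𝕂)).contDiff.comp
        (LinearMap.toContinuousLinearMap (b.coord i)).contDiff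
    exact h1.contMDiff.comp_contMDiffOn contMDiffOn_chart
  let x : Fin (Module.finrank ℝ E) → smoothFunctions 𝕂 E M := fun i =>
    ⟨_, contMDiff_mul_of_tsupport (chartAt E p).open_source hρ (hsm i)⟩
  refine ⟨χ, hχ1.eq_of_nhds, _, x, fun i => chartField p ρ hρ (b i), fun X => ?_⟩
  refine Derivation.ext fun f => Subtype.ext (funext fun q => ?_)
  have hsum : (χ • ∑ i, X (x i) • chartField p ρ hρ (b i)) f
      = χ * ∑ i, X (x i) * chartField p ρ hρ (b i) f := by
    simp only [Derivation.smul_apply, smul_eq_mul, derivation_sum_apply]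
  have hs : (∑ i, X (x i) * chartField p ρ hρ (b i) f).1 q
      = ∑ i, (X (x i)).1 q * (ρ.1 q *
        fderiv ℝ (f.1 ∘ (chartAt E p).symm) (chartAt E p q) (b i)) := by
    have := congrFun (map_sum (smoothFunctions 𝕂 E M).val
      (fun i => X (x i) * chartField p ρ hρ (b i) f) Finset.univ) q
    rw [Finset.sum_apply] at this
    exact this
  rw [hsum]
  show χ.1 q * (X f).1 q = χ.1 q * (∑ i, X (x i) * chartField p ρ hρ (b i) f).1 q
  rw [hs]
  by_cases hq : q ∈ tsupport χ.1
  · have h1 : ρ.1 =ᶠ[𝓝 q] 1 := hχ hq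
    have hqs : q ∈ (chartAt E p).source := hρ (subset_closure (by
      rw [Function.mem_support, h1.eq_of_nhds]; exact one_ne_zero))
    rw [derivation_apply_eq_sum X p hqs b x (fun i => by
      filter_upwards [h1] with m hm
      show ρ.1 m * _ = _
      rw [hm, Pi.one_apply, one_mul]) f, h1.eq_of_nhds]
    simp
  · rw [image_eq_zero_of_notMem_tsupport hq, zero_mul, zero_mul]

variable (𝕂 E M) in
-- At p, a relation χ^k r = 0 with χ(p) = 1 forces r(p) = 0.
theorem separated_smoothFunctions : Separated (smoothFunctions 𝕂 E M) 𝕂 (smoothFunctions 𝕂 E M) :=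
  fun r hr => Subtype.ext (funext fun p => by
    obtain ⟨χ, h1, hχ⟩ := exists_isChartFn (𝕂 := 𝕂) (E := E) p
    obtain ⟨k, hk⟩ := hr χ hχ
    have : χ.1 p ^ k * r.1 p = 0 := congrArg (fun f : smoothFunctions 𝕂 E M => f.1 p) hk
    simpa [h1] using this)

end Bump

end ChartFields
end FoliationDG
end

/-! ### The theorem for integrable distributions on manifolds -/

theorem mainTheorem5 {𝕂 : Type*} [RCLike 𝕂] {E : Type*} [NormedAddCommGroup E] [NormedSpace ℝ E]
    [FiniteDimensional ℝ E] {M : Type*} [TopologicalSpace M] [ChartedSpace E M]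
    [IsManifold 𝓘(ℝ, E) ∞ M] [T2Space M] [SecondCountableTopology M]
    (D : ∀ x : M, Submodule 𝕂 (TangentK 𝕂 E x)) (hD : IsSubbundle D) (hinv : IsInvolutive D)
    (j : Splitting (distributionOf D hinv)) :
    let F := distributionOf D hinv
    ∃ (ψ : (complex (Conn.bott F)).carrier →+ (vect F).carrier)
      (h : (vect F).carrier →+ (vect F).carrier)
      (φd : (complex (Conn.dual (Conn.bott F))).carrier →+ (DGMod.dual (vect F)).carrier)
      (ψd : (DGMod.dual (vect F)).carrier →+ (complex (Conn.dual (Conn.bott F))).carrier)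
      (hd : (DGMod.dual (vect F)).carrier →+ (DGMod.dual (vect F)).carrier)
      (Φ : ∀ m n, ((vect F).tens m n).carrier →+ (complex ((Conn.bott F).tens m n)).carrier)
      (Ψ : ∀ m n, (complex ((Conn.bott F).tens m n)).carrier →+ ((vect F).tens m n).carrier)
      (H : ∀ m n, ((vect F).tens m n).carrier →+ ((vect F).tens m n).carrier),
      IsPsi j ψ ∧ IsHomotopy j h ∧
      DGMod.IsContraction (vect F) (complex (Conn.bott F)) phi ψ h ∧
      IsDual phi ψ h φd ψd hd ∧
      DGMod.IsContraction (DGMod.dual (vect F)) (complex (Conn.dual (Conn.bott F))) ψd φd hd ∧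
      IsTensorTrick phi ψ h φd ψd hd Φ Ψ H ∧
      ∀ m n, DGMod.IsContraction ((vect F).tens m n) (complex ((Conn.bott F).tens m n))
        (Φ m n) (Ψ m n) (H m n) := by
  intro F
  have hR : Separated (smoothFunctions 𝕂 E M) 𝕂 (smoothFunctions 𝕂 E M) :=
    separated_smoothFunctions 𝕂 E M
  have hP : HasFrames (smoothFunctions 𝕂 E M) 𝕂 (Conn.bott F).carrier := hasFrames_quot j
  -- The contraction of vector fields is the only input; the dual and tensor contractions are
  -- generated from it. In `c.tens` the arguments n and m are exchanged, as the recursion runs over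
  -- the covector factors.
  let c := vectContraction hR j
  exact ⟨psi j, homotopyMap j, (c.dual hP hR).i, (c.dual hP hR).p, (c.dual hP hR).h,
    fun m n => (c.tens hP hR n m).p, fun m n => (c.tens hP hR n m).i,
    fun m n => (c.tens hP hR n m).h, isPsi_psi j, isHomotopy_homotopyMap j,
    c.isPar.toIsContraction, isDual_dual hP hR c, (c.dual hP hR).isPar.toIsContraction,
    isTensorTrick_tens hP hR c, fun m n => (c.tens hP hR n m).isPar.toIsContraction⟩
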